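/- **Setting.** Let $T>0$; let $f\in C^2_b(\mathbb R)$ (bounded with bounded derivatives up to order two) with $\inf f>0$; let $\sigma:\mathbb R\to\mathbb R$ be bounded and Lipschitz with $\inf\sigma>0$; let $\bar\gamma:\mathbb R\to\mathbb R$ be bounded and continuous with $\iota\le\bar\gamma\le 1/f-\iota$ for some $\iota>0$. Let $\bar\Gamma\in C^2(\mathbb R)$ satisfy $\bar\Gamma''=\bar\gamma$, and let $g:\mathbb R\to\mathbb R$ be lower semicontinuous and bounded below, with $g^+$ of linear growth. Put $\hat g:=(g-\bar\Gamma)^{\rm conc}+\bar\Gamma$, where $^{\rm conc}$ is the concave envelope, and assume that $\hat g$ is uniformly continuous. Let $$F(x,q,M):=\min\Big\{-q-\frac{\sigma^2(x)M}{2(1-f(x)M)},\ \bar\gamma(x)-M\Big\},$$ $$F^{\epsilon}_{\kappa}(x,q,M):=\inf_{x'\in D^{\epsilon}_{\kappa}(x)}F(x',q,M),\qquad D^\epsilon_\kappa(x):=\{x'\in\mathbb R:\ (x-x')/\kappa(x')\in[-\epsilon,\epsilon]\}.$$ **Viscosity solutions.** For $G\in\{F,F^\epsilon_\kappa\}$ and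 $h:\mathbb R\to\mathbb R$, a viscosity solution of $$G(x,\partial_t\varphi,\partial^2_{xx}\varphi)\mathbf 1_{[0,T)}+(\varphi-h)\mathbf 1_{\{T\}}=0\quad\text{on }[0,T]\times\mathbb R \qquad (G,h)$$ is a locally bounded function whose upper (resp. lower) semicontinuous envelope on $[0,T]\times\mathbb R$ is a viscosity subsolution (resp. supersolution), with $C^2$ test functions, of $G=0$ on $[0,T)\times\mathbb R$ and of $\min\{G,\varphi-h\}=0$ (resp. $\max\{G,\varphi-h\}=0$) on $\{T\}\times\mathbb R$. A function $u$ on $[0,T]\times\mathbb R$ has linear growth if $|u(t,x)|\le C(1+|x|)$ for some constant $C$. **Approximation schemes.** An approximation scheme consists of $\epsilon_\circ\in(0,1)$ and, for each $K>0$, of a uniformly continuous $\hat g_K:\mathbb R\to\mathbb R$, a number $x_K\ge K$ and $\kappa_K\in C^\infty(\mathbb R)$ such that: (i) $\hat g_K$ is affine on $[x_K,\infty)$ and on $(-\infty,-x_K]$, $\hat g_K=\hat g$ on $[-K,K]$, $\hat g_K\ge\hat g$ on $\mathbb R$, and $\hat g_K-\Gamma$ is concave for every $\Gamma\in C^2(\mathbb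 R)$ with $\Gamma''=\bar\gamma$; (ii) $|\hat g_K(x)|\le C(1+|x|)$ for all $x$ and $K$, with $C$ independent of $K$; (iii) all derivatives of $\kappa_K$ of order at least one are bounded, $\inf\kappa_K>0$, $\kappa_K=|\hat g_K|+1$ on $\{|x|\ge x_K\}$, and $-1/\epsilon_\circ<\kappa_K'<1/\epsilon_\circ$. We call the weights $(\kappa_K)$ locally bounded if for every $R$ there is $C_R$ such that $\kappa_K\le C_R$ on $[-R,R]$ for all large $K$. **Proposition.** Approximation schemes with locally bounded weights exist. There is a continuous function $\bar{\rm v}_{\bar\gamma}$ on $[0,T]\times\mathbb R$ with linear growth which is a viscosity solution of $(F,\hat g)$, i.e. of the pricing equation with terminal condition $\hat g$; it satisfies $\bar{\rm v}_{\bar\gamma}(T,\cdot)=\hat g$, and it is the only viscosity solution (continuous or not) of $(F,\hat g)$ with linear growth. Moreover, for every approximation scheme: 1. for all $\epsilon\in[0,\epsilon_\circ]$ and $K>0$ there is a unique continuous viscosity solution $\bar{\rm v}^{\epsilon,K}$ of $(F^\epsilon_{\kappa_K},\hat g_K+\epsilon)$ with linear growth; 2. if the weights are locally bounded, then $\bar{\rm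 v}^{\epsilon,K}\to\bar{\rm v}_{\bar\gamma}$ locally uniformly on $[0,T]\times\mathbb R$ as $(\epsilon,K)\to(0+,\infty)$ jointly; 3. without that condition, $\bar{\rm v}^{\epsilon,K}\to\bar{\rm v}^{0,K}$ as $\epsilon\to0+$ for each fixed $K>0$, and $\bar{\rm v}^{0,K}\to\bar{\rm v}_{\bar\gamma}$ as $K\to\infty$, both locally uniformly on $[0,T]\times\mathbb R$. -/

import Mathlib

open Set Filter Topology

namespace GammaPricing

noncomputable section

/-! ### Face-lifted payoff -/

/-- Concave envelope of `h`: the pointwise infimum of the concave majorants of `h`. -/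
def concaveEnvelope (h : ℝ → ℝ) (x : ℝ) : ℝ :=
  sInf {y : ℝ | ∃ φ : ℝ → ℝ, ConcaveOn ℝ univ φ ∧ (∀ z, h z ≤ φ z) ∧ y = φ x}

/-- `Γ` is a twice continuously differentiable function with second derivative `γ`. -/
def IsSecondPrimitive (γ Γ : ℝ → ℝ) : Prop :=
  ContDiff ℝ 2 Γ ∧ ∀ x, iteratedDeriv 2 Γ x = γ x

/-- The face-lift `(g - Γ)^conc + Γ` of the payoff `g`. -/
def faceLift (Γ g : ℝ → ℝ) (x : ℝ) : ℝ :=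
  concaveEnvelope (fun z => g z - Γ z) x + Γ x

/-! ### Standing assumptions on the coefficients and the payoff -/

/-- Standing assumptions: `T` maturity, `f` impact function, `σ` volatility, `γ` gamma bound,
`g` payoff, and `Γ` any second primitive of `γ`, used to compute the face-lift of `g`. -/
structure StandingAssumptions (T : ℝ) (f σ γ Γ g : ℝ → ℝ) : Prop where
  T_pos : 0 < T
  f_contDiff : ContDiff ℝ 2 f
  f_bounded : ∀ n : ℕ, n ≤ 2 → ∃ C : ℝ, ∀ x, |iteratedDeriv n f x| ≤ C
  f_inf_pos : ∃ c : ℝ, 0 < c ∧ ∀ x, c ≤ f x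
  sigma_lipschitz : ∃ L : NNReal, LipschitzWith L σ
  sigma_bounded : ∃ C : ℝ, ∀ x, |σ x| ≤ C
  sigma_inf_pos : ∃ c : ℝ, 0 < c ∧ ∀ x, c ≤ σ x
  gamma_continuous : Continuous γ
  gamma_bounded : ∃ C : ℝ, ∀ x, |γ x| ≤ C
  gamma_gap : ∃ ι : ℝ, 0 < ι ∧ ∀ x, ι ≤ γ x ∧ γ x ≤ 1 / f x - ι
  secondPrimitive : IsSecondPrimitive γ Γ
  g_lsc : LowerSemicontinuous g
  g_bddBelow : ∃ C : ℝ, ∀ x, -C ≤ g x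
  g_growth : ∃ C : ℝ, ∀ x, g x ≤ C * (1 + |x|)
  faceLift_uniformContinuous : UniformContinuous (faceLift Γ g)

/-! ### The pricing operator and its version with shaken coefficients -/

/-- `F(x, q, M) = min { -q - σ(x)² M / (2 (1 - f(x) M)), γ(x) - M }`.
Where `1 - f(x) M ≤ 0` one has `M > γ(x)`, so that `F < 0` because of the second entry, whatever
value is given to the quotient. -/
def pricingF (f σ γ : ℝ → ℝ) (x q M : ℝ) : ℝ :=
  min (-q - σ x ^ 2 * M / (2 * (1 - f x * M))) (γ x - M)

/-- `D(x) = { x' : (x - x') / κ(x') ∈ [-ε, ε] }`. -/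
def shakenSet (κ : ℝ → ℝ) (ε x : ℝ) : Set ℝ :=
  {x' : ℝ | (x - x') / κ x' ∈ Icc (-ε) ε}

/-- `min_{x' ∈ D(x)} F(x', q, M)`, as an infimum in the extended reals (for some `M > γ` the
quotient in `F` is unbounded on `D(x)`, and the infimum is then `-∞`). -/
def shakenF (f σ γ κ : ℝ → ℝ) (ε : ℝ) (x q M : ℝ) : EReal :=
  ⨅ x' ∈ shakenSet κ ε x, ((pricingF f σ γ x' q M : ℝ) : EReal)

/-! ### Viscosity solutions of parabolic terminal value problems

Functions of `(t, x)` are functions on `ℝ × ℝ`, and only their values on `[0, T] × ℝ` matter.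
An operator is a function `G` of `(x, q, M)`, where `q` stands for the time derivative and `M` for
the second space derivative. -/

/-- The domain `[0, T] × ℝ`. -/
def strip (T : ℝ) : Set (ℝ × ℝ) := Icc 0 T ×ˢ univ

/-- `∂_t φ`. -/
def timeDeriv (φ : ℝ × ℝ → ℝ) (p : ℝ × ℝ) : ℝ := deriv (fun t => φ (t, p.2)) p.1

/-- `∂²_{xx} φ`. -/
def spaceDeriv2 (φ : ℝ × ℝ → ℝ) (p : ℝ × ℝ) : ℝ := iteratedDeriv 2 (fun x => φ (p.1, x)) p.2

/-- Viscosity subsolution on `[0, T] × ℝ` of `G[φ] 1_{t < T} + (φ - h) 1_{t = T} = 0`: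
upper semicontinuous, subsolution of `G = 0` on `[0, T) × ℝ` and of `min {G, φ - h} = 0` on
`{T} × ℝ`. -/
structure IsViscositySubsolution (T : ℝ) (G : ℝ → ℝ → ℝ → EReal) (h : ℝ → ℝ)
    (u : ℝ × ℝ → ℝ) : Prop where
  usc : UpperSemicontinuousOn u (strip T)
  interior : ∀ φ : ℝ × ℝ → ℝ, ContDiff ℝ 2 φ → ∀ p ∈ strip T, p.1 < T →
    IsLocalMaxOn (fun z => u z - φ z) (strip T) p →
      G p.2 (timeDeriv φ p) (spaceDeriv2 φ p) ≤ 0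
  terminal : ∀ φ : ℝ × ℝ → ℝ, ContDiff ℝ 2 φ → ∀ p ∈ strip T, p.1 = T →
    IsLocalMaxOn (fun z => u z - φ z) (strip T) p →
      min (G p.2 (timeDeriv φ p) (spaceDeriv2 φ p)) ((u p - h p.2 : ℝ) : EReal) ≤ 0

/-- Viscosity supersolution on `[0, T] × ℝ` of `G[φ] 1_{t < T} + (φ - h) 1_{t = T} = 0`:
lower semicontinuous, supersolution of `G = 0` on `[0, T) × ℝ` and of `max {G, φ - h} = 0` on
`{T} × ℝ`. -/
structure IsViscositySupersolution (T : ℝ) (G : ℝ → ℝ → ℝ → EReal) (h : ℝ → ℝ)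
    (u : ℝ × ℝ → ℝ) : Prop where
  lsc : LowerSemicontinuousOn u (strip T)
  interior : ∀ φ : ℝ × ℝ → ℝ, ContDiff ℝ 2 φ → ∀ p ∈ strip T, p.1 < T →
    IsLocalMinOn (fun z => u z - φ z) (strip T) p →
      0 ≤ G p.2 (timeDeriv φ p) (spaceDeriv2 φ p)
  terminal : ∀ φ : ℝ × ℝ → ℝ, ContDiff ℝ 2 φ → ∀ p ∈ strip T, p.1 = T →
    IsLocalMinOn (fun z => u z - φ z) (strip T) p →
      0 ≤ max (G p.2 (timeDeriv φ p) (spaceDeriv2 φ p)) ((u p - h p.2 : ℝ) : EReal)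

/-- Linear growth in `x`, uniformly in `t ∈ [0, T]`. -/
def HasLinearGrowth (T : ℝ) (u : ℝ × ℝ → ℝ) : Prop :=
  ∃ C : ℝ, ∀ p ∈ strip T, |u p| ≤ C * (1 + |p.2|)

/-- Upper semicontinuous envelope on `[0, T] × ℝ` of a locally bounded function. -/
def uscEnvelope (T : ℝ) (u : ℝ × ℝ → ℝ) (p : ℝ × ℝ) : ℝ := limsup u (𝓝[strip T] p)

/-- Lower semicontinuous envelope on `[0, T] × ℝ` of a locally bounded function. -/
def lscEnvelope (T : ℝ) (u : ℝ × ℝ → ℝ) (p : ℝ × ℝ) : ℝ := liminf u (𝓝[strip T] p)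

/-- `u` is a (possibly discontinuous) viscosity solution with linear growth: its upper and lower
semicontinuous envelopes are a sub- and a supersolution. On `[0, T] × ℝ` a continuous function
equals its envelopes. -/
structure IsLinearGrowthSolution (T : ℝ) (G : ℝ → ℝ → ℝ → EReal) (h : ℝ → ℝ)
    (u : ℝ × ℝ → ℝ) : Prop where
  growth : HasLinearGrowth T u
  sub : IsViscositySubsolution T G h (uscEnvelope T u)
  super : IsViscositySupersolution T G h (lscEnvelope T u)

/-- `u` is the unique continuous viscosity solution with linear growth. -/
def IsUniqueContinuousSolution (T : ℝ) (G : ℝ → ℝ → ℝ → EReal) (h : ℝ → ℝ)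
    (u : ℝ × ℝ → ℝ) : Prop :=
  (ContinuousOn u (strip T) ∧ IsLinearGrowthSolution T G h u) ∧
    ∀ w : ℝ × ℝ → ℝ, ContinuousOn w (strip T) → IsLinearGrowthSolution T G h w →
      EqOn w u (strip T)

/-! ### The approximation parameters -/

/-- `gK`, for `K > 0`, are approximations of the face-lifted payoff `ghat` that are affine outside
`[-xK, xK]`, and `κ K` are the weights that scale the shaking of the coefficients, with
`ε₀ ∈ (0, 1)`. -/
structure IsApproximationScheme (γ ghat : ℝ → ℝ) (ε₀ : ℝ) (gK : ℝ → ℝ → ℝ) (xK : ℝ → ℝ)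
    (κ : ℝ → ℝ → ℝ) : Prop where
  eps_pos : 0 < ε₀
  eps_lt_one : ε₀ < 1
  gK_uniformContinuous : ∀ K > 0, UniformContinuous (gK K)
  le_xK : ∀ K > 0, K ≤ xK K
  gK_affine_right : ∀ K > 0, ∃ a b : ℝ, ∀ x, xK K ≤ x → gK K x = a + b * x
  gK_affine_left : ∀ K > 0, ∃ a b : ℝ, ∀ x, x ≤ -xK K → gK K x = a + b * x
  gK_eq : ∀ K > 0, ∀ x ∈ Icc (-K) K, gK K x = ghat x
  le_gK : ∀ K > 0, ∀ x, ghat x ≤ gK K x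
  gK_concave : ∀ K > 0, ∀ Γ : ℝ → ℝ, IsSecondPrimitive γ Γ →
    ConcaveOn ℝ univ (fun x => gK K x - Γ x)
  gK_growth : ∃ C : ℝ, ∀ K > 0, ∀ x, |gK K x| ≤ C * (1 + |x|)
  kappa_smooth : ∀ K > 0, ContDiff ℝ ((⊤ : ℕ∞) : WithTop ℕ∞) (κ K)
  kappa_derivs_bounded : ∀ K > 0, ∀ n : ℕ, 1 ≤ n → ∃ C : ℝ, ∀ x, |iteratedDeriv n (κ K) x| ≤ C
  kappa_inf_pos : ∀ K > 0, ∃ c : ℝ, 0 < c ∧ ∀ x, c ≤ κ K x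
  kappa_eq : ∀ K > 0, ∀ x, xK K ≤ |x| → κ K x = |gK K x| + 1
  kappa_slope : ∀ K > 0, ∀ x, -(1 / ε₀) < deriv (κ K) x ∧ deriv (κ K) x < 1 / ε₀

/-- The weights `κ K` are bounded on compact sets, uniformly in large `K`. -/
def LocallyBoundedWeights (κ : ℝ → ℝ → ℝ) : Prop :=
  ∀ R : ℝ, ∃ C : ℝ, ∀ᶠ K in atTop, ∀ x ∈ Icc (-R) R, κ K x ≤ C

end

end GammaPricing

/-! Everything rests on a comparison principle proved without doubling of variables. Two features of
the operator make this possible. On `M ≤ γ`, the part `drift` is bounded, nondecreasing and convex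
in `M`. And the constraint `M ≤ γ` bounds the second space derivative of every supersolution from
above. Shaken and unshaken equations are treated together as `infOperator` over a compact-valued
Lipschitz family of base points.

Regularising a supersolution. Before `T` it is semiconcave in space (`concaveOn_slice`). Its lower
limit at `T` inherits the gamma constraint (`terminalLimit_constraint`), so it can be continued past
`T`, decreasing in time at the rate `driftBound`, and stays a supersolution (`extend`).
Inf-convolution in time alone then keeps the equation, whose coefficients do not depend on time
(`infConv_super`), and yields semiconcavity in each variable separately. Differentiability of
monotone functions and Fubini give expansions almost everywhere (`ae_expansion`), and there the
inequality holds pointwise (`nonneg_of_expansion`). Replacing the convex `drift` by a tangent makes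
the inequality linear, so it passes to mollifications (`mollify_super`).

Comparison and stability. A small multiple of an explicit strict supersolution with quadratic growth
is mixed into the mollified function. The result is a smooth strict supersolution, which serves as
test function for any subsolution of linear growth (`IsViscositySupersolution.eventually_le`).
Strictness leaves room to perturb the base points and the terminal value; the same lemma thus gives
comparison (`le_extendSuper`) and the upper half of the convergence. The lower half is immediate:
shaking lowers the operator and the approximate payoffs lie above the limit, so the approximations
are supersolutions of the limit problem (`tendsto_solution`).

Existence. Perron's method runs between `h - driftBound * (T - t)` and a smooth hyperbola plus
`driftBound * (T - t)`. Comparing the Perron function with the extension of its lower envelope gives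
continuity up to `T` (`exists_solution`). The relaxed terminal condition would allow a subsolution
to exceed `h` at `T`. For the face-lifted payoff this cannot happen, because `h + driftBound * (T -
t)` is itself a supersolution (`subsolution_terminal_le`); this also gives uniqueness among
discontinuous solutions.

Schemes. The face-lift is Lipschitz. It is continued outside `[-K, K]` by an infimum of functions
whose slope is that of `Γ` plus a constant, truncated to `[-L, L]` (`exists_majorant`). Mollifying
the positive part of the result plus one gives the weights (`exists_scheme`). -/

namespace GammaPricing

/-! ### The operator -/

/-- The second-order part of the pricing operator. -/
noncomputable def drift (f σ : ℝ → ℝ) (x M : ℝ) : ℝ := σ x ^ 2 * M / (2 * (1 - f x * M))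

/-- Quantitative bounds on the coefficients. -/
structure CoeffBounds (f σ γ : ℝ → ℝ) (c B ι : ℝ) : Prop where
  f_cont : Continuous f
  sigma_cont : Continuous σ
  gamma_cont : Continuous γ
  c_pos : 0 < c
  iota_pos : 0 < ι
  le_f : ∀ x, c ≤ f x
  sigma_le : ∀ x, |σ x| ≤ B
  iota_le : ∀ x, ι ≤ γ x
  gamma_le : ∀ x, γ x ≤ 1 / f x - ι

/-- The infimum of the pricing operator over a set of base points. -/
noncomputable def infOperator (f σ γ : ℝ → ℝ) (D : ℝ → Set ℝ) (x q M : ℝ) : EReal :=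
  ⨅ x' ∈ D x, ((pricingF f σ γ x' q M : ℝ) : EReal)

/-- A compact-valued Lipschitz multifunction with `x ∈ D x`. -/
structure IsLipschitzFamily (D : ℝ → Set ℝ) (L : ℝ) : Prop where
  mem_self : ∀ x, x ∈ D x
  compact : ∀ x, IsCompact (D x)
  nonneg : 0 ≤ L
  lip : ∀ x y, ∀ x' ∈ D x, ∃ y' ∈ D y, |y' - x'| ≤ L * |y - x|

theorem isLipschitzFamily_singleton : IsLipschitzFamily (fun x => {x}) 1 where
  mem_self x := rfl
  compact x := isCompact_singleton
  nonneg := zero_le_one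
  lip x y x' hx := by
    rw [mem_singleton_iff] at hx
    subst hx
    exact ⟨y, rfl, by simp⟩

/-- The pricing equation thus becomes the case of a singleton family, and everything proved for
shaken operators applies to it. -/
theorem infOperator_singleton (f σ γ : ℝ → ℝ) :
    infOperator f σ γ (fun x => {x}) =
      fun x q M => ((pricingF f σ γ x q M : ℝ) : EReal) := by
  funext x q M
  simp [infOperator]

theorem pricingF_eq (f σ γ : ℝ → ℝ) (x q M : ℝ) :
    pricingF f σ γ x q M = min (-q - drift f σ x M) (γ x - M) := rfl

/-- The uniform bound of the second-order part. -/
noncomputable def driftBound (c B ι : ℝ) : ℝ := B ^ 2 * (2 / (c ^ 2 * ι) + 1 / c)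

/-! ### Bounds, monotonicity and convexity of the second-order part -/

section
variable {f σ γ : ℝ → ℝ} {c B ι : ℝ}

theorem CoeffBounds.f_pos (hb : CoeffBounds f σ γ c B ι) (x : ℝ) : 0 < f x :=
  hb.c_pos.trans_le (hb.le_f x)

theorem CoeffBounds.gamma_le_inv (hb : CoeffBounds f σ γ c B ι) (x : ℝ) : γ x ≤ 1 / c - ι := by
  have h1 := hb.gamma_le x
  have h2 : 1 / f x ≤ 1 / c := one_div_le_one_div_of_le hb.c_pos (hb.le_f x)
  linarith

/-- The gap `ι` between `γ` and `1 / f` keeps the denominator away from zero. Only half of it is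
spent, so that `M` may exceed `γ x` by the errors of frozen coefficients and mollification. -/
theorem CoeffBounds.denom_pos (hb : CoeffBounds f σ γ c B ι) {x M : ℝ} (hM : M ≤ γ x + ι / 2) :
    c * ι / 2 ≤ 1 - f x * M := by
  have hf := hb.f_pos x
  have h1 := hb.gamma_le x
  have h2 : M ≤ 1 / f x - ι / 2 := by linarith
  have h3 : f x * M ≤ f x * (1 / f x - ι / 2) := mul_le_mul_of_nonneg_left h2 hf.le
  have h4 : f x * (1 / f x - ι / 2) = 1 - f x * ι / 2 := by field_simp
  have h5 : c * ι ≤ f x * ι := mul_le_mul_of_nonneg_right (hb.le_f x) hb.iota_pos.le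
  linarith

theorem CoeffBounds.denom_pos' (hb : CoeffBounds f σ γ c B ι) {x M : ℝ} (hM : M ≤ γ x + ι / 2) :
    0 < 1 - f x * M :=
  lt_of_lt_of_le (by have := hb.c_pos; have := hb.iota_pos; positivity) (hb.denom_pos hM)

/-- There is no lower bound on `M`: for `M ≥ 0` the numerator is at most `1 / c` and the denominator
is bounded below, while for `M ≤ 0` the ratio saturates, in absolute value, at `1 / f x`. Hence
`drift` is bounded, and functions of slope `driftBound` in time serve as barriers. -/
theorem CoeffBounds.abs_ratio_le (hb : CoeffBounds f σ γ c B ι) {x M : ℝ}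
    (hM : M ≤ γ x + ι / 2) : |M / (1 - f x * M)| ≤ 2 / (c ^ 2 * ι) + 1 / c := by
  have hc := hb.c_pos
  have hι := hb.iota_pos
  have hd := hb.denom_pos' hM
  have hd2 := hb.denom_pos hM
  have hf := hb.f_pos x
  have hg := hb.gamma_le_inv x
  have hA : 0 < 2 / (c ^ 2 * ι) := by positivity
  have hC : 0 < 1 / c := by positivity
  rcases le_total 0 M with h | h
  · rw [abs_of_nonneg (div_nonneg h hd.le), div_le_iff₀ hd]
    have h1 : M ≤ 1 / c := by linarith
    have h2 : 2 / (c ^ 2 * ι) * (c * ι / 2) ≤ 2 / (c ^ 2 * ι) * (1 - f x * M) :=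
      mul_le_mul_of_nonneg_left hd2 hA.le
    have h3 : 2 / (c ^ 2 * ι) * (c * ι / 2) = 1 / c := by field_simp
    have h4 : 0 ≤ 1 / c * (1 - f x * M) := by positivity
    nlinarith
  · rw [abs_of_nonpos (div_nonpos_of_nonpos_of_nonneg h hd.le), ← neg_div, div_le_iff₀ hd]
    have h1 : -M * c ≤ -M * f x := mul_le_mul_of_nonneg_left (hb.le_f x) (by linarith)
    have h2 : -M = 1 / c * (-M * c) := by field_simp
    have h3 : 1 / c * (-M * c) ≤ 1 / c * (-M * f x) := mul_le_mul_of_nonneg_left h1 hC.le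
    have h4 : 0 ≤ 2 / (c ^ 2 * ι) * (1 - f x * M) := by positivity
    nlinarith

theorem drift_eq (f σ : ℝ → ℝ) (x M : ℝ) :
    drift f σ x M = σ x ^ 2 / 2 * (M / (1 - f x * M)) := by
  unfold drift
  rw [div_mul_div_comm]

theorem CoeffBounds.sigma_sq_le (hb : CoeffBounds f σ γ c B ι) (x : ℝ) : σ x ^ 2 ≤ B ^ 2 :=
  sq_le_sq' (neg_le_of_abs_le (hb.sigma_le x)) (le_of_abs_le (hb.sigma_le x))

theorem CoeffBounds.abs_drift_le (hb : CoeffBounds f σ γ c B ι) {x M : ℝ}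
    (hM : M ≤ γ x + ι / 2) : |drift f σ x M| ≤ driftBound c B ι := by
  rw [drift_eq, abs_mul, abs_of_nonneg (by positivity), driftBound]
  have := hb.sigma_sq_le x
  exact mul_le_mul (by nlinarith [sq_nonneg B]) (hb.abs_ratio_le hM) (abs_nonneg _) (sq_nonneg B)

theorem CoeffBounds.driftBound_nonneg (hb : CoeffBounds f σ γ c B ι) : 0 ≤ driftBound c B ι := by
  have := hb.c_pos
  have := hb.iota_pos
  unfold driftBound
  positivity

theorem CoeffBounds.drift_mono (hb : CoeffBounds f σ γ c B ι) {x M N : ℝ} (hMN : M ≤ N)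
    (hN : N ≤ γ x + ι / 2) : drift f σ x M ≤ drift f σ x N := by
  rw [drift_eq, drift_eq]
  have hd := hb.denom_pos' hN
  have hd' := hb.denom_pos' (hMN.trans hN)
  refine mul_le_mul_of_nonneg_left ?_ (by positivity)
  rw [div_le_div_iff₀ hd' hd]
  nlinarith

/-- Tangent inequality for the convex function `drift f σ x`. -/
theorem CoeffBounds.drift_tangent (hb : CoeffBounds f σ γ c B ι) {x M N : ℝ}
    (hM : M ≤ γ x + ι / 2) (hN : N ≤ γ x + ι / 2) :
    drift f σ x N + σ x ^ 2 / 2 / (1 - f x * N) ^ 2 * (M - N) ≤ drift f σ x M := by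
  have hd := hb.denom_pos' hN
  have hd' := hb.denom_pos' hM
  have hf := hb.f_pos x
  have hdn := hd.ne'
  have hdn' := hd'.ne'
  rw [drift_eq, drift_eq]
  -- The remainder of the tangent at `N` is an explicit square over positive denominators.
  have h : M / (1 - f x * M) - N / (1 - f x * N) - (M - N) / (1 - f x * N) ^ 2 =
      f x * (M - N) ^ 2 / ((1 - f x * M) * (1 - f x * N) ^ 2) := by
    rw [div_sub_div _ _ hdn' hdn, div_sub_div _ _ (mul_ne_zero hdn' hdn) (pow_ne_zero 2 hdn),
      div_eq_div_iff (mul_ne_zero (mul_ne_zero hdn' hdn) (pow_ne_zero 2 hdn))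
        (mul_ne_zero hdn' (pow_ne_zero 2 hdn))]
    ring
  have h2 : 0 ≤ f x * (M - N) ^ 2 / ((1 - f x * M) * (1 - f x * N) ^ 2) := by positivity
  have h3 : 0 ≤ σ x ^ 2 / 2 := by positivity
  have h4 : σ x ^ 2 / 2 / (1 - f x * N) ^ 2 * (M - N) =
    σ x ^ 2 / 2 * ((M - N) / (1 - f x * N) ^ 2) := by ring
  rw [h4, ← mul_add]
  exact mul_le_mul_of_nonneg_left (by linarith) h3

/-- Convexity along the segment joining `M` to `N`. -/
theorem CoeffBounds.drift_convex (hb : CoeffBounds f σ γ c B ι) {x M N lam : ℝ}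
    (hM : M ≤ γ x + ι / 2) (hN : N ≤ γ x + ι / 2) (h0 : 0 ≤ lam) (h1 : lam ≤ 1) :
    drift f σ x (lam * M + (1 - lam) * N) ≤ lam * drift f σ x M + (1 - lam) * drift f σ x N := by
  set P := lam * M + (1 - lam) * N with hP
  have hPd : P ≤ γ x + ι / 2 := by nlinarith
  -- Both tangents are taken at the mixed point `P`, so that their linear terms cancel after
  -- weighting.
  have e1 := hb.drift_tangent hM hPd
  have e2 := hb.drift_tangent hN hPd
  set b := σ x ^ 2 / 2 / (1 - f x * P) ^ 2
  have e3 := mul_le_mul_of_nonneg_left e1 h0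
  have e4 := mul_le_mul_of_nonneg_left e2 (sub_nonneg.2 h1)
  have e5 : lam * (drift f σ x P + b * (M - P)) + (1 - lam) * (drift f σ x P + b * (N - P)) =
      drift f σ x P := by
    rw [hP]; ring
  linarith

/-- The difference of the two ratios is `f x - f y` times their product (`key`), and each ratio is
bounded independently of `M`. The modulus of continuity in the base point is therefore uniform in
`M`. -/
theorem CoeffBounds.abs_drift_sub_le (hb : CoeffBounds f σ γ c B ι) {x y M : ℝ}
    (hx : M ≤ γ x + ι / 2) (hy : M ≤ γ y + ι / 2) :
    |drift f σ x M - drift f σ y M| ≤ (2 / (c ^ 2 * ι) + 1 / c) * |σ x ^ 2 - σ y ^ 2| +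
      B ^ 2 * (2 / (c ^ 2 * ι) + 1 / c) ^ 2 * |f x - f y| := by
  have hdx := hb.denom_pos' hx
  have hdy := hb.denom_pos' hy
  have rx := hb.abs_ratio_le hx
  have ry := hb.abs_ratio_le hy
  have hs := hb.sigma_sq_le y
  set Q := 2 / (c ^ 2 * ι) + 1 / c
  have hdn := hdx.ne'
  have hdn' := hdy.ne'
  rw [drift_eq, drift_eq]
  have key : M / (1 - f x * M) - M / (1 - f y * M) =
      (f x - f y) * (M / (1 - f x * M)) * (M / (1 - f y * M)) := by
    rw [div_sub_div _ _ hdn hdn', mul_assoc, div_mul_div_comm, ← mul_div_assoc]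
    congr 1
    ring
  have e : σ x ^ 2 / 2 * (M / (1 - f x * M)) - σ y ^ 2 / 2 * (M / (1 - f y * M)) =
      (σ x ^ 2 - σ y ^ 2) * (M / (1 - f x * M)) / 2 +
        σ y ^ 2 / 2 * ((f x - f y) * (M / (1 - f x * M)) * (M / (1 - f y * M))) := by
    rw [← key]; ring
  have hQ : 0 ≤ Q := (abs_nonneg _).trans rx
  rw [e]
  refine (abs_add_le _ _).trans (add_le_add ?_ ?_)
  · rw [abs_div, abs_mul, abs_two]
    have : |σ x ^ 2 - σ y ^ 2| * |M / (1 - f x * M)| ≤ |σ x ^ 2 - σ y ^ 2| * Q :=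
      mul_le_mul_of_nonneg_left rx (abs_nonneg _)
    have : 0 ≤ |σ x ^ 2 - σ y ^ 2| * Q := by positivity
    linarith
  · rw [abs_mul, abs_mul, abs_mul, abs_of_nonneg (by positivity : 0 ≤ σ y ^ 2 / 2)]
    have h1 : |M / (1 - f x * M)| * |M / (1 - f y * M)| ≤ Q * Q :=
      mul_le_mul rx ry (abs_nonneg _) hQ
    calc σ y ^ 2 / 2 * (|f x - f y| * |M / (1 - f x * M)| * |M / (1 - f y * M)|)
        = (σ y ^ 2 / 2) * |f x - f y| * (|M / (1 - f x * M)| * |M / (1 - f y * M)|) := by ring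
      _ ≤ B ^ 2 * |f x - f y| * (Q * Q) := by
          refine mul_le_mul (mul_le_mul_of_nonneg_right ?_ (abs_nonneg _)) h1 (by positivity)
            (by positivity)
          nlinarith [sq_nonneg B]
      _ = B ^ 2 * Q ^ 2 * |f x - f y| := by ring

/-- On compact sets the coefficients are continuous uniformly in `M`. -/
theorem CoeffBounds.uniform (hb : CoeffBounds f σ γ c B ι) (R : ℝ) {ω : ℝ} (hω : 0 < ω) :
    ∃ ρ > 0, ∀ x y, |x| ≤ R → |y - x| ≤ ρ → |γ y - γ x| ≤ ω ∧
      ∀ M, M ≤ γ x + ι / 2 → M ≤ γ y + ι / 2 → |drift f σ y M - drift f σ x M| ≤ ω := by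
  have hc := hb.c_pos
  have hι := hb.iota_pos
  set Q := 2 / (c ^ 2 * ι) + 1 / c with hQ
  have hQ0 : 0 < Q := by positivity
  -- The common tolerance will be `ω / A`: the oscillations of `σ ^ 2` and `f` enter with the
  -- weights `Q` and `B ^ 2 * Q ^ 2`, and the `1` makes `A ≥ 1`, which is what `γ` needs.
  set A := Q + B ^ 2 * Q ^ 2 + 1 with hA
  have hA1 : 0 < A := by positivity
  have hAle : 1 ≤ A := by rw [hA]; nlinarith [mul_nonneg (sq_nonneg B) (sq_nonneg Q)]
  have hu : ∀ k : ℝ → ℝ, Continuous k → ∃ ρ > 0, ∀ x y, |x| ≤ R → |y - x| ≤ ρ →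
      |k y - k x| ≤ ω / A := by
    intro k hk
    have h1 := (isCompact_Icc (a := -R - 1) (b := R + 1)).uniformContinuousOn_of_continuous
      hk.continuousOn
    rw [Metric.uniformContinuousOn_iff] at h1
    obtain ⟨ρ, hρ, h⟩ := h1 (ω / A) (by positivity)
    refine ⟨min 1 (ρ / 2), by positivity, fun x y hx hy => ?_⟩
    have hy1 := abs_le.1 (hy.trans (min_le_left _ _))
    have hx1 := abs_le.1 hx
    have := h y ⟨by linarith, by linarith⟩ x ⟨by linarith, by linarith⟩
      (by rw [Real.dist_eq]; exact (hy.trans (min_le_right _ _)).trans_lt (by linarith))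
    exact this.le
  obtain ⟨r1, hr1, h1⟩ := hu γ hb.gamma_cont
  obtain ⟨r2, hr2, h2⟩ := hu (fun x => σ x ^ 2) (hb.sigma_cont.pow 2)
  obtain ⟨r3, hr3, h3⟩ := hu f hb.f_cont
  refine ⟨min r1 (min r2 r3), by positivity, fun x y hx hy => ⟨?_, fun M hM hM' => ?_⟩⟩
  · exact (h1 x y hx (hy.trans (min_le_left _ _))).trans (div_le_self hω.le hAle)
  · have e2 := h2 x y hx (hy.trans ((min_le_right _ _).trans (min_le_left _ _)))
    have e3 := h3 x y hx (hy.trans ((min_le_right _ _).trans (min_le_right _ _)))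
    have e := hb.abs_drift_sub_le hM' hM
    rw [← hQ] at e
    have e4 := mul_le_mul_of_nonneg_left e2 hQ0.le
    have e5 := mul_le_mul_of_nonneg_left e3 (by positivity : 0 ≤ B ^ 2 * Q ^ 2)
    have e6 : Q * (ω / A) + B ^ 2 * Q ^ 2 * (ω / A) ≤ A * (ω / A) := by
      have : 0 < ω / A := by positivity
      rw [hA]; nlinarith
    have e7 : A * (ω / A) = ω := by field_simp
    linarith

/-! ### Signs of the pricing operator -/

theorem CoeffBounds.pricingF_neg_of_large (hb : CoeffBounds f σ γ c B ι) {x q M : ℝ}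
    (hq : driftBound c B ι < q) : pricingF f σ γ x q M < 0 := by
  rw [pricingF_eq]
  rcases lt_or_ge (γ x) M with h | h
  · exact (min_le_right _ _).trans_lt (by linarith)
  · have := abs_le.1 (hb.abs_drift_le (h.trans (by linarith [hb.iota_pos] : γ x ≤ γ x + ι / 2)))
    exact (min_le_left _ _).trans_lt (by linarith)

theorem CoeffBounds.pricingF_nonpos_of_large (hb : CoeffBounds f σ γ c B ι) {x q M : ℝ}
    (hq : driftBound c B ι ≤ q) : pricingF f σ γ x q M ≤ 0 := by
  rw [pricingF_eq]
  rcases lt_or_ge (γ x) M with h | h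
  · exact (min_le_right _ _).trans (by linarith)
  · have := abs_le.1 (hb.abs_drift_le (h.trans (by linarith [hb.iota_pos] : γ x ≤ γ x + ι / 2)))
    exact (min_le_left _ _).trans (by linarith)

theorem CoeffBounds.pricingF_nonneg_of_small (hb : CoeffBounds f σ γ c B ι) {x q M : ℝ}
    (hq : q ≤ -driftBound c B ι) (hM : M ≤ γ x) : 0 ≤ pricingF f σ γ x q M := by
  rw [pricingF_eq]
  have := abs_le.1 (hb.abs_drift_le (hM.trans (by linarith [hb.iota_pos] : γ x ≤ γ x + ι / 2)))
  exact le_min (by linarith) (by linarith)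

/-- Only negativity is monotone, not the operator itself: past the pole of the quotient the first
entry changes sign, but the second entry is negative as soon as `M' > γ x`. -/
theorem CoeffBounds.pricingF_neg_mono (hb : CoeffBounds f σ γ c B ι) {x q M q' M' : ℝ}
    (h : pricingF f σ γ x q M < 0) (hq : q ≤ q') (hM : M ≤ M') : pricingF f σ γ x q' M' < 0 := by
  rw [pricingF_eq] at h ⊢
  rcases lt_or_ge (γ x) M' with h1 | h1
  · exact (min_le_right _ _).trans_lt (by linarith)
  · have := hb.drift_mono hM (h1.trans (by linarith [hb.iota_pos] : γ x ≤ γ x + ι / 2))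
    rcases min_lt_iff.1 h with h2 | h2
    · exact (min_le_left _ _).trans_lt (by linarith)
    · exact (min_le_right _ _).trans_lt (by linarith)

theorem CoeffBounds.continuousAt_pricingF (hb : CoeffBounds f σ γ c B ι) {x q M : ℝ}
    (hM : M ≤ γ x) :
    ContinuousAt (fun z : ℝ × ℝ × ℝ => pricingF f σ γ z.1 z.2.1 z.2.2) (x, q, M) := by
  have hd := (hb.denom_pos' (hM.trans (by linarith [hb.iota_pos] : γ x ≤ γ x + ι / 2))).ne'
  have hf := hb.f_cont
  have hs := hb.sigma_cont
  have hg := hb.gamma_cont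
  unfold pricingF
  refine Filter.Tendsto.min (ContinuousAt.tendsto ?_) (ContinuousAt.tendsto (by fun_prop))
  refine ContinuousAt.sub (by fun_prop) (ContinuousAt.div (by fun_prop) (by fun_prop) ?_)
  simpa using hd

theorem CoeffBounds.eventually_pricingF_neg (hb : CoeffBounds f σ γ c B ι) {x q M : ℝ}
    (h : pricingF f σ γ x q M < 0) :
    ∀ᶠ z : ℝ × ℝ × ℝ in 𝓝 (x, q, M), pricingF f σ γ z.1 z.2.1 z.2.2 < 0 := by
  rcases lt_or_ge (γ x) M with h1 | h1
  · have hg := hb.gamma_cont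
    have : ∀ᶠ z : ℝ × ℝ × ℝ in 𝓝 (x, q, M), γ z.1 < z.2.2 :=
      ContinuousAt.eventually_lt (by fun_prop) (by fun_prop) h1
    filter_upwards [this] with z hz
    rw [pricingF_eq]
    exact (min_le_right _ _).trans_lt (by linarith)
  · exact (hb.continuousAt_pricingF h1).eventually_lt continuousAt_const h

/-- A value above `a ≥ 0` forces `M < γ x`, which is away from the pole; there the operator is
continuous. -/
theorem CoeffBounds.eventually_lt_pricingF (hb : CoeffBounds f σ γ c B ι) {x q M a : ℝ}
    (ha : 0 ≤ a) (h : a < pricingF f σ γ x q M) :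
    ∀ᶠ z : ℝ × ℝ × ℝ in 𝓝 (x, q, M), a < pricingF f σ γ z.1 z.2.1 z.2.2 := by
  have h1 : M ≤ γ x := by
    rw [pricingF_eq] at h
    have := h.trans_le (min_le_right _ _)
    linarith
  exact continuousAt_const.eventually_lt (hb.continuousAt_pricingF h1) h

/-! ### Signs of the infimum over base points -/

variable {D : ℝ → Set ℝ} {L : ℝ}

theorem infOperator_nonneg_iff {x q M : ℝ} :
    0 ≤ infOperator f σ γ D x q M ↔ ∀ x' ∈ D x, 0 ≤ pricingF f σ γ x' q M := by
  simp [infOperator, le_iInf_iff]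

theorem infOperator_neg_iff {x q M : ℝ} :
    infOperator f σ γ D x q M < 0 ↔ ∃ x' ∈ D x, pricingF f σ γ x' q M < 0 := by
  rw [← not_le, infOperator_nonneg_iff]
  push Not
  rfl

/-- A uniform margin `a` is needed, since an infimum of positive numbers may vanish. The viscosity
inequalities involve only the sign of the operator, so its possible value `-∞` is harmless. -/
theorem infOperator_pos_iff {x q M : ℝ} :
    0 < infOperator f σ γ D x q M ↔ ∃ a > 0, ∀ x' ∈ D x, a ≤ pricingF f σ γ x' q M := by
  constructor
  · intro h
    obtain ⟨a, ha, ha'⟩ := EReal.lt_iff_exists_real_btwn.1 h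
    refine ⟨a, by exact_mod_cast ha, fun x' hx' => ?_⟩
    have := ha'.le.trans (iInf₂_le x' hx')
    exact_mod_cast this
  · rintro ⟨a, ha, h⟩
    refine lt_of_lt_of_le (b := (a : EReal)) (by exact_mod_cast ha) ?_
    exact le_iInf₂ fun x' hx' => by exact_mod_cast h x' hx'

theorem CoeffBounds.infOperator_neg_of_large (hb : CoeffBounds f σ γ c B ι)
    (hD : IsLipschitzFamily D L) {x q M : ℝ}
    (hq : driftBound c B ι < q) : infOperator f σ γ D x q M < 0 :=
  infOperator_neg_iff.2 ⟨x, hD.mem_self x, hb.pricingF_neg_of_large hq⟩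

theorem CoeffBounds.infOperator_nonpos_of_large (hb : CoeffBounds f σ γ c B ι)
    (hD : IsLipschitzFamily D L) {x q M : ℝ}
    (hq : driftBound c B ι ≤ q) : infOperator f σ γ D x q M ≤ 0 :=
  (iInf₂_le x (hD.mem_self x)).trans (by exact_mod_cast hb.pricingF_nonpos_of_large hq)

theorem CoeffBounds.infOperator_nonneg_of_small (hb : CoeffBounds f σ γ c B ι) {x q M : ℝ}
    (hq : q ≤ -driftBound c B ι) (hM : ∀ x' ∈ D x, M ≤ γ x') : 0 ≤ infOperator f σ γ D x q M :=
  infOperator_nonneg_iff.2 fun x' hx' => hb.pricingF_nonneg_of_small hq (hM x' hx')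

theorem CoeffBounds.infOperator_neg_mono (hb : CoeffBounds f σ γ c B ι) {x q M q' M' : ℝ}
    (h : infOperator f σ γ D x q M < 0) (hq : q ≤ q') (hM : M ≤ M') :
    infOperator f σ γ D x q' M' < 0 := by
  obtain ⟨x', hx', h⟩ := infOperator_neg_iff.1 h
  exact infOperator_neg_iff.2 ⟨x', hx', hb.pricingF_neg_mono h hq hM⟩

/-- A base point at which the operator is negative is carried along to the neighbouring sets by the
Lipschitz property, and negativity at one base point is an open condition. -/
theorem CoeffBounds.eventually_infOperator_neg (hb : CoeffBounds f σ γ c B ι)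
    (hD : IsLipschitzFamily D L) {x q M : ℝ} (h : infOperator f σ γ D x q M < 0) :
    ∀ᶠ z : ℝ × ℝ × ℝ in 𝓝 (x, q, M), infOperator f σ γ D z.1 z.2.1 z.2.2 < 0 := by
  obtain ⟨x', hx', h⟩ := infOperator_neg_iff.1 h
  choose y hy hyl using fun z => hD.lip x z x' hx'
  have ht : Tendsto y (𝓝 x) (𝓝 x') := by
    rw [tendsto_iff_norm_sub_tendsto_zero]
    refine squeeze_zero (fun _ => norm_nonneg _) hyl ?_
    have : Continuous fun z => L * |z - x| := by fun_prop
    simpa using this.tendsto x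
  have ht2 : Tendsto (fun z : ℝ × ℝ × ℝ => (y z.1, z.2.1, z.2.2)) (𝓝 (x, q, M))
      (𝓝 (x', q, M)) := by
    refine Tendsto.prodMk_nhds (ht.comp continuousAt_fst) ?_
    exact (continuous_snd.tendsto _)
  filter_upwards [ht2.eventually (hb.eventually_pricingF_neg h)] with z hz
  exact infOperator_neg_iff.2 ⟨y z.1, hy z.1, hz⟩

/-- Positivity concerns all base points. Compactness of `D x` gives a margin `a / 2` on a uniform
neighbourhood of `D x`, which contains the nearby sets by the Lipschitz property. -/
theorem CoeffBounds.eventually_infOperator_pos (hb : CoeffBounds f σ γ c B ι)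
    (hD : IsLipschitzFamily D L) {x q M : ℝ} (h : 0 < infOperator f σ γ D x q M) :
    ∀ᶠ z : ℝ × ℝ × ℝ in 𝓝 (x, q, M), 0 < infOperator f σ γ D z.1 z.2.1 z.2.2 := by
  obtain ⟨a, ha, h⟩ := infOperator_pos_iff.1 h
  have h1 : ∀ᶠ w : ℝ × ℝ × ℝ in 𝓝 (0, q, M), ∀ x' ∈ D x,
      a / 2 < pricingF f σ γ (x' + w.1) w.2.1 w.2.2 := by
    refine (hD.compact x).eventually_forall_of_forall_eventually fun x' hx' => ?_
    have hx := hb.eventually_lt_pricingF (by linarith)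
      (lt_of_lt_of_le (by linarith : a / 2 < a) (h x' hx'))
    have hc : Tendsto (fun z : (ℝ × ℝ × ℝ) × ℝ => (z.2 + z.1.1, z.1.2.1, z.1.2.2))
        (𝓝 ((0, q, M), x')) (𝓝 (x', q, M)) := by
      have : Continuous fun z : (ℝ × ℝ × ℝ) × ℝ => (z.2 + z.1.1, z.1.2.1, z.1.2.2) := by fun_prop
      simpa using this.tendsto ((0, q, M), x')
    exact hc.eventually hx
  obtain ⟨r, hr, h2⟩ := Metric.eventually_nhds_iff.1 h1
  have hL := hD.nonneg
  have h3 : ∀ᶠ z : ℝ × ℝ × ℝ in 𝓝 (x, q, M), L * |z.1 - x| < r ∧ |z.2.1 - q| < r ∧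
      |z.2.2 - M| < r := by
    refine (ContinuousAt.eventually_lt (by fun_prop) continuousAt_const (by simpa)).and
      ((ContinuousAt.eventually_lt (by fun_prop) continuousAt_const (by simpa)).and
      (ContinuousAt.eventually_lt (by fun_prop) continuousAt_const (by simpa)))
  filter_upwards [h3] with z hz
  refine infOperator_pos_iff.2 ⟨a / 2, by linarith, fun y' hy' => ?_⟩
  obtain ⟨x', hx', hl⟩ := hD.lip z.1 x y' hy'
  have := h2 (y := (y' - x', z.2.1, z.2.2)) (by
    rw [abs_sub_comm, abs_sub_comm x] at hl
    simp only [Prod.dist_eq, Real.dist_eq, sub_zero]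
    exact max_lt (hl.trans_lt hz.1) (max_lt hz.2.1 hz.2.2)) x' hx'
  simpa using this.le

end

end GammaPricing

namespace GammaPricing

/-! ### Second-order expansions of functions of one variable -/

/-- `g` has the second-order Taylor expansion `g x + q y + M y² / 2` at `x`. -/
def HasSecondOrderExpansion (g : ℝ → ℝ) (x q M : ℝ) : Prop :=
  ∀ ω > 0, ∃ r > 0, ∀ y, |y| ≤ r → |g (x + y) - g x - q * y - M * y ^ 2 / 2| ≤ ω * y ^ 2

/-- The right derivative need be differentiable at `x` only. After subtraction of the quadratic
polynomial the right derivative is at most `ω * |z|` near `0`, and the mean value inequality for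
right derivatives integrates this bound. -/
theorem hasSecondOrderExpansion_of_rightDeriv {g d : ℝ → ℝ} {x M : ℝ} (hg : Continuous g)
    (hd : ∀ z, HasDerivWithinAt g (d z) (Ici z) z) (hM : HasDerivAt d M x) :
    HasSecondOrderExpansion g x (d x) M := by
  intro ω hω
  have h1 := (hasDerivAt_iff_isLittleO_nhds_zero.1 hM).def hω
  obtain ⟨r, hr, h1⟩ := Metric.eventually_nhds_iff.1 h1
  refine ⟨r / 2, by linarith, fun y hy => ?_⟩
  set G : ℝ → ℝ := fun z => g (x + z) - d x * z - M * z ^ 2 / 2 with hG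
  have hGc : Continuous G := by fun_prop
  have hGd : ∀ z, HasDerivWithinAt G (d (x + z) - d x - M * z) (Ici z) z := by
    intro z
    have e1 : HasDerivWithinAt (fun z => g (x + z)) (d (x + z)) (Ici z) z := by
      have := (hd (x + z)).scomp z (((hasDerivAt_id z).const_add x).hasDerivWithinAt (s := Ici z))
        (fun w hw => by simpa using hw)
      rw [one_smul] at this
      exact this
    have e2 : HasDerivAt (fun z : ℝ => d x * z) (d x) z := by
      simpa using (hasDerivAt_id z).const_mul (d x)
    have e3 : HasDerivAt (fun z : ℝ => M * z ^ 2 / 2) (M * z) z := by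
      exact (((hasDerivAt_pow 2 z).const_mul M).div_const 2).congr_deriv (by simp; ring)
    exact (e1.sub e2.hasDerivWithinAt).sub e3.hasDerivWithinAt
  have hb : ∀ z, |z| ≤ r / 2 → ‖d (x + z) - d x - M * z‖ ≤ ω * |z| := by
    intro z hz
    have := h1 (y := z) (by simpa using lt_of_le_of_lt hz (by linarith))
    simpa [mul_comm] using this
  have hG0 : g (x + y) - g x - d x * y - M * y ^ 2 / 2 = G y - G 0 := by simp [hG]; ring
  rw [hG0]
  have hy2 : 0 ≤ ω * y ^ 2 := by positivity
  have hBd : ∀ (C z : ℝ), HasDerivAt (fun z : ℝ => C + ω * z ^ 2 / 2) (ω * z) z := by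
    intro C z
    exact ((((hasDerivAt_pow 2 z).const_mul ω).div_const 2).const_add C).congr_deriv
      (by simp; ring)
  have hBd' : ∀ (C z : ℝ), HasDerivAt (fun z : ℝ => C - ω * z ^ 2 / 2) (-(ω * z)) z := by
    intro C z
    exact ((((hasDerivAt_pow 2 z).const_mul ω).div_const 2).const_sub C).congr_deriv
      (by simp; ring)
  rcases le_total 0 y with h | h
  · have := image_norm_le_of_norm_deriv_right_le_deriv_boundary (a := 0) (b := y)
      (f := fun z => G z - G 0) (f' := fun z => d (x + z) - d x - M * z)
      (B := fun z => 0 + ω * z ^ 2 / 2) (B' := fun z => ω * z)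
      (by fun_prop) (fun z _ => (hGd z).sub_const _) (by simp) (fun z => hBd 0 z)
      (fun z hz => by
        have h3 : |z| = z := abs_of_nonneg hz.1
        have := hb z (by rw [abs_of_nonneg h] at hy; rw [h3]; linarith [hz.2])
        rwa [h3] at this) (right_mem_Icc.2 h)
    rw [Real.norm_eq_abs] at this
    linarith
  -- Right derivatives can only be integrated forwards, so for negative `y` the inequality starts at
  -- `y`, and the comparison function vanishes there.
  · have := image_norm_le_of_norm_deriv_right_le_deriv_boundary (a := y) (b := 0)
      (f := fun z => G z - G y) (f' := fun z => d (x + z) - d x - M * z)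
      (B := fun z => ω * y ^ 2 / 2 - ω * z ^ 2 / 2) (B' := fun z => -(ω * z))
      (by fun_prop) (fun z _ => (hGd z).sub_const _) (by simp) (fun z => hBd' _ z)
      (fun z hz => by
        have h3 : |z| = -z := abs_of_nonpos hz.2.le
        have := hb z (by rw [abs_of_nonpos h] at hy; rw [h3]; linarith [hz.1])
        rw [h3] at this
        linarith) (right_mem_Icc.2 h)
    rw [Real.norm_eq_abs, abs_sub_comm] at this
    simp at this
    linarith

theorem HasSecondOrderExpansion.hasDerivAt {g : ℝ → ℝ} {x q M : ℝ}
    (h : HasSecondOrderExpansion g x q M) : HasDerivAt g q x := by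
  rw [hasDerivAt_iff_isLittleO_nhds_zero, Asymptotics.isLittleO_iff]
  intro ω hω
  obtain ⟨r, hr, h1⟩ := h 1 one_pos
  have hev : ∀ᶠ y : ℝ in 𝓝 0, |y| ≤ r ∧ (1 + |M|) * |y| < ω := by
    refine Filter.Eventually.and ?_
      (ContinuousAt.eventually_lt (by fun_prop) continuousAt_const (by simpa))
    exact (ContinuousAt.eventually_lt (by fun_prop) continuousAt_const (by simpa)).mono
      fun y hy => le_of_lt hy
  filter_upwards [hev] with y hy
  have := h1 y hy.1
  rw [Real.norm_eq_abs, Real.norm_eq_abs, smul_eq_mul]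
  have e1 : g (x + y) - g x - y * q =
      (g (x + y) - g x - q * y - M * y ^ 2 / 2) + M * y ^ 2 / 2 := by ring
  rw [e1]
  refine (abs_add_le _ _).trans ?_
  have e2 : |M * y ^ 2 / 2| = |M| * |y| ^ 2 / 2 := by
    rw [abs_div, abs_mul, abs_two, abs_pow]
  have e3 : y ^ 2 = |y| ^ 2 := (sq_abs y).symm
  rw [e2, ← e3]
  have h5 : (1 + |M|) * |y| * |y| ≤ ω * |y| := mul_le_mul_of_nonneg_right hy.2.le (abs_nonneg y)
  have h6 : |y| * |y| = y ^ 2 := by rw [e3]; ring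
  rw [mul_assoc, h6] at h5
  nlinarith [mul_nonneg (abs_nonneg M) (sq_nonneg y)]

theorem HasSecondOrderExpansion.tendsto_secondDiff {g : ℝ → ℝ} {x q M : ℝ}
    (h : HasSecondOrderExpansion g x q M) :
    Tendsto (fun y => (g (x + y) + g (x - y) - 2 * g x) / y ^ 2) (𝓝[≠] 0) (𝓝 M) := by
  rw [Metric.tendsto_nhdsWithin_nhds]
  intro ε hε
  obtain ⟨r, hr, h1⟩ := h (ε / 4) (by linarith)
  refine ⟨r, hr, fun y hy hyr => ?_⟩
  have hyr' : |y| ≤ r := by simpa using hyr.le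
  have a1 := h1 y hyr'
  have a2 := h1 (-y) (by simpa using hyr')
  have hy2 : 0 < y ^ 2 := by
    have : y ≠ 0 := hy
    positivity
  rw [Real.dist_eq]
  have e : (g (x + y) + g (x - y) - 2 * g x) / y ^ 2 - M =
      ((g (x + y) - g x - q * y - M * y ^ 2 / 2) +
        (g (x + -y) - g x - q * -y - M * (-y) ^ 2 / 2)) / y ^ 2 := by
    rw [← sub_eq_add_neg, div_sub' hy2.ne']
    congr 1
    ring
  rw [e, abs_div, abs_of_pos hy2, div_lt_iff₀ hy2]
  refine (abs_add_le _ _).trans_lt ?_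
  have h5 : ε / 4 * y ^ 2 + ε / 4 * y ^ 2 < ε * y ^ 2 := by nlinarith
  refine (add_le_add a1 a2).trans_lt ?_
  rw [neg_sq]
  exact h5

theorem hasSecondOrderExpansion_of_contDiff {g : ℝ → ℝ} (hg : ContDiff ℝ 2 g) (x : ℝ) :
    HasSecondOrderExpansion g x (deriv g x) (iteratedDeriv 2 g x) := by
  have h1 : Differentiable ℝ g := hg.differentiable (by norm_num)
  have h2 : Differentiable ℝ (deriv g) := by
    have := hg.differentiable_iteratedDeriv 1 (by norm_num)
    rwa [iteratedDeriv_one] at this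
  refine hasSecondOrderExpansion_of_rightDeriv hg.continuous
    (fun z => (h1 z).hasDerivAt.hasDerivWithinAt) ?_
  rw [iteratedDeriv_succ, iteratedDeriv_one]
  exact (h2 x).hasDerivAt

/-- Alexandrov's theorem in one dimension: the right derivative is monotone, hence differentiable
almost everywhere. -/
theorem ConcaveOn.ae_hasSecondOrderExpansion {g : ℝ → ℝ} (hg : ConcaveOn ℝ univ g) :
    ∀ᵐ x, ∃ q M, HasSecondOrderExpansion g x q M := by
  have hc : ConvexOn ℝ univ (fun x => -g x) := hg.neg
  set d : ℝ → ℝ := fun x => derivWithin (fun x => -g x) (Ioi x) x with hd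
  have hmono : Monotone d := by
    have := hc.monotoneOn_rightDeriv
    rw [interior_univ] at this
    exact monotoneOn_univ.1 this
  have hcont : Continuous g := by
    have := hg.continuousOn_interior
    rwa [interior_univ, continuousOn_univ] at this
  filter_upwards [hmono.ae_differentiableAt] with x hx
  refine ⟨-d x, -deriv d x, ?_⟩
  refine hasSecondOrderExpansion_of_rightDeriv (d := fun x => - d x) hcont (fun z => ?_)
    hx.hasDerivAt.neg
  have := (hc.hasDerivWithinAt_rightDeriv_of_mem_interior (x := z) (by simp)).fun_neg
  simp only [neg_neg] at this
  rw [← hasDerivWithinAt_Ioi_iff_Ici]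
  exact this

theorem iteratedDeriv_two_eq {b b' : ℝ → ℝ} {y m : ℝ} (h : ∀ z, HasDerivAt b (b' z) z)
    (h' : HasDerivAt b' m y) : iteratedDeriv 2 b y = m := by
  rw [iteratedDeriv_succ, iteratedDeriv_one, funext fun z => (h z).deriv]
  exact h'.deriv

theorem hasDerivAt_quadratic (a k x z : ℝ) :
    HasDerivAt (fun y => a * (y - x) + k * (y - x) ^ 2) (a + 2 * k * (z - x)) z := by
  have h : HasDerivAt (fun y => y - x) 1 z := (hasDerivAt_id z).sub_const x
  exact ((h.const_mul a).add ((h.fun_pow 2).const_mul k)).congr_deriv (by simp; ring)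

theorem iteratedDeriv_two_quadratic (a k x z : ℝ) :
    iteratedDeriv 2 (fun y => a * (y - x) + k * (y - x) ^ 2) z = 2 * k := by
  refine iteratedDeriv_two_eq (hasDerivAt_quadratic a k x) ?_
  have := (((hasDerivAt_id z).sub_const x).const_mul (2 * k)).const_add a
  simpa using this

theorem iteratedDeriv_two_const_mul (k : ℝ) {b : ℝ → ℝ} (hb : ContDiff ℝ 2 b) (y : ℝ) :
    iteratedDeriv 2 (fun z => k * b z) y = k * iteratedDeriv 2 b y :=
  iteratedDeriv_const_mul k (hb.contDiffAt)

theorem iteratedDeriv_two_add {a b : ℝ → ℝ} (ha : ContDiff ℝ 2 a) (hb : ContDiff ℝ 2 b)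
    (y : ℝ) : iteratedDeriv 2 (fun z => a z + b z) y =
      iteratedDeriv 2 a y + iteratedDeriv 2 b y :=
  iteratedDeriv_fun_add ha.contDiffAt hb.contDiffAt

/-- A smooth function touching from below a function with nonpositive second differences. -/
theorem iteratedDeriv_two_nonpos_of_isLocalMin {c ψ : ℝ → ℝ} {x : ℝ}
    (hc : ∀ y, c (x + y) + c (x - y) ≤ 2 * c x) (hψ : ContDiff ℝ 2 ψ)
    (hmin : IsLocalMin (fun y => c y - ψ y) x) : iteratedDeriv 2 ψ x ≤ 0 := by
  have h := (hasSecondOrderExpansion_of_contDiff hψ x).tendsto_secondDiff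
  refine le_of_tendsto h ?_
  have h1 : ∀ᶠ y : ℝ in 𝓝 0, c x - ψ x ≤ c (x + y) - ψ (x + y) := by
    have : Tendsto (fun y : ℝ => x + y) (𝓝 0) (𝓝 x) := by
      have h0 : Continuous fun y : ℝ => x + y := by fun_prop
      simpa using h0.tendsto 0
    exact this.eventually hmin
  have h2 : ∀ᶠ y : ℝ in 𝓝 0, c x - ψ x ≤ c (x - y) - ψ (x - y) := by
    have : Tendsto (fun y : ℝ => x - y) (𝓝 0) (𝓝 x) := by
      have h0 : Continuous fun y : ℝ => x - y := by fun_prop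
      simpa using h0.tendsto 0
    exact this.eventually hmin
  filter_upwards [nhdsWithin_le_nhds h1, nhdsWithin_le_nhds h2] with y e1 e2
  have := hc y
  exact div_nonpos_of_nonpos_of_nonneg (by linarith) (sq_nonneg y)

theorem ConcaveOn.secondDiff_le {c : ℝ → ℝ} (hc : ConcaveOn ℝ univ c) (x y : ℝ) :
    c (x + y) + c (x - y) ≤ 2 * c x := by
  have := hc.2 (mem_univ (x + y)) (mem_univ (x - y)) (by norm_num : (0 : ℝ) ≤ 1 / 2)
    (by norm_num : (0 : ℝ) ≤ 1 / 2) (by norm_num)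
  simp only [smul_eq_mul] at this
  rw [show (1 : ℝ) / 2 * (x + y) + 1 / 2 * (x - y) = x by ring] at this
  linarith

/-! ### Derivatives of test functions -/

theorem contDiff_slice_fst {φ : ℝ × ℝ → ℝ} (h : ContDiff ℝ 2 φ) (x : ℝ) :
    ContDiff ℝ 2 fun t => φ (t, x) := by fun_prop

theorem contDiff_slice_snd {φ : ℝ × ℝ → ℝ} (h : ContDiff ℝ 2 φ) (t : ℝ) :
    ContDiff ℝ 2 fun x => φ (t, x) := by fun_prop

theorem hasDerivAt_slice_fst {φ : ℝ × ℝ → ℝ} (h : ContDiff ℝ 2 φ) (p : ℝ × ℝ) :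
    HasDerivAt (fun t => φ (t, p.2)) (timeDeriv φ p) p.1 :=
  ((contDiff_slice_fst h p.2).differentiable (by norm_num) p.1).hasDerivAt

theorem timeDeriv_add {φ ψ : ℝ × ℝ → ℝ} (h : ContDiff ℝ 2 φ) (h' : ContDiff ℝ 2 ψ) (p : ℝ × ℝ) :
    timeDeriv (fun z => φ z + ψ z) p = timeDeriv φ p + timeDeriv ψ p :=
  ((hasDerivAt_slice_fst h p).add (hasDerivAt_slice_fst h' p)).deriv

theorem spaceDeriv2_add {φ ψ : ℝ × ℝ → ℝ} (h : ContDiff ℝ 2 φ) (h' : ContDiff ℝ 2 ψ)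
    (p : ℝ × ℝ) : spaceDeriv2 (fun z => φ z + ψ z) p = spaceDeriv2 φ p + spaceDeriv2 ψ p :=
  iteratedDeriv_two_add (contDiff_slice_snd h p.1) (contDiff_slice_snd h' p.1) p.2

theorem timeDeriv_const_mul (k : ℝ) {φ : ℝ × ℝ → ℝ} (h : ContDiff ℝ 2 φ) (p : ℝ × ℝ) :
    timeDeriv (fun z => k * φ z) p = k * timeDeriv φ p :=
  ((hasDerivAt_slice_fst h p).const_mul k).deriv

theorem spaceDeriv2_const_mul (k : ℝ) {φ : ℝ × ℝ → ℝ} (h : ContDiff ℝ 2 φ)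
    (p : ℝ × ℝ) : spaceDeriv2 (fun z => k * φ z) p = k * spaceDeriv2 φ p :=
  iteratedDeriv_two_const_mul k (contDiff_slice_snd h p.1) p.2

theorem timeDeriv_sep {a : ℝ → ℝ} {m : ℝ} {p : ℝ × ℝ} (ha : HasDerivAt a m p.1) (b : ℝ → ℝ) :
    timeDeriv (fun z => a z.1 + b z.2) p = m :=
  (ha.add_const (b p.2)).deriv

theorem spaceDeriv2_sep (a b : ℝ → ℝ) (p : ℝ × ℝ) :
    spaceDeriv2 (fun z => a z.1 + b z.2) p = iteratedDeriv 2 b p.2 := by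
  exact iteratedDeriv_const_add (n := 2) (by norm_num) (a p.1) (f := b)

theorem timeDeriv_eq_fderiv {φ : ℝ × ℝ → ℝ} (h : ContDiff ℝ 2 φ) (p : ℝ × ℝ) :
    timeDeriv φ p = fderiv ℝ φ p (1, 0) := by
  have h1 : HasFDerivAt φ (fderiv ℝ φ p) (p.1, p.2) :=
    (h.differentiable (by norm_num) p).hasFDerivAt
  have h2 : HasDerivAt (fun t : ℝ => (t, p.2)) ((1 : ℝ), (0 : ℝ)) p.1 :=
    (hasDerivAt_id p.1).prodMk (hasDerivAt_const p.1 p.2)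
  exact (h1.comp_hasDerivAt p.1 h2).deriv

theorem spaceDeriv_eq_fderiv {φ : ℝ × ℝ → ℝ} (h : ContDiff ℝ 1 φ) (t x : ℝ) :
    deriv (fun y => φ (t, y)) x = fderiv ℝ φ (t, x) (0, 1) := by
  have h1 : HasFDerivAt φ (fderiv ℝ φ (t, x)) (t, x) :=
    (h.differentiable (by norm_num) (t, x)).hasFDerivAt
  have h2 : HasDerivAt (fun y : ℝ => (t, y)) ((0 : ℝ), (1 : ℝ)) x :=
    (hasDerivAt_const x t).prodMk (hasDerivAt_id x)
  exact (h1.comp_hasDerivAt x h2).deriv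

theorem continuous_timeDeriv {φ : ℝ × ℝ → ℝ} (h : ContDiff ℝ 2 φ) : Continuous (timeDeriv φ) := by
  rw [funext (timeDeriv_eq_fderiv h)]
  exact (h.continuous_fderiv (by norm_num)).clm_apply continuous_const

theorem continuous_spaceDeriv2 {φ : ℝ × ℝ → ℝ} (h : ContDiff ℝ 2 φ) :
    Continuous (spaceDeriv2 φ) := by
  have h1 : ContDiff ℝ 1 fun z => fderiv ℝ φ z (0, 1) :=
    (h.fderiv_right (m := 1) (by norm_num)).clm_apply contDiff_const
  have : spaceDeriv2 φ = fun p => fderiv ℝ (fun z => fderiv ℝ φ z (0, 1)) p (0, 1) := by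
    funext p
    unfold spaceDeriv2
    rw [iteratedDeriv_succ, iteratedDeriv_one,
      funext (spaceDeriv_eq_fderiv (h.of_le (by norm_num)) p.1)]
    exact spaceDeriv_eq_fderiv h1 p.1 p.2
  rw [this]
  exact (h1.continuous_fderiv (by norm_num)).clm_apply continuous_const

theorem timeDeriv_translate (φ : ℝ × ℝ → ℝ) (a : ℝ) (p : ℝ × ℝ) :
    timeDeriv (fun z => φ (z.1 + a, z.2)) p = timeDeriv φ (p.1 + a, p.2) := by
  unfold timeDeriv
  exact deriv_comp_add_const (f := fun t => φ (t, p.2)) a p.1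

theorem spaceDeriv2_translate (φ : ℝ × ℝ → ℝ) (a : ℝ) (p : ℝ × ℝ) :
    spaceDeriv2 (fun z => φ (z.1 + a, z.2)) p = spaceDeriv2 φ (p.1 + a, p.2) := rfl

end GammaPricing

namespace GammaPricing

/-! ### Elementary properties of viscosity supersolutions -/

/-- A minimum over the compact set `K` becomes a local minimum over `S` once larger values on `K`
outside `U` keep it inside `U`. Penalised test functions are built to satisfy `hout`. -/
theorem exists_isLocalMinOn {α : Type*} [TopologicalSpace α] {S K U : Set α} {J : α → ℝ}
    (hK : IsCompact K) (hJ : LowerSemicontinuousOn J K) (hU : IsOpen U) (hUS : U ∩ S ⊆ K)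
    {z₀ : α} (hz₀ : z₀ ∈ K) (hout : ∀ z ∈ K, z ∉ U → J z₀ < J z) :
    ∃ p ∈ K, p ∈ U ∧ IsLocalMinOn J S p ∧ J p ≤ J z₀ := by
  obtain ⟨p, hp, hmin⟩ := hJ.exists_isMinOn ⟨z₀, hz₀⟩ hK
  have h1 : J p ≤ J z₀ := hmin hz₀
  have hpU : p ∈ U := by
    by_contra h
    exact absurd h1 (not_le.2 (hout p hp h))
  refine ⟨p, hp, hpU, ?_, h1⟩
  filter_upwards [inter_mem_nhdsWithin S (hU.mem_nhds hpU)] with z hz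
  exact hmin (hUS ⟨hz.2, hz.1⟩)

theorem exists_isLocalMaxOn {α : Type*} [TopologicalSpace α] {S K U : Set α} {J : α → ℝ}
    (hK : IsCompact K) (hJ : UpperSemicontinuousOn J K) (hU : IsOpen U) (hUS : U ∩ S ⊆ K)
    {z₀ : α} (hz₀ : z₀ ∈ K) (hout : ∀ z ∈ K, z ∉ U → J z < J z₀) :
    ∃ p ∈ K, p ∈ U ∧ IsLocalMaxOn J S p ∧ J z₀ ≤ J p := by
  obtain ⟨p, hp, hmax⟩ := hJ.exists_isMaxOn ⟨z₀, hz₀⟩ hK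
  have h1 : J z₀ ≤ J p := hmax hz₀
  have hpU : p ∈ U := by
    by_contra h
    exact absurd h1 (not_le.2 (hout p hp h))
  refine ⟨p, hp, hpU, ?_, h1⟩
  filter_upwards [inter_mem_nhdsWithin S (hU.mem_nhds hpU)] with z hz
  exact hmax (hUS ⟨hz.2, hz.1⟩)

theorem lowerSemicontinuousOn_sub {α : Type*} [TopologicalSpace α] {S : Set α} {u φ : α → ℝ}
    (hu : LowerSemicontinuousOn u S) (hφ : Continuous φ) :
    LowerSemicontinuousOn (fun z => u z - φ z) S := by
  have := hu.add (hφ.neg.lowerSemicontinuous.lowerSemicontinuousOn S)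
  simpa [sub_eq_add_neg] using this

theorem upperSemicontinuousOn_sub {α : Type*} [TopologicalSpace α] {S : Set α} {u φ : α → ℝ}
    (hu : UpperSemicontinuousOn u S) (hφ : Continuous φ) :
    UpperSemicontinuousOn (fun z => u z - φ z) S := by
  have := hu.add (hφ.neg.upperSemicontinuous.upperSemicontinuousOn S)
  simpa [sub_eq_add_neg] using this

theorem isCompact_box (a b c d : ℝ) : IsCompact (Icc a b ×ˢ Icc c d : Set (ℝ × ℝ)) :=
  isCompact_Icc.prod isCompact_Icc

theorem exists_lowerBound_of_lsc {α : Type*} [TopologicalSpace α] {K : Set α} {u : α → ℝ}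
    (hK : IsCompact K) (hu : LowerSemicontinuousOn u K) : ∃ B : ℝ, ∀ z ∈ K, B ≤ u z := by
  obtain ⟨B, hB⟩ := hu.bddBelow_of_isCompact hK
  exact ⟨B, fun z hz => hB ⟨z, hz, rfl⟩⟩

theorem iteratedDeriv_two_quartic (k x z : ℝ) :
    iteratedDeriv 2 (fun y => k * (y - x) ^ 4) z = 12 * k * (z - x) ^ 2 := by
  have h : ∀ z : ℝ, HasDerivAt (fun y => y - x) 1 z := fun z => (hasDerivAt_id z).sub_const x
  refine iteratedDeriv_two_eq (b' := fun y => 4 * k * (y - x) ^ 3) (fun z => ?_) ?_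
  · exact (((h z).fun_pow 4).const_mul k).congr_deriv (by simp; ring)
  · exact (((h z).fun_pow 3).const_mul (4 * k)).congr_deriv (by simp; ring)

/-- Later times suffice, which matters at time `0`, where there are no earlier ones, and at `T` for
extended functions, whose formula changes there. -/
theorem nonpos_of_eventually_right {g : ℝ → ℝ} {m t : ℝ} (hg : HasDerivAt g m t)
    (h : ∀ᶠ s in 𝓝[>] t, g s ≤ g t) : m ≤ 0 := by
  have h1 : Tendsto (slope g t) (𝓝[>] t) (𝓝 m) :=
    (hasDerivAt_iff_tendsto_slope.1 hg).mono_left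
      (nhdsWithin_mono t fun s hs => ne_of_gt hs)
  refine le_of_tendsto h1 ?_
  filter_upwards [h, self_mem_nhdsWithin] with s hs hst
  rw [slope_def_field]
  exact div_nonpos_of_nonpos_of_nonneg (by linarith) (by linarith [mem_Ioi.1 hst])

section
variable {T : ℝ} {G : ℝ → ℝ → ℝ → EReal} {h : ℝ → ℝ} {v : ℝ × ℝ → ℝ}

/-- If no smooth function of `x` with the second derivative of `ψ` can touch `v` from below over
`(a, b)`, then `v (s, ·) - ψ` is at least its minimum over the end points. -/
theorem IsViscositySupersolution.slice (hv : IsViscositySupersolution T G h v) {s : ℝ}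
    (hs : 0 ≤ s) (hsT : s < T) {ψ : ℝ → ℝ} (hψ : ContDiff ℝ 2 ψ) {a b : ℝ}
    (hneg : ∀ y ∈ Ioo a b, ∀ q, ¬ 0 ≤ G y q (iteratedDeriv 2 ψ y)) {y : ℝ} (hy : y ∈ Icc a b) :
    min (v (s, a) - ψ a) (v (s, b) - ψ b) ≤ v (s, y) - ψ y := by
  by_contra! hlt
  set m₀ := v (s, y) - ψ y
  obtain ⟨m₁, hm₀, hm₁⟩ := exists_between hlt
  have hmem : ∀ c : ℝ, (s, c) ∈ strip T := fun c => ⟨⟨hs, hsT.le⟩, mem_univ _⟩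
  have hev : ∀ c : ℝ, m₁ < v (s, c) - ψ c →
      ∀ᶠ t in 𝓝 s, t ∈ Icc 0 T → m₁ < v (t, c) - ψ c := by
    intro c hc
    have h1 := hv.lsc (s, c) (hmem c) (m₁ + ψ c) (by linarith)
    rw [eventually_nhdsWithin_iff] at h1
    have ht : Tendsto (fun t : ℝ => (t, c)) (𝓝 s) (𝓝 (s, c)) :=
      (by fun_prop : Continuous fun t : ℝ => (t, c)).tendsto s
    filter_upwards [ht.eventually h1] with t ht htT
    linarith [ht ⟨htT, mem_univ _⟩]
  obtain ⟨r, hr, hball⟩ := Metric.eventually_nhds_iff.1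
    (((hev a (hm₁.trans_le (min_le_left _ _))).and
      (hev b (hm₁.trans_le (min_le_right _ _)))).and (eventually_lt_nhds hsT))
  set K : Set (ℝ × ℝ) := (Icc (s - r / 2) (s + r / 2) ∩ Icc 0 T) ×ˢ Icc a b with hK
  have hKc : IsCompact K := (isCompact_Icc.inter isCompact_Icc).prod isCompact_Icc
  have hKS : K ⊆ strip T := fun z hz => ⟨hz.1.2, mem_univ _⟩
  have hψc : Continuous ψ := hψ.continuous
  have hl0 : LowerSemicontinuousOn (fun z : ℝ × ℝ => v z - ψ z.2) K :=
    lowerSemicontinuousOn_sub (hv.lsc.mono hKS) (by fun_prop)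
  obtain ⟨B, hB⟩ := exists_lowerBound_of_lsc hKc hl0
  -- The penalty in time lifts the function above `m₁` at the time ends of the box, where only the
  -- lower bound `B` is known. At the lateral ends, values above `m₁` come from lower semicontinuity
  -- in time.
  set κ := (|m₁ - B| + 1) / (r / 2) ^ 2 with hκ
  have hκr : κ * (r / 2) ^ 2 = |m₁ - B| + 1 := by
    rw [hκ]; field_simp
  set φ : ℝ × ℝ → ℝ := fun z => -(κ * (z.1 - s) ^ 2) + ψ z.2 with hφ
  have hφC : ContDiff ℝ 2 φ := by fun_prop
  have hrs : ∀ t, |t - s| ≤ r / 2 → dist t s < r := fun t ht => by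
    rw [Real.dist_eq]; linarith
  obtain ⟨p, hpK, hpU, hmin, hle⟩ := exists_isLocalMinOn (S := strip T)
    (J := fun z => v z - φ z) (U := Ioo (s - r / 2) (s + r / 2) ×ˢ Ioo a b) hKc
    (lowerSemicontinuousOn_sub (hv.lsc.mono hKS) hφC.continuous) (isOpen_Ioo.prod isOpen_Ioo)
    (fun z hz => ⟨⟨Ioo_subset_Icc_self hz.1.1, hz.2.1⟩, Ioo_subset_Icc_self hz.1.2⟩)
    (z₀ := (s, y)) ⟨⟨⟨by linarith, by linarith⟩, ⟨hs, hsT.le⟩⟩, hy⟩ (by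
      rintro ⟨t, x⟩ hz hzU
      simp only [hφ, sub_self]
      have hκ0 : 0 ≤ κ := by positivity
      have hm : v (s, y) - (-(κ * 0 ^ 2) + ψ y) = m₀ := by simp [m₀]
      rw [hm]
      have hz1 : t ∈ Icc (s - r / 2) (s + r / 2) := hz.1.1
      have ht : |t - s| ≤ r / 2 := abs_le.2 ⟨by linarith [hz1.1], by linarith [hz1.2]⟩
      have hb := hball (hrs t ht)
      have hsq : 0 ≤ κ * (t - s) ^ 2 := by positivity
      by_cases hx : x ∈ Ioo a b
      · have ht' : t ∉ Ioo (s - r / 2) (s + r / 2) := fun h' => hzU ⟨h', hx⟩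
        have : (r / 2) ^ 2 ≤ (t - s) ^ 2 := by
          rw [mem_Ioo, not_and_or, not_lt, not_lt] at ht'
          rcases ht' with h' | h' <;> nlinarith
        have h3 := mul_le_mul_of_nonneg_left this hκ0
        have h4 := hB _ hz
        simp only at h4
        have h5 := le_abs_self (m₁ - B)
        linarith
      · have hx2 : x = a ∨ x = b := by
          have h1 := hz.2
          by_contra! hne
          exact hx ⟨lt_of_le_of_ne h1.1 hne.1.symm, lt_of_le_of_ne h1.2 hne.2⟩
        rcases hx2 with rfl | rfl
        · linarith [hb.1.1 hz.1.2]
        · linarith [hb.1.2 hz.1.2])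
  have hpT : p.1 < T := (hball (hrs p.1 (abs_le.2
    ⟨by linarith [hpU.1.1], by linarith [hpU.1.2]⟩))).2
  have := hv.interior φ hφC p (hKS hpK) hpT hmin
  have e2 : spaceDeriv2 φ p = iteratedDeriv 2 ψ p.2 :=
    spaceDeriv2_sep (fun t => -(κ * (t - s) ^ 2)) ψ p
  rw [e2] at this
  exact hneg p.2 hpU.2 _ this

/-- Semiconcavity in space of supersolutions. -/
theorem IsViscositySupersolution.concaveOn_slice (hv : IsViscositySupersolution T G h v) {A : ℝ}
    (hA : ∀ y q, ¬ 0 ≤ G y q A) {s : ℝ} (hs : 0 ≤ s) (hsT : s < T) :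
    ConcaveOn ℝ univ fun x => v (s, x) - A / 2 * x ^ 2 := by
  refine LinearOrder.concaveOn_of_lt convex_univ ?_
  intro a _ b _ hab t u ht hu htu
  simp only [smul_eq_mul]
  set y := t * a + u * b with hy
  have ht' : t = 1 - u := by linarith
  have hba : 0 < b - a := by linarith
  -- With this slope the parabola of second derivative `A` leaves equal differences at both ends, so
  -- the minimum in `slice` is explicit.
  set sl := (v (s, b) - v (s, a)) / (b - a) - A / 2 * (b - a) with hsl
  have hyab : y ∈ Icc a b := by
    constructor <;> rw [hy, ht'] <;> nlinarith
  have := hv.slice hs hsT (ψ := fun y => sl * (y - a) + A / 2 * (y - a) ^ 2)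
    (by fun_prop) (a := a) (b := b) (fun y _ q => by
      rw [iteratedDeriv_two_quadratic]
      simpa [mul_div_cancel₀] using hA y q) hyab
  have e1 : v (s, a) - (sl * (a - a) + A / 2 * (a - a) ^ 2) = v (s, a) := by ring
  have e2 : v (s, b) - (sl * (b - a) + A / 2 * (b - a) ^ 2) = v (s, a) := by
    rw [hsl]; field_simp; ring
  have e3 : y - a = u * (b - a) := by rw [hy, ht']; ring
  have e4 : sl * (u * (b - a)) = u * (v (s, b) - v (s, a)) - A / 2 * u * (b - a) ^ 2 := by
    rw [hsl]; field_simp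
  rw [e1, e2, min_self, e3, e4] at this
  have e5 : A / 2 * y ^ 2 = t * (A / 2 * a ^ 2) + u * (A / 2 * b ^ 2)
      - A / 2 * (u - u ^ 2) * (b - a) ^ 2 := by rw [hy, ht']; ring
  rw [e5, ht'] at *
  nlinarith

/-- A supersolution dominates the terminal condition. -/
theorem IsViscositySupersolution.terminal_le (hv : IsViscositySupersolution T G h v) {Λ : ℝ}
    (hΛ : ∀ y q M, Λ < q → G y q M < 0) (hT : 0 < T) (hh : Continuous h) (x : ℝ) :
    h x ≤ v (T, x) := by
  by_contra! hlt
  obtain ⟨m, hm1, hm2⟩ := exists_between hlt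
  obtain ⟨r, hr, hball⟩ := Metric.eventually_nhds_iff.1
    (hh.continuousAt.eventually (lt_mem_nhds hm2))
  set K : Set (ℝ × ℝ) := Icc 0 T ×ˢ Icc (x - r / 2) (x + r / 2) with hK
  have hKc : IsCompact K := isCompact_Icc.prod isCompact_Icc
  have hKS : K ⊆ strip T := fun z hz => ⟨hz.1, mem_univ _⟩
  obtain ⟨B, hB⟩ := exists_lowerBound_of_lsc hKc (hv.lsc.mono hKS)
  set κ := (|m - B| + 1) / (r / 2) ^ 2 with hκ
  have hκr : κ * (r / 2) ^ 2 = |m - B| + 1 := by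
    rw [hκ]; field_simp
  have hκ0 : 0 ≤ κ := by positivity
  set Λ' := max Λ 0 + 1
  have hΛ0 : 0 ≤ Λ' := by positivity
  -- A time slope above `Λ` makes the operator negative wherever `φ` touches. Contact is thus only
  -- possible at `T`, with the terminal alternative `v ≥ h`.
  set φ : ℝ × ℝ → ℝ := fun z => Λ' * (z.1 - T) + -(κ * (z.2 - x) ^ 2) with hφ
  have hφC : ContDiff ℝ 2 φ := by fun_prop
  have hval : v (T, x) - φ (T, x) = v (T, x) := by simp [hφ]
  obtain ⟨p, hpK, hpU, hmin, hle⟩ := exists_isLocalMinOn (S := strip T)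
    (J := fun z => v z - φ z) (U := univ ×ˢ Ioo (x - r / 2) (x + r / 2)) hKc
    (lowerSemicontinuousOn_sub (hv.lsc.mono hKS) hφC.continuous) (isOpen_univ.prod isOpen_Ioo)
    (fun z hz => ⟨hz.2.1, Ioo_subset_Icc_self hz.1.2⟩)
    (z₀ := (T, x)) ⟨⟨hT.le, le_rfl⟩, ⟨by linarith, by linarith⟩⟩ (by
      rintro ⟨t, y⟩ hz hzU
      simp only [hval]
      have ht' : y ∉ Ioo (x - r / 2) (x + r / 2) := fun h' => hzU ⟨mem_univ _, h'⟩
      have : (r / 2) ^ 2 ≤ (y - x) ^ 2 := by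
        rw [mem_Ioo, not_and_or, not_lt, not_lt] at ht'
        rcases ht' with h' | h' <;> nlinarith
      have h3 := mul_le_mul_of_nonneg_left this hκ0
      have h4 := hB _ hz
      have h5 := le_abs_self (m - B)
      have h6 : 0 ≤ Λ' * (T - t) := mul_nonneg hΛ0 (by linarith [hz.1.2])
      simp only [hφ]
      linarith)
  simp only [hval] at hle
  have e1 : timeDeriv φ p = Λ' := by
    refine timeDeriv_sep (a := fun t => Λ' * (t - T)) ?_ (fun y => -(κ * (y - x) ^ 2))
    simpa using ((hasDerivAt_id p.1).sub_const T).const_mul Λ'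
  have hneg : G p.2 (timeDeriv φ p) (spaceDeriv2 φ p) < 0 := by
    rw [e1]; exact hΛ _ _ _ (lt_of_le_of_lt (le_max_left Λ 0) (lt_add_one _))
  rcases lt_or_eq_of_le hpK.1.2 with hpT | hpT
  · exact absurd (hv.interior φ hφC p (hKS hpK) hpT hmin) (not_le.2 hneg)
  · have h1 := hv.terminal φ hφC p (hKS hpK) hpT hmin
    rcases le_max_iff.1 h1 with h2 | h2
    · exact absurd h2 (not_le.2 hneg)
    · have h2' : 0 ≤ v p - h p.2 := by exact_mod_cast h2
      have h3 : m < h p.2 := hball (by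
        rw [Real.dist_eq]
        have : |p.2 - x| < r / 2 := abs_lt.2 ⟨by linarith [hpU.2.1], by linarith [hpU.2.2]⟩
        linarith)
      have h4 : 0 ≤ κ * (p.2 - x) ^ 2 := by positivity
      simp only [hφ, hpT, sub_self] at hle
      linarith

end

/-! ### Linear growth and limits at the terminal time -/

theorem HasLinearGrowth.exists_eventually_abs_le {T : ℝ} {u : ℝ × ℝ → ℝ}
    (hu : HasLinearGrowth T u) (p : ℝ × ℝ) : ∃ B, ∀ᶠ z in 𝓝[strip T] p, |u z| ≤ B := by
  obtain ⟨C, hC⟩ := hu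
  refine ⟨|C| * (1 + |p.2| + 1), ?_⟩
  have h1 : ∀ᶠ z : ℝ × ℝ in 𝓝 p, |z.2| < |p.2| + 1 :=
    ContinuousAt.eventually_lt (by fun_prop) continuousAt_const (by simp)
  filter_upwards [nhdsWithin_le_nhds h1, self_mem_nhdsWithin] with z hz hzS
  refine (hC z hzS).trans ?_
  exact mul_le_mul (le_abs_self C) (by linarith) (by positivity) (abs_nonneg C)

/-- The part of the strip before the terminal time. -/
def openStrip (T : ℝ) : Set (ℝ × ℝ) := Ico 0 T ×ˢ univ

theorem openStrip_subset_strip (T : ℝ) : openStrip T ⊆ strip T :=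
  fun _ hz => ⟨Ico_subset_Icc_self hz.1, mem_univ _⟩

theorem openStrip_neBot {T : ℝ} (hT : 0 < T) (x : ℝ) : (𝓝[openStrip T] (T, x)).NeBot := by
  rw [← mem_closure_iff_nhdsWithin_neBot, openStrip, closure_prod_eq, closure_Ico hT.ne,
    closure_univ]
  exact ⟨⟨hT.le, le_rfl⟩, mem_univ _⟩

/-- Lower limit at the terminal time from earlier times. -/
noncomputable def terminalLimit (T : ℝ) (v : ℝ × ℝ → ℝ) (x : ℝ) : ℝ :=
  liminf v (𝓝[openStrip T] (T, x))

theorem isBoundedUnder_of_eventually_abs_le {α : Type*} {l : Filter α} {u : α → ℝ} {B : ℝ}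
    (h : ∀ᶠ z in l, |u z| ≤ B) : l.IsBoundedUnder (· ≥ ·) u ∧ l.IsBoundedUnder (· ≤ ·) u :=
  ⟨⟨-B, eventually_map.2 (h.mono fun _ hz => (abs_le.1 hz).1)⟩,
    ⟨B, eventually_map.2 (h.mono fun _ hz => (abs_le.1 hz).2)⟩⟩

section
variable {T : ℝ} {v : ℝ × ℝ → ℝ}

theorem HasLinearGrowth.isBoundedUnder_openStrip (hv : HasLinearGrowth T v) (x : ℝ) :
    (𝓝[openStrip T] (T, x)).IsBoundedUnder (· ≥ ·) v ∧
      (𝓝[openStrip T] (T, x)).IsBoundedUnder (· ≤ ·) v := by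
  obtain ⟨B, hB⟩ := hv.exists_eventually_abs_le (T, x)
  exact isBoundedUnder_of_eventually_abs_le
    ((nhdsWithin_mono _ (openStrip_subset_strip T)) hB)

theorem eventually_lt_of_lt_terminalLimit (hv : HasLinearGrowth T v) {x a : ℝ}
    (h : a < terminalLimit T v x) : ∀ᶠ z in 𝓝[openStrip T] (T, x), a < v z :=
  eventually_lt_of_lt_liminf h (hv.isBoundedUnder_openStrip x).1

theorem frequently_lt_of_terminalLimit_lt (hv : HasLinearGrowth T v) (hT : 0 < T) {x a : ℝ}
    (h : terminalLimit T v x < a) : ∃ᶠ z in 𝓝[openStrip T] (T, x), v z < a := by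
  have := openStrip_neBot hT x
  exact frequently_lt_of_liminf_lt (hv.isBoundedUnder_openStrip x).2.isCoboundedUnder_ge h

theorem le_terminalLimit (hv : HasLinearGrowth T v) (hT : 0 < T) {x a : ℝ}
    (h : ∀ᶠ z in 𝓝[openStrip T] (T, x), a ≤ v z) : a ≤ terminalLimit T v x := by
  have := openStrip_neBot hT x
  exact le_liminf_of_le (hv.isBoundedUnder_openStrip x).2.isCoboundedUnder_ge h

theorem terminalLimit_le (hv : HasLinearGrowth T v) (hT : 0 < T) {x a : ℝ}
    (h : ∀ᶠ z in 𝓝[openStrip T] (T, x), v z ≤ a) : terminalLimit T v x ≤ a := by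
  have := openStrip_neBot hT x
  exact liminf_le_of_frequently_le h.frequently (hv.isBoundedUnder_openStrip x).1

theorem lowerSemicontinuous_terminalLimit (hv : HasLinearGrowth T v) (hT : 0 < T) :
    LowerSemicontinuous (terminalLimit T v) := by
  intro x a ha
  obtain ⟨a', ha1, ha2⟩ := exists_between ha
  have h1 := eventually_lt_of_lt_terminalLimit hv ha2
  have h2 := eventually_eventually_nhdsWithin.2 h1
  have h3 : ∀ᶠ z in 𝓝 (T, x), ∀ᶠ w in 𝓝[openStrip T] z, a' < v w :=
    eventually_nhds_nhdsWithin.2 h1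
  have ht : Tendsto (fun y : ℝ => (T, y)) (𝓝 x) (𝓝 (T, x)) :=
    (by fun_prop : Continuous fun y : ℝ => (T, y)).tendsto x
  filter_upwards [ht.eventually h3] with y hy
  exact ha1.trans_le (le_terminalLimit hv hT (hy.mono fun _ => le_of_lt))

theorem abs_terminalLimit_le (hT : 0 < T) {C : ℝ}
    (hC : ∀ p ∈ strip T, |v p| ≤ C * (1 + |p.2|)) (x : ℝ) :
    |terminalLimit T v x| ≤ C * (1 + |x|) := by
  have hv : HasLinearGrowth T v := ⟨C, hC⟩
  have hev : ∀ ε > 0, ∀ᶠ z in 𝓝[openStrip T] (T, x), |v z| ≤ C * (1 + |x|) + ε := by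
    intro ε hε
    have h1 : ∀ᶠ z : ℝ × ℝ in 𝓝 (T, x), C * (1 + |z.2|) < C * (1 + |x|) + ε :=
      ContinuousAt.eventually_lt (by fun_prop) continuousAt_const (by simpa)
    filter_upwards [nhdsWithin_le_nhds h1, self_mem_nhdsWithin] with z hz hzS
    exact (hC z (openStrip_subset_strip T hzS)).trans hz.le
  refine abs_le.2 ⟨?_, ?_⟩
  · refine le_of_forall_pos_sub_le fun ε hε => ?_
    exact le_terminalLimit hv hT ((hev ε hε).mono fun z hz => by linarith [(abs_le.1 hz).1])
  · refine le_of_forall_pos_le_add fun ε hε => ?_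
    exact terminalLimit_le hv hT ((hev ε hε).mono fun z hz => (abs_le.1 hz).2)

/-! ### Extension past the terminal time -/

/-- Extension of a supersolution past the terminal time. -/
noncomputable def extendSuper (T A : ℝ) (v : ℝ × ℝ → ℝ) (z : ℝ × ℝ) : ℝ :=
  if z.1 < T then v z else terminalLimit T v z.2 - A * (z.1 - T)

theorem extendSuper_of_lt {A : ℝ} {z : ℝ × ℝ} (h : z.1 < T) : extendSuper T A v z = v z :=
  if_pos h

theorem extendSuper_of_ge {A : ℝ} {z : ℝ × ℝ} (h : T ≤ z.1) :
    extendSuper T A v z = terminalLimit T v z.2 - A * (z.1 - T) := if_neg (not_lt.2 h)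

theorem nhdsWithin_strip_eq {z : ℝ × ℝ} (h : z.1 < T) :
    𝓝[Ici 0 ×ˢ univ] z = 𝓝[strip T] z := by
  have ho : IsOpen {w : ℝ × ℝ | w.1 < T} := isOpen_lt continuous_fst continuous_const
  refine nhdsWithin_eq_nhdsWithin (s := {w : ℝ × ℝ | w.1 < T}) h ho ?_
  ext w
  constructor
  · rintro ⟨hw, hw2⟩
    exact ⟨⟨⟨hw.1, le_of_lt hw2⟩, mem_univ _⟩, hw2⟩
  · rintro ⟨hw, hw2⟩
    exact ⟨⟨hw.1.1, mem_univ _⟩, hw2⟩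

theorem extendSuper_eventuallyEq (A : ℝ) {z : ℝ × ℝ} (h : z.1 < T) :
    extendSuper T A v =ᶠ[𝓝 z] v := by
  have ho : IsOpen {w : ℝ × ℝ | w.1 < T} := isOpen_lt continuous_fst continuous_const
  filter_upwards [ho.mem_nhds h] with w hw
  exact extendSuper_of_lt hw

/-- The values of `v` at `T` itself are discarded. At `T` the two pieces fit together because
`terminalLimit` is the lower limit from earlier times. -/
theorem lowerSemicontinuousOn_extendSuper (hv : HasLinearGrowth T v) (hT : 0 < T)
    (hl : LowerSemicontinuousOn v (strip T)) (A : ℝ) :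
    LowerSemicontinuousOn (extendSuper T A v) (Ici 0 ×ˢ univ) := by
  intro z hz a ha
  have hk : LowerSemicontinuous fun z : ℝ × ℝ => terminalLimit T v z.2 - A * (z.1 - T) := by
    rw [← lowerSemicontinuousOn_univ_iff]
    refine lowerSemicontinuousOn_sub (u := fun z : ℝ × ℝ => terminalLimit T v z.2) ?_
      (by fun_prop : Continuous fun z : ℝ × ℝ => A * (z.1 - T))
    rw [lowerSemicontinuousOn_univ_iff]
    exact (lowerSemicontinuous_terminalLimit hv hT).comp continuous_snd
  rcases lt_trichotomy z.1 T with h | h | h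
  · rw [extendSuper_of_lt h] at ha
    have hzS : z ∈ strip T := ⟨⟨hz.1, h.le⟩, mem_univ _⟩
    rw [nhdsWithin_strip_eq h]
    filter_upwards [hl z hzS a ha, nhdsWithin_le_nhds (extendSuper_eventuallyEq A h)] with w h1 h2
    rwa [h2]
  · rw [extendSuper_of_ge h.ge] at ha
    have h1 := nhdsWithin_le_nhds (s := Ici 0 ×ˢ univ) (hk z a ha)
    have hz2 : z = (T, z.2) := by rw [← h]
    have h2 : a < terminalLimit T v z.2 := by rw [h, sub_self, mul_zero, sub_zero] at ha; exact ha
    have h3 := eventually_lt_of_lt_terminalLimit hv h2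
    rw [← hz2, eventually_nhdsWithin_iff] at h3
    filter_upwards [h1, nhdsWithin_le_nhds h3, self_mem_nhdsWithin] with w e1 e2 e3
    rcases lt_or_ge w.1 T with h4 | h4
    · rw [extendSuper_of_lt h4]
      exact e2 ⟨⟨e3.1, h4⟩, mem_univ _⟩
    · rw [extendSuper_of_ge h4]
      exact e1
  · rw [extendSuper_of_ge h.le] at ha
    have ho : IsOpen {w : ℝ × ℝ | T < w.1} := isOpen_lt continuous_const continuous_fst
    filter_upwards [nhdsWithin_le_nhds (hk z a ha), nhdsWithin_le_nhds (ho.mem_nhds h)]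
      with w e1 e2
    rw [extendSuper_of_ge (le_of_lt e2)]
    exact e1

end

/-! ### The gamma constraint at the terminal time -/

section
variable {T : ℝ} {f σ γ h : ℝ → ℝ} {c B ι L : ℝ} {D : ℝ → Set ℝ} {v : ℝ × ℝ → ℝ}

theorem CoeffBounds.not_infOperator_nonneg (_hb : CoeffBounds f σ γ c B ι) {y q M : ℝ}
    (h : ∃ y' ∈ D y, γ y' < M) : ¬ 0 ≤ infOperator f σ γ D y q M := by
  rw [infOperator_nonneg_iff]
  push Not
  obtain ⟨y', hy', h⟩ := h
  exact ⟨y', hy', by rw [pricingF_eq]; exact (min_le_right _ _).trans_lt (by linarith)⟩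

/-- The gamma constraint passes to the limit at the terminal time. -/
theorem IsViscositySupersolution.terminalLimit_constraint (hb : CoeffBounds f σ γ c B ι)
    (hD : IsLipschitzFamily D L) (hv : IsViscositySupersolution T (infOperator f σ γ D) h v)
    (hg : HasLinearGrowth T v) (hT : 0 < T) {ψ : ℝ → ℝ} (hψ : ContDiff ℝ 2 ψ) {x : ℝ}
    (hmin : IsLocalMin (fun y => terminalLimit T v y - ψ y) x) :
    ∀ x' ∈ D x, iteratedDeriv 2 ψ x ≤ γ x' := by
  by_contra! hcon
  obtain ⟨x', hx', hlt⟩ := hcon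
  choose y' hy' hyl using fun z => hD.lip x z x' hx'
  have ht : Tendsto y' (𝓝 x) (𝓝 x') := by
    rw [tendsto_iff_norm_sub_tendsto_zero]
    refine squeeze_zero (fun _ => norm_nonneg _) hyl ?_
    have : Continuous fun z => L * |z - x| := by fun_prop
    simpa using this.tendsto x
  have hψ2 : Continuous (iteratedDeriv 2 ψ) := hψ.continuous_iteratedDeriv 2 (by norm_num)
  have hev : ∀ᶠ y in 𝓝 x, γ (y' y) < iteratedDeriv 2 ψ y - 12 * (y - x) ^ 2 :=
    Tendsto.eventually_lt ((hb.gamma_cont.tendsto x').comp ht)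
      ((by fun_prop : Continuous fun y => iteratedDeriv 2 ψ y - 12 * (y - x) ^ 2).tendsto x)
      (by simpa using hlt)
  obtain ⟨r, hr, hball⟩ := Metric.eventually_nhds_iff.1 (hev.and hmin)
  set s := r / 2 with hs
  have hs0 : 0 < s := by positivity
  -- The quartic makes the minimum strict by `s ^ 4` at the end points and leaves the second
  -- derivative at `x` unchanged. Near `x` the constraint is still violated, so `slice` applies at
  -- every time before `T`.
  set ψ4 : ℝ → ℝ := fun y => ψ y + -1 * (y - x) ^ 4 with hψ4
  have hψ4C : ContDiff ℝ 2 ψ4 := by fun_prop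
  have hslice : ∀ t, 0 ≤ t → t < T → ∀ y ∈ Icc (x - s) (x + s),
      min (v (t, x - s) - ψ4 (x - s)) (v (t, x + s) - ψ4 (x + s)) ≤ v (t, y) - ψ4 y := by
    intro t ht0 htT y hy
    refine hv.slice ht0 htT hψ4C (fun w hw q => hb.not_infOperator_nonneg ⟨y' w, hy' w, ?_⟩) hy
    have := (hball (y := w) (by
      rw [Real.dist_eq, abs_lt]; constructor <;> linarith [hw.1, hw.2])).1
    rw [hψ4, iteratedDeriv_two_add hψ (by fun_prop), iteratedDeriv_two_quartic]
    linarith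
  have hend : ∀ w, |w - x| = s → ∀ᶠ z : ℝ × ℝ in 𝓝[openStrip T] (T, x),
      terminalLimit T v x - ψ x + 2 * s ^ 4 / 3 < v (z.1, w) - ψ4 w := by
    intro w hw
    have h1 := (hball (y := w) (by rw [Real.dist_eq, hw]; linarith)).2
    have h2 : (w - x) ^ 4 = s ^ 4 := by rw [← hw, ← abs_pow, abs_of_nonneg (by positivity)]
    have h3 := eventually_lt_of_lt_terminalLimit hg
      (show terminalLimit T v w - s ^ 4 / 3 < terminalLimit T v w by
        have : 0 < s ^ 4 := by positivity
        linarith)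
    have ht : Tendsto (fun z : ℝ × ℝ => (z.1, w)) (𝓝[openStrip T] (T, x))
        (𝓝[openStrip T] (T, w)) := by
      refine tendsto_nhdsWithin_iff.2 ⟨?_, ?_⟩
      · exact ((by fun_prop : Continuous fun z : ℝ × ℝ => (z.1, w)).tendsto (T, x)).mono_left
          nhdsWithin_le_nhds
      · filter_upwards [self_mem_nhdsWithin] with z hz
        exact ⟨hz.1, mem_univ _⟩
    filter_upwards [ht.eventually h3] with z hz
    simp only [hψ4, h2]
    simp only at h1
    linarith
  have hs4 : 0 < s ^ 4 := by positivity
  -- Along points realising the lower limit at `x` the value is nearly minimal, whereas at both ends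
  -- it exceeds the minimum by `2 * s ^ 4 / 3`; this contradicts `slice`.
  have hfreq := frequently_lt_of_terminalLimit_lt hg hT
    (show terminalLimit T v x < terminalLimit T v x + s ^ 4 / 3 by linarith)
  have hnear : ∀ᶠ z : ℝ × ℝ in 𝓝[openStrip T] (T, x),
      ψ x - s ^ 4 / 3 < ψ4 z.2 ∧ |z.2 - x| < s := by
    refine nhdsWithin_le_nhds (Filter.Eventually.and ?_ ?_)
    · have := hψ.continuous
      refine ContinuousAt.eventually_lt continuousAt_const (by fun_prop) ?_
      simp [hψ4]; exact hs4
    · exact ContinuousAt.eventually_lt (by fun_prop) continuousAt_const (by simpa)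
  obtain ⟨z, hz, ⟨hz1, hz2⟩, h1, h2, hzS⟩ := (hfreq.and_eventually (hnear.and
    ((hend (x - s) (by simp [abs_of_pos hs0])).and ((hend (x + s)
      (by simp [abs_of_pos hs0])).and self_mem_nhdsWithin)))).exists
  have h3 := hslice z.1 hzS.1.1 hzS.1.2 z.2 (by
    have := abs_lt.1 hz2
    constructor <;> linarith)
  rcases min_le_iff.1 h3 with h4 | h4 <;> linarith

/-- The extended supersolution is a supersolution for all nonnegative times. -/
theorem IsViscositySupersolution.extend (hb : CoeffBounds f σ γ c B ι)
    (hD : IsLipschitzFamily D L) (hv : IsViscositySupersolution T (infOperator f σ γ D) h v)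
    (hg : HasLinearGrowth T v) (hT : 0 < T) {φ : ℝ × ℝ → ℝ} (hφ : ContDiff ℝ 2 φ) {p : ℝ × ℝ}
    (hp : 0 ≤ p.1) (hmin : IsLocalMinOn
      (fun z => extendSuper T (driftBound c B ι) v z - φ z) (Ici 0 ×ˢ univ) p) :
    0 ≤ infOperator f σ γ D p.2 (timeDeriv φ p) (spaceDeriv2 φ p) := by
  rcases lt_or_ge p.1 T with hpT | hpT
  · refine hv.interior φ hφ p ⟨⟨hp, hpT.le⟩, mem_univ _⟩ hpT ?_
    unfold IsLocalMinOn at hmin ⊢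
    rw [nhdsWithin_strip_eq hpT] at hmin
    refine IsMinFilter.congr hmin ?_ ?_
    · filter_upwards [nhdsWithin_le_nhds (extendSuper_eventuallyEq (v := v)
        (driftBound c B ι) hpT)] with z hz
      rw [hz]
    · rw [extendSuper_of_lt hpT]
  -- From `T` on, later times show that the time slope of `φ` is at most `-C`, and the slice in
  -- space gives the gamma constraint. As `drift` is bounded by `C`, these two facts imply the
  -- inequality.
  · set C := driftBound c B ι
    have hmin' : ∀ᶠ z in 𝓝[Ici 0 ×ˢ univ] p,
      extendSuper T C v p - φ p ≤ extendSuper T C v z - φ z := hmin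
    rw [eventually_nhdsWithin_iff, ← Prod.mk.eta (p := p)] at hmin'
    have ht1 : Tendsto (fun s : ℝ => (s, p.2)) (𝓝 p.1) (𝓝 (p.1, p.2)) :=
      (by fun_prop : Continuous fun s : ℝ => (s, p.2)).tendsto _
    have ht2 : Tendsto (fun y : ℝ => (p.1, y)) (𝓝 p.2) (𝓝 (p.1, p.2)) :=
      (by fun_prop : Continuous fun y : ℝ => (p.1, y)).tendsto _
    refine hb.infOperator_nonneg_of_small ?_ ?_
    · have hd := (hasDerivAt_slice_fst hφ p).add ((hasDerivAt_id p.1).const_mul C)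
      have := nonpos_of_eventually_right hd (by
        filter_upwards [nhdsWithin_le_nhds (ht1.eventually hmin'), self_mem_nhdsWithin]
          with s hs hsp
        have hsp' : p.1 < s := hsp
        have h2 := hs ⟨by simp; linarith, mem_univ _⟩
        rw [extendSuper_of_ge (by simpa using hpT),
          extendSuper_of_ge (by simp; linarith)] at h2
        simp only [Pi.add_apply, id] at h2 ⊢
        linarith)
      linarith
    · refine hv.terminalLimit_constraint hb hD hg hT (contDiff_slice_snd hφ p.1) ?_
      filter_upwards [ht2.eventually hmin'] with y hy
      have h2 := hy ⟨hp, mem_univ _⟩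
      rw [extendSuper_of_ge (by simpa using hpT),
          extendSuper_of_ge (by simpa using hpT)] at h2
      simp only at h2
      linarith

end

end GammaPricing

namespace GammaPricing

/-! ### Supersolutions for all nonnegative times and their inf-convolutions in time -/

/-- A supersolution on `[0, ∞) × ℝ`, bounded below by `-A (1 + |x|) - C t`. -/
structure IsGlobalSuper (G : ℝ → ℝ → ℝ → EReal) (A C : ℝ) (w : ℝ × ℝ → ℝ) : Prop where
  lsc : LowerSemicontinuousOn w (Ici 0 ×ˢ univ)
  super : ∀ φ : ℝ × ℝ → ℝ, ContDiff ℝ 2 φ → ∀ p : ℝ × ℝ, 0 ≤ p.1 →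
    IsLocalMinOn (fun z => w z - φ z) (Ici 0 ×ˢ univ) p →
      0 ≤ G p.2 (timeDeriv φ p) (spaceDeriv2 φ p)
  lower : ∀ z : ℝ × ℝ, 0 ≤ z.1 → -(A * (1 + |z.2|)) - C * z.1 ≤ w z
  upper : ∀ x : ℝ, w (0, x) ≤ A * (1 + |x|)
  A_nonneg : 0 ≤ A
  C_nonneg : 0 ≤ C

theorem IsGlobalSuper.concaveOn_slice {G : ℝ → ℝ → ℝ → EReal} {A C Q : ℝ} {w : ℝ × ℝ → ℝ}
    (hw : IsGlobalSuper G A C w) (hQ : ∀ y q, ¬ 0 ≤ G y q Q) {s : ℝ} (hs : 0 ≤ s) :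
    ConcaveOn ℝ univ fun x => w (s, x) - Q / 2 * x ^ 2 := by
  have hsub : strip (s + 1) ⊆ Ici 0 ×ˢ univ := fun z hz => ⟨hz.1.1, mem_univ _⟩
  -- Any horizon beyond `s` would do; with `w` itself as terminal value the terminal condition is
  -- void.
  have : IsViscositySupersolution (s + 1) G (fun x => w (s + 1, x)) w :=
    { lsc := hw.lsc.mono hsub
      interior := fun φ hφ p hp hpT hmin => hw.super φ hφ p hp.1.1 (by
        unfold IsLocalMinOn at hmin ⊢
        rwa [nhdsWithin_strip_eq hpT])
      terminal := fun φ hφ p hp hpT hmin => le_max_of_le_right (by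
        rw [← hpT]; simp) }
  exact this.concaveOn_slice hQ hs (lt_add_one s)

/-- Inf-convolution in time over `[0, ∞)`. -/
noncomputable def infConv (δ : ℝ) (w : ℝ × ℝ → ℝ) (z : ℝ × ℝ) : ℝ :=
  sInf ((fun s => w (s, z.2) + (z.1 - s) ^ 2 / (2 * δ)) '' Ici 0)

section
variable {G : ℝ → ℝ → ℝ → EReal} {A C Q δ : ℝ} {w : ℝ × ℝ → ℝ}

theorem IsGlobalSuper.le_penalized (hw : IsGlobalSuper G A C w) (hδ : 0 < δ) (t x : ℝ) {s : ℝ}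
    (hs : 0 ≤ s) : -(A * (1 + |x|)) - C * t - C ^ 2 * δ / 2 ≤
      w (s, x) + (t - s) ^ 2 / (2 * δ) := by
  have h1 := hw.lower (s, x) hs
  have h2 : 0 ≤ (t - s + C * δ) ^ 2 / (2 * δ) := by positivity
  have h3 : (t - s + C * δ) ^ 2 / (2 * δ) = (t - s) ^ 2 / (2 * δ) + C * (t - s) + C ^ 2 * δ / 2 := by
    field_simp; ring
  simp only at h1
  linarith

theorem IsGlobalSuper.bddBelow (hw : IsGlobalSuper G A C w) (hδ : 0 < δ) (z : ℝ × ℝ) :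
    BddBelow ((fun s => w (s, z.2) + (z.1 - s) ^ 2 / (2 * δ)) '' Ici 0) := by
  refine ⟨-(A * (1 + |z.2|)) - C * z.1 - C ^ 2 * δ / 2, ?_⟩
  rintro _ ⟨s, hs, rfl⟩
  exact hw.le_penalized hδ z.1 z.2 hs

theorem IsGlobalSuper.infConv_le (hw : IsGlobalSuper G A C w) (hδ : 0 < δ) (t x : ℝ) {s : ℝ}
    (hs : 0 ≤ s) : infConv δ w (t, x) ≤ w (s, x) + (t - s) ^ 2 / (2 * δ) :=
  csInf_le (hw.bddBelow hδ (t, x)) ⟨s, hs, rfl⟩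

theorem IsGlobalSuper.infConv_le_self (hw : IsGlobalSuper G A C w) (hδ : 0 < δ) (t x : ℝ)
    (ht : 0 ≤ t) : infConv δ w (t, x) ≤ w (t, x) := by
  simpa using hw.infConv_le hδ t x ht

theorem IsGlobalSuper.le_infConv (hw : IsGlobalSuper G A C w) (hδ : 0 < δ) (t x : ℝ) :
    -(A * (1 + |x|)) - C * t - C ^ 2 * δ / 2 ≤ infConv δ w (t, x) := by
  refine le_csInf ⟨_, 0, self_mem_Ici, rfl⟩ ?_
  rintro _ ⟨s, hs, rfl⟩
  exact hw.le_penalized hδ t x hs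

theorem IsGlobalSuper.exists_contact (hw : IsGlobalSuper G A C w) (hδ : 0 < δ) (t x : ℝ) :
    ∃ s, 0 ≤ s ∧ infConv δ w (t, x) = w (s, x) + (t - s) ^ 2 / (2 * δ) := by
  set J : ℝ → ℝ := fun s => w (s, x) + (t - s) ^ 2 / (2 * δ) with hJ
  -- Beyond `S` the quadratic penalty outweighs the linear lower bound of `w` and the value at time
  -- `0`, so the infimum is attained on `[0, S]`.
  set S := 2 * δ * (|t| / δ + C + 2 * A * (1 + |x|)) + 1 with hS
  have hA := hw.A_nonneg
  have hC := hw.C_nonneg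
  have hS1 : 1 ≤ S := by
    rw [hS]
    have : 0 ≤ 2 * δ * (|t| / δ + C + 2 * A * (1 + |x|)) := by positivity
    linarith
  have hlsc : LowerSemicontinuousOn J (Icc 0 S) := by
    have h1 : LowerSemicontinuousOn (fun s => w (s, x)) (Icc 0 S) :=
      hw.lsc.comp (by fun_prop : ContinuousOn (fun s : ℝ => (s, x)) (Icc 0 S))
        (fun s hs => ⟨hs.1, mem_univ _⟩)
    exact h1.add (ContinuousOn.lowerSemicontinuousOn (by fun_prop))
  obtain ⟨s, hs, hmin⟩ := hlsc.exists_isMinOn ⟨0, left_mem_Icc.2 (by linarith)⟩ isCompact_Icc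
  have hall : ∀ s' ∈ Ici (0 : ℝ), J s ≤ J s' := by
    intro s' hs'
    rcases le_total s' S with h | h
    · exact hmin ⟨hs', h⟩
    · refine (hmin (left_mem_Icc.2 (by linarith))).trans ?_
      have h0 := hw.upper x
      have h1 := hw.lower (s', x) hs'
      simp only at h1
      simp only [hJ]
      have e1 : (t - s') ^ 2 / (2 * δ) = (t - 0) ^ 2 / (2 * δ) + s' * (s' / (2 * δ) - t / δ) := by
        field_simp; ring
      have e2 : |t| / δ + C + 2 * A * (1 + |x|) ≤ s' / (2 * δ) := by
        rw [le_div_iff₀ (by positivity)]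
        linarith
      have e3 : t / δ ≤ |t| / δ := div_le_div_of_nonneg_right (le_abs_self t) hδ.le
      have e4 : s' * (C + 2 * A * (1 + |x|)) ≤ s' * (s' / (2 * δ) - t / δ) :=
        mul_le_mul_of_nonneg_left (by linarith) hs'
      have e5 : 0 ≤ 2 * A * (1 + |x|) := by positivity
      have e6 : 2 * A * (1 + |x|) ≤ s' * (2 * A * (1 + |x|)) :=
        le_mul_of_one_le_left e5 (hS1.trans h)
      rw [e1]
      linarith
  refine ⟨s, hs.1, le_antisymm (hw.infConv_le hδ t x hs.1) ?_⟩
  refine le_csInf ⟨_, 0, self_mem_Ici, rfl⟩ ?_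
  rintro _ ⟨s', hs', rfl⟩
  exact hall s' hs'

theorem IsGlobalSuper.infConv_le_growth (hw : IsGlobalSuper G A C w) (hδ : 0 < δ) (t x : ℝ) :
    infConv δ w (t, x) ≤ A * (1 + |x|) + t ^ 2 / (2 * δ) := by
  have h1 := hw.infConv_le hδ t x le_rfl
  have h2 := hw.upper x
  rw [sub_zero] at h1
  linarith

/-- An infimum of functions that are semiconcave with the same constant: the contact time at the
mixed point is admissible at both end points. -/
theorem IsGlobalSuper.infConv_concaveOn_space (hw : IsGlobalSuper G A C w) (hδ : 0 < δ)
    (hQ : ∀ y q, ¬ 0 ≤ G y q Q) (t : ℝ) :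
    ConcaveOn ℝ univ fun x => infConv δ w (t, x) - Q / 2 * x ^ 2 := by
  refine ⟨convex_univ, fun a _ b _ μ ν hμ hν hμν => ?_⟩
  obtain ⟨s, hs, h⟩ := hw.exists_contact hδ t (μ • a + ν • b)
  have hc := (hw.concaveOn_slice hQ hs).2 (mem_univ a) (mem_univ b) hμ hν hμν
  have ha := mul_le_mul_of_nonneg_left (hw.infConv_le hδ t a hs) hμ
  have hb := mul_le_mul_of_nonneg_left (hw.infConv_le hδ t b hs) hν
  simp only at hc ⊢
  rw [h]
  simp only [smul_eq_mul] at *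
  have e : (t - s) ^ 2 / (2 * δ) = μ * ((t - s) ^ 2 / (2 * δ)) + ν * ((t - s) ^ 2 / (2 * δ)) := by
    rw [← add_mul, hμν, one_mul]
  linarith

/-- For fixed `x` this is an infimum of parabolas in `t` with second derivative `1 / δ`, whatever
the regularity of `w`. -/
theorem IsGlobalSuper.infConv_concaveOn_time (hw : IsGlobalSuper G A C w) (hδ : 0 < δ) (x : ℝ) :
    ConcaveOn ℝ univ fun t => infConv δ w (t, x) - (1 / δ) / 2 * t ^ 2 := by
  refine ⟨convex_univ, fun a _ b _ μ ν hμ hν hμν => ?_⟩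
  obtain ⟨s, hs, h⟩ := hw.exists_contact hδ (μ • a + ν • b) x
  have ha := mul_le_mul_of_nonneg_left (hw.infConv_le hδ a x hs) hμ
  have hb := mul_le_mul_of_nonneg_left (hw.infConv_le hδ b x hs) hν
  simp only
  rw [h]
  simp only [smul_eq_mul] at *
  have e : ∀ r : ℝ, (r - s) ^ 2 / (2 * δ) = 1 / δ / 2 * r ^ 2 + (s ^ 2 / (2 * δ) - r * (s / δ)) := by
    intro r; field_simp; ring
  rw [e] at ha hb ⊢
  have e2 : w (s, x) + s ^ 2 / (2 * δ) =
      μ * (w (s, x) + s ^ 2 / (2 * δ)) + ν * (w (s, x) + s ^ 2 / (2 * δ)) := by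
    rw [← add_mul, hμν, one_mul]
  linarith

/-- A test function translated in time to the contact time touches `w` from below there. Neither `x`
nor the derivatives change, and `G` does not depend on time. The extension past `T` is what
guarantees that every contact time `s ≥ 0` is admissible. -/
theorem IsGlobalSuper.infConv_super (hw : IsGlobalSuper G A C w) (hδ : 0 < δ)
    {φ : ℝ × ℝ → ℝ} (hφ : ContDiff ℝ 2 φ) {p : ℝ × ℝ}
    (hmin : IsLocalMin (fun z => infConv δ w z - φ z) p) :
    0 ≤ G p.2 (timeDeriv φ p) (spaceDeriv2 φ p) := by
  obtain ⟨s, hs, h⟩ := hw.exists_contact hδ p.1 p.2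
  set ψ : ℝ × ℝ → ℝ := fun z => φ (z.1 + (p.1 - s), z.2) with hψ
  have hψC : ContDiff ℝ 2 ψ := by fun_prop
  have e1 : timeDeriv ψ (s, p.2) = timeDeriv φ p := by
    rw [hψ, timeDeriv_translate]; simp
  have e2 : spaceDeriv2 ψ (s, p.2) = spaceDeriv2 φ p := by
    rw [hψ, spaceDeriv2_translate]; simp
  have := hw.super ψ hψC (s, p.2) hs ?_
  · rwa [e1, e2] at this
  · have ht : Tendsto (fun z : ℝ × ℝ => (z.1 + (p.1 - s), z.2)) (𝓝 (s, p.2)) (𝓝 p) := by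
      have h0 : Continuous fun z : ℝ × ℝ => (z.1 + (p.1 - s), z.2) := by fun_prop
      have := h0.tendsto (s, p.2)
      simpa using this
    filter_upwards [nhdsWithin_le_nhds (ht.eventually hmin), self_mem_nhdsWithin] with z hz hzS
    have h3 := hw.infConv_le hδ (z.1 + (p.1 - s)) z.2 hzS.1
    have e4 : z.1 + (p.1 - s) - z.1 = p.1 - s := by ring
    rw [e4] at h3
    have h5 : infConv δ w p = w (s, p.2) + (p.1 - s) ^ 2 / (2 * δ) := h
    simp only [hψ, add_sub_cancel, Prod.mk.eta] at hz ⊢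
    linarith

end

/-! ### Regularity of separately semiconcave functions -/

theorem ConcaveOn.abs_sub_le {e : ℝ → ℝ} (he : ConcaveOn ℝ univ e) {R B : ℝ}
    (hB : ∀ t, |t| ≤ R + 2 → |e t| ≤ B) {t t' : ℝ} (ht : |t| ≤ R) (ht' : |t'| ≤ R) :
    |e t - e t'| ≤ 2 * B * |t - t'| := by
  have hR : 0 ≤ R := (abs_nonneg t).trans ht
  have hB0 : 0 ≤ B := (abs_nonneg _).trans (hB 0 (by simp; linarith))
  have h := ConcaveOn.lipschitzOnWith_of_abs_le (x₀ := (0 : ℝ)) (r := R + 2) (ε := 1) (M := B)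
    (he.subset (subset_univ _) (convex_ball _ _)) one_pos
    (fun a ha => hB a (by rw [dist_zero_right, Real.norm_eq_abs] at ha; exact ha.le))
  have := h.dist_le_mul t (by rw [mem_ball_zero_iff, Real.norm_eq_abs]; linarith) t'
    (by rw [mem_ball_zero_iff, Real.norm_eq_abs]; linarith)
  rw [Real.dist_eq, Real.dist_eq, div_one, Real.coe_toNNReal _ (by linarith)] at this
  exact this

/-- A function that is semiconcave in each variable, with locally uniform bounds. -/
structure IsSemiconcave (W : ℝ × ℝ → ℝ) (a Q : ℝ) : Prop where
  time : ∀ x, ConcaveOn ℝ univ fun t => W (t, x) - a / 2 * t ^ 2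
  space : ∀ t, ConcaveOn ℝ univ fun x => W (t, x) - Q / 2 * x ^ 2
  bound : ∀ R, ∃ B, ∀ t x, |t| ≤ R → |x| ≤ R → |W (t, x)| ≤ B

theorem IsSemiconcave.lipschitz_time {W : ℝ × ℝ → ℝ} {a Q : ℝ} (h : IsSemiconcave W a Q) (R : ℝ) :
    ∃ K, 0 ≤ K ∧ ∀ t t' x, |t| ≤ R → |t'| ≤ R → |x| ≤ R →
      |W (t, x) - W (t', x)| ≤ K * |t - t'| := by
  obtain ⟨B, hB⟩ := h.bound (R + 2)
  refine ⟨2 * (|B| + |a| / 2 * (R + 2) ^ 2) + |a| * |R|, by positivity, fun t t' x ht ht' hx => ?_⟩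
  have h1 := ConcaveOn.abs_sub_le (h.time x) (R := R) (B := |B| + |a| / 2 * (R + 2) ^ 2)
    (fun t ht => by
      refine (abs_sub _ _).trans (add_le_add ?_ ?_)
      · exact (hB t x ht (by linarith)).trans (le_abs_self B)
      · rw [abs_mul, abs_div, abs_two, abs_pow]
        have : |t| ^ 2 ≤ (R + 2) ^ 2 := pow_le_pow_left₀ (abs_nonneg t) ht 2
        exact mul_le_mul_of_nonneg_left this (by positivity)) ht ht'
  have e : W (t, x) - W (t', x) = (W (t, x) - a / 2 * t ^ 2 - (W (t', x) - a / 2 * t' ^ 2)) +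
      a / 2 * (t + t') * (t - t') := by ring
  rw [e]
  refine (abs_add_le _ _).trans ?_
  rw [add_mul]
  refine add_le_add h1 ?_
  rw [abs_mul, abs_mul, abs_div, abs_two]
  refine mul_le_mul_of_nonneg_right ?_ (abs_nonneg _)
  have h3 := abs_add_le t t'
  have h4 := le_abs_self R
  nlinarith [abs_nonneg a]

/-- Separate concavity would not suffice by itself without the locally uniform bounds: these give a
Lipschitz constant in time that is uniform in space, to be combined with continuity of a single
space slice. -/
theorem IsSemiconcave.continuous {W : ℝ × ℝ → ℝ} {a Q : ℝ} (h : IsSemiconcave W a Q) :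
    Continuous W := by
  rw [continuous_iff_continuousAt]
  intro p
  obtain ⟨K, hK0, hK⟩ := h.lipschitz_time (|p.1| + |p.2| + 1)
  have hx : Continuous fun x => W (p.1, x) := by
    have h1 := (h.space p.1).continuousOn_interior
    rw [interior_univ, continuousOn_univ] at h1
    exact (h1.add (by fun_prop : Continuous fun x : ℝ => Q / 2 * x ^ 2)).congr
      fun x => by simp
  have h1 : Tendsto (fun z : ℝ × ℝ => K * |z.1 - p.1| + |W (p.1, z.2) - W (p.1, p.2)|) (𝓝 p)
      (𝓝 0) := by
    have : Continuous fun z : ℝ × ℝ => K * |z.1 - p.1| + |W (p.1, z.2) - W (p.1, p.2)| :=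
      (continuous_const.mul (continuous_fst.sub continuous_const).abs).add
        (((hx.comp continuous_snd).sub continuous_const).abs)
    simpa using this.tendsto p
  rw [ContinuousAt, tendsto_iff_norm_sub_tendsto_zero]
  refine squeeze_zero' (Eventually.of_forall fun _ => norm_nonneg _) ?_ h1
  have hn : ∀ᶠ z : ℝ × ℝ in 𝓝 p, |z.1| < |p.1| + 1 ∧ |z.2| < |p.2| + 1 :=
    (ContinuousAt.eventually_lt (by fun_prop) continuousAt_const (by simp)).and
      (ContinuousAt.eventually_lt (by fun_prop) continuousAt_const (by simp))
  filter_upwards [hn] with z hz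
  have := hK z.1 p.1 z.2 (by linarith [abs_nonneg p.2]) (by linarith [abs_nonneg p.2])
    (by linarith [abs_nonneg p.1])
  have e : W z - W p = (W (z.1, z.2) - W (p.1, z.2)) + (W (p.1, z.2) - W (p.1, p.2)) := by simp
  rw [Real.norm_eq_abs, e]
  exact (abs_add_le _ _).trans (add_le_add this le_rfl)

theorem IsGlobalSuper.isSemiconcave_infConv {G : ℝ → ℝ → ℝ → EReal} {A C Q δ : ℝ}
    {w : ℝ × ℝ → ℝ} (hw : IsGlobalSuper G A C w) (hδ : 0 < δ) (hQ : ∀ y q, ¬ 0 ≤ G y q Q) :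
    IsSemiconcave (infConv δ w) (1 / δ) Q where
  time := hw.infConv_concaveOn_time hδ
  space := hw.infConv_concaveOn_space hδ hQ
  bound R := by
    refine ⟨A * (1 + R) + C * R + C ^ 2 * δ / 2 + R ^ 2 / (2 * δ), fun t x ht hx => ?_⟩
    have hA := hw.A_nonneg
    have hC := hw.C_nonneg
    have hR : 0 ≤ R := (abs_nonneg t).trans ht
    have h1 := hw.le_infConv hδ t x
    have h2 := hw.infConv_le_growth hδ t x
    have h3 : A * (1 + |x|) ≤ A * (1 + R) := mul_le_mul_of_nonneg_left (by linarith) hA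
    have h4 : C * t ≤ C * R := mul_le_mul_of_nonneg_left ((le_abs_self t).trans ht) hC
    have h5 : t ^ 2 / (2 * δ) ≤ R ^ 2 / (2 * δ) := by
      have : t ^ 2 ≤ R ^ 2 := by rw [← sq_abs]; exact pow_le_pow_left₀ (abs_nonneg t) ht 2
      gcongr
    have h6 : 0 ≤ R ^ 2 / (2 * δ) := by positivity
    have h7 : 0 ≤ C ^ 2 * δ / 2 := by positivity
    have h8 : 0 ≤ C * R := by positivity
    exact abs_le.2 ⟨by linarith, by linarith⟩

/-- A continuous function, semiconcave in time, is bounded below by its first-order expansion in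
time, locally uniformly in space. -/
theorem IsSemiconcave.time_lowerBound {W : ℝ × ℝ → ℝ} {a Q : ℝ} (h : IsSemiconcave W a Q)
    {t x p : ℝ} (hd : HasDerivAt (fun t => W (t, x)) p t) {ω : ℝ} (hω : 0 < ω) :
    ∃ σ > 0, ∃ ρ > 0, ∀ s y, |s| ≤ σ → |y| ≤ ρ →
      W (t, x + y) + p * s - ω * |s| ≤ W (t + s, x + y) := by
  have h1 := (hasDerivAt_iff_isLittleO_nhds_zero.1 hd).def (by linarith : 0 < ω / 4)
  obtain ⟨r, hr, h1⟩ := Metric.eventually_nhds_iff.1 h1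
  -- Small enough for the derivative to be accurate at `t ± σ`, and for the curvature error `|a| *
  -- σ` to be below `ω`.
  set σ := min (r / 2) (ω / (|a| + 1)) with hσ
  have hσ0 : 0 < σ := by positivity
  have hσr : σ < r := (min_le_left _ _).trans_lt (by linarith)
  have hσa : |a| * σ ≤ ω := by
    have h2 : σ ≤ ω / (|a| + 1) := min_le_right _ _
    rw [le_div_iff₀ (by positivity)] at h2
    nlinarith
  have hside : ∀ e : ℝ, |e| = 1 → ∀ᶠ y in 𝓝 (0 : ℝ),
      p * (e * σ) - ω / 2 * σ < W (t + e * σ, x + y) - W (t, x + y) := by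
    intro e he
    have hc := h.continuous
    refine ContinuousAt.eventually_lt continuousAt_const (by fun_prop) ?_
    have h2 : |e * σ| = σ := by rw [abs_mul, he, one_mul, abs_of_pos hσ0]
    have := h1 (y := e * σ) (by rw [dist_zero_right, Real.norm_eq_abs, h2]; exact hσr)
    rw [Real.norm_eq_abs, Real.norm_eq_abs, h2, smul_eq_mul] at this
    have := (abs_le.1 this).1
    have h0 : 0 < ω * σ := by positivity
    rw [add_zero]
    linarith
  obtain ⟨ρ, hρ, hball⟩ := Metric.eventually_nhds_iff.1
    ((hside 1 (by simp)).and (hside (-1) (by simp)))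
  refine ⟨σ, hσ0, ρ / 2, by linarith, fun s y hs hy => ?_⟩
  have hb := hball (y := y) (by rw [dist_zero_right, Real.norm_eq_abs]; linarith)
  -- The bound is known at times `t ± σ`, uniformly near `x` by continuity. Semiconcavity in time
  -- interpolates it down to `t`; the sign `e` covers both sides.
  have key : ∀ e : ℝ, e ^ 2 = 1 → ∀ s : ℝ, 0 ≤ s → s ≤ σ →
      p * (e * σ) - ω / 2 * σ < W (t + e * σ, x + y) - W (t, x + y) →
      W (t, x + y) + p * (e * s) - ω * s ≤ W (t + e * s, x + y) := by
    intro e he s hs0 hsσ hlt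
    set μ := s / σ with hμ
    have hμ0 : 0 ≤ μ := by positivity
    have hμ1 : μ ≤ 1 := (div_le_one hσ0).2 hsσ
    have hsμ : s = μ * σ := by rw [hμ]; field_simp
    have hc := (h.time (x + y)).2 (mem_univ (t + e * σ)) (mem_univ t) hμ0
      (by linarith : 0 ≤ 1 - μ) (by ring)
    simp only [smul_eq_mul] at hc
    have e1 : μ * (t + e * σ) + (1 - μ) * t = t + e * s := by rw [hsμ]; ring
    rw [e1] at hc
    have e2 : a / 2 * (t + e * s) ^ 2 = μ * (a / 2 * (t + e * σ) ^ 2) + (1 - μ) * (a / 2 * t ^ 2)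
        - a / 2 * e ^ 2 * (s * σ - s ^ 2) := by
      rw [hsμ]; ring
    rw [he] at e2
    have e3 : a / 2 * 1 * (s * σ - s ^ 2) ≤ ω / 2 * s := by
      have h5 : a * (σ - s) ≤ |a| * σ := by
        have h6 : a * (σ - s) ≤ |a| * (σ - s) :=
          mul_le_mul_of_nonneg_right (le_abs_self a) (by linarith)
        have h7 : |a| * (σ - s) ≤ |a| * σ := mul_le_mul_of_nonneg_left (by linarith) (abs_nonneg a)
        linarith
      have h8 := mul_le_mul_of_nonneg_right (h5.trans hσa) hs0
      linarith
    have e4 := mul_le_mul_of_nonneg_left hlt.le hμ0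
    have e5 : μ * (p * (e * σ) - ω / 2 * σ) = p * (e * s) - ω / 2 * s := by rw [hsμ]; ring
    rw [e5] at e4
    linarith
  rcases le_total 0 s with h0 | h0
  · have := key 1 (by norm_num) s h0 (by rwa [abs_of_nonneg h0] at hs) hb.1
    rw [one_mul] at this
    rwa [abs_of_nonneg h0]
  · have := key (-1) (by norm_num) (-s) (by linarith) (by rwa [abs_of_nonpos h0] at hs) hb.2
    rw [abs_of_nonpos h0]
    simpa using this

/-- A semiconcave viscosity supersolution satisfies the inequality at points of twice
differentiability. -/
theorem IsSemiconcave.nonneg_of_expansion {W : ℝ × ℝ → ℝ} {a Q : ℝ} (h : IsSemiconcave W a Q)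
    {G : ℝ → ℝ → ℝ → EReal}
    (hG : ∀ x q M, G x q M < 0 → ∀ᶠ z : ℝ × ℝ × ℝ in 𝓝 (x, q, M), G z.1 z.2.1 z.2.2 < 0)
    (hW : ∀ φ : ℝ × ℝ → ℝ, ContDiff ℝ 2 φ → ∀ p : ℝ × ℝ,
      IsLocalMin (fun z => W z - φ z) p → 0 ≤ G p.2 (timeDeriv φ p) (spaceDeriv2 φ p))
    {t x p q M : ℝ} (hd : HasDerivAt (fun t => W (t, x)) p t)
    (he : HasSecondOrderExpansion (fun x => W (t, x)) x q M) : 0 ≤ G x p M := by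
  by_contra! hlt
  obtain ⟨r, hr, hball⟩ : ∃ r > 0, ∀ x' q' M', |x' - x| < r → |q' - p| < r → |M' - M| < r →
      G x' q' M' < 0 := by
    obtain ⟨r, hr, hb⟩ := Metric.eventually_nhds_iff.1 (hG x p M hlt)
    refine ⟨r, hr, fun x' q' M' h1 h2 h3 => hb (y := (x', q', M')) ?_⟩
    simp only [Prod.dist_eq, Real.dist_eq]
    exact max_lt h1 (max_lt h2 h3)
  set ω := r / 8 with hω
  have hω0 : 0 < ω := by positivity
  obtain ⟨σ, hσ, ρ₁, hρ₁, hlow⟩ := h.time_lowerBound hd hω0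
  obtain ⟨ρ₂, hρ₂, hexp⟩ := he ω hω0
  set ρ := min (min ρ₁ ρ₂) (r / 2) with hρ
  have hρ0 : 0 < ρ := by positivity
  have hρr : ρ < r := (min_le_right _ _).trans_lt (by linarith)
  -- The first term beats the error `ω * |s|` at the time ends. The second makes the dip of `-ω * s
  -- + K * s ^ 2`, of depth `ω ^ 2 / (4 * K)`, shallower than the gain `ω * ρ ^ 2` at the lateral
  -- ends.
  set K := 2 * ω / σ + ω / ρ ^ 2 with hK
  have hK0 : 0 < K := by positivity
  have hKσ : 2 * ω ≤ K * σ := by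
    have : (2 * ω / σ) * σ = 2 * ω := by field_simp
    have h2 : 0 ≤ ω / ρ ^ 2 * σ := by positivity
    rw [hK, add_mul]; linarith
  have hKρ : ω ≤ K * ρ ^ 2 := by
    have : (ω / ρ ^ 2) * ρ ^ 2 = ω := by field_simp
    have h2 : 0 ≤ 2 * ω / σ * ρ ^ 2 := by positivity
    rw [hK, add_mul]; linarith
  set φ : ℝ × ℝ → ℝ := fun z => (p * (z.1 - t) + -K * (z.1 - t) ^ 2) +
    (q * (z.2 - x) + (M / 2 - 2 * ω) * (z.2 - x) ^ 2) with hφ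
  have hφC : ContDiff ℝ 2 φ := by fun_prop
  have hlb : ∀ z : ℝ × ℝ, |z.1 - t| ≤ σ → |z.2 - x| ≤ ρ →
      W (t, x) - ω * |z.1 - t| + K * |z.1 - t| ^ 2 + ω * |z.2 - x| ^ 2 ≤ W z - φ z := by
    intro z h1 h2
    have e1 := hlow (z.1 - t) (z.2 - x) h1 (h2.trans ((min_le_left _ _).trans (min_le_left _ _)))
    have e2 := (abs_le.1 (hexp (z.2 - x)
      (h2.trans ((min_le_left _ _).trans (min_le_right _ _))))).1
    rw [add_sub_cancel, add_sub_cancel] at e1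
    rw [add_sub_cancel] at e2
    rw [sq_abs, sq_abs]
    simp only [hφ]
    rw [Prod.mk.eta] at e1
    linarith
  have hc := h.continuous
  obtain ⟨z, hzK, hzU, hmin, hle⟩ := exists_isLocalMinOn (S := univ)
    (K := Icc (t - σ) (t + σ) ×ˢ Icc (x - ρ) (x + ρ))
    (U := Ioo (t - σ) (t + σ) ×ˢ Ioo (x - ρ) (x + ρ)) (J := fun z => W z - φ z)
    (isCompact_box _ _ _ _)
    (ContinuousOn.lowerSemicontinuousOn (by fun_prop))
    (isOpen_Ioo.prod isOpen_Ioo)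
    (fun z hz => ⟨Ioo_subset_Icc_self hz.1.1, Ioo_subset_Icc_self hz.1.2⟩)
    (z₀ := (t, x)) ⟨⟨by linarith, by linarith⟩, ⟨by linarith, by linarith⟩⟩ (by
      intro z hz hzU
      have h1 : |z.1 - t| ≤ σ := abs_le.2 ⟨by linarith [hz.1.1], by linarith [hz.1.2]⟩
      have h2 : |z.2 - x| ≤ ρ := abs_le.2 ⟨by linarith [hz.2.1], by linarith [hz.2.2]⟩
      refine lt_of_lt_of_le ?_ (hlb z h1 h2)
      have e0 : W (t, x) - φ (t, x) = W (t, x) := by simp [hφ]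
      rw [e0]
      set s := |z.1 - t|
      set y := |z.2 - x|
      have hs0 : 0 ≤ s := abs_nonneg _
      by_cases hs : s < σ
      · have hy : y = ρ := by
          refine le_antisymm h2 ?_
          by_contra! hy
          have h3 := abs_lt.1 hs
          have h4 := abs_lt.1 hy
          exact hzU ⟨⟨by linarith, by linarith⟩, ⟨by linarith, by linarith⟩⟩
        rw [hy]
        have h5 : 0 < K * (-ω * s + K * s ^ 2 + ω * ρ ^ 2) := by
          have : ω * ω ≤ ω * (K * ρ ^ 2) := mul_le_mul_of_nonneg_left hKρ hω0.le
          nlinarith [sq_nonneg (K * s - ω / 2), mul_pos hω0 hω0]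
        have := (mul_pos_iff_of_pos_left hK0).1 h5
        linarith
      · have hs' : s = σ := le_antisymm h1 (not_lt.1 hs)
        rw [hs']
        have : 2 * ω * σ ≤ K * σ * σ := mul_le_mul_of_nonneg_right hKσ hσ.le
        have h3 : 0 < ω * σ := by positivity
        have h4 : 0 ≤ ω * y ^ 2 := by positivity
        nlinarith)
  have hsσ : |z.1 - t| ≤ σ := abs_le.2 ⟨by linarith [hzK.1.1], by linarith [hzK.1.2]⟩
  have hyρ : |z.2 - x| ≤ ρ := abs_le.2 ⟨by linarith [hzK.2.1], by linarith [hzK.2.2]⟩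
  have hb := hlb z hsσ hyρ
  have e0 : W (t, x) - φ (t, x) = W (t, x) := by simp [hφ]
  rw [e0] at hle
  -- However large `K` is, minimality keeps `K * |z.1 - t|` below `ω`, so the time slope of `φ`
  -- moves by at most `2 * ω`.
  have hKs : K * |z.1 - t| ≤ ω := by
    by_contra! hcon
    have h1 : 0 ≤ |z.1 - t| := abs_nonneg _
    have h2 : 0 < |z.1 - t| := by
      rcases h1.eq_or_lt with h3 | h3
      · rw [← h3, mul_zero] at hcon; linarith
      · exact h3
    have h3 := mul_lt_mul_of_pos_right hcon h2
    have h4 : 0 ≤ ω * |z.2 - x| ^ 2 := by positivity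
    nlinarith
  have hmin' : IsLocalMin (fun z => W z - φ z) z := by
    rwa [IsLocalMinOn, nhdsWithin_univ] at hmin
  have hfin := hW φ hφC z hmin'
  have e1 : timeDeriv φ z = p + 2 * -K * (z.1 - t) :=
    timeDeriv_sep (hasDerivAt_quadratic p (-K) t z.1)
      (fun y => q * (y - x) + (M / 2 - 2 * ω) * (y - x) ^ 2)
  have e2 : spaceDeriv2 φ z = 2 * (M / 2 - 2 * ω) := by
    rw [← iteratedDeriv_two_quadratic q (M / 2 - 2 * ω) x z.2]
    exact spaceDeriv2_sep (fun s => p * (s - t) + -K * (s - t) ^ 2)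
      (fun y => q * (y - x) + (M / 2 - 2 * ω) * (y - x) ^ 2) z
  rw [e1, e2] at hfin
  refine hfin.not_gt (hball _ _ _ (hyρ.trans_lt hρr) ?_ ?_)
  · have : p + 2 * -K * (z.1 - t) - p = -(2 * (K * (z.1 - t))) := by ring
    rw [this, abs_neg, abs_mul, abs_mul, abs_two, abs_of_pos hK0]
    linarith
  · have : 2 * (M / 2 - 2 * ω) - M = -(4 * ω) := by ring
    rw [this, abs_neg, abs_of_pos (by positivity)]
    linarith

end GammaPricing

namespace GammaPricing

open MeasureTheory

/-! ### Almost everywhere expansions of semiconcave functions -/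

theorem HasSecondOrderExpansion.add_quadratic {g : ℝ → ℝ} {x q M : ℝ} (a : ℝ)
    (h : HasSecondOrderExpansion (fun x => g x - a / 2 * x ^ 2) x q M) :
    HasSecondOrderExpansion g x (q + a * x) (M + a) := by
  intro ω hω
  obtain ⟨r, hr, h1⟩ := h ω hω
  refine ⟨r, hr, fun y hy => ?_⟩
  convert h1 y hy using 2
  ring

/-- Sum of a time difference quotient and a second space difference quotient. -/
noncomputable def diffQuot (α β : ℝ) (W : ℝ × ℝ → ℝ) (k : ℝ) (z : ℝ × ℝ) : ℝ :=
  α * ((W (z.1 + k, z.2) - W z) / k) +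
    β * ((W (z.1, z.2 + k) + W (z.1, z.2 - k) - 2 * W z) / k ^ 2)

/-- The step sizes `1 / (n + 1)`. -/
noncomputable def step (n : ℕ) : ℝ := 1 / ((n : ℝ) + 1)

theorem step_pos (n : ℕ) : 0 < step n := by unfold step; positivity

theorem step_le_one (n : ℕ) : step n ≤ 1 := by
  unfold step
  rw [div_le_one (by positivity)]
  have : (0 : ℝ) ≤ n := Nat.cast_nonneg n
  linarith

theorem tendsto_step : Tendsto step atTop (𝓝[≠] 0) :=
  tendsto_nhdsWithin_iff.2 ⟨tendsto_one_div_add_atTop_nhds_zero_nat,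
    Eventually.of_forall fun n => (step_pos n).ne'⟩

theorem tendsto_diffQuot {W : ℝ × ℝ → ℝ} {t x p q M : ℝ} (α β : ℝ)
    (hd : HasDerivAt (fun t => W (t, x)) p t)
    (he : HasSecondOrderExpansion (fun x => W (t, x)) x q M) :
    Tendsto (fun n => diffQuot α β W (step n) (t, x)) atTop (𝓝 (α * p + β * M)) := by
  have h1 := (hasDerivAt_iff_tendsto_slope_zero.1 hd).comp tendsto_step
  have h2 := he.tendsto_secondDiff.comp tendsto_step
  refine ((h1.const_mul α).add (h2.const_mul β)).congr fun n => ?_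
  simp only [diffQuot, Function.comp, smul_eq_mul]
  ring

/-- Each time line and each space line has its own null set. Fubini, with measurability of the set
of differentiability points, puts both properties on almost every time slice. -/
theorem IsSemiconcave.ae_expansion {W : ℝ × ℝ → ℝ} {a Q : ℝ} (h : IsSemiconcave W a Q) :
    ∀ᵐ t : ℝ, ∀ᵐ x : ℝ, (∃ p, HasDerivAt (fun t => W (t, x)) p t) ∧
      ∃ q M, HasSecondOrderExpansion (fun x => W (t, x)) x q M := by
  have hc := h.continuous
  have hm : MeasurableSet {p : ℝ × ℝ | DifferentiableAt ℝ (fun t => W (t, p.1)) p.2} :=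
    measurableSet_of_differentiableAt_with_param ℝ (f := fun x t => W (t, x))
      (by simp only [Function.uncurry_def]; fun_prop)
  have h1 : ∀ᵐ x : ℝ, ∀ᵐ t : ℝ, DifferentiableAt ℝ (fun t => W (t, x)) t := by
    refine Eventually.of_forall fun x => ?_
    filter_upwards [ConcaveOn.ae_hasSecondOrderExpansion (h.time x)] with t ht
    obtain ⟨q, M, ht⟩ := ht
    exact (HasSecondOrderExpansion.add_quadratic (g := fun t => W (t, x)) a
      ht).hasDerivAt.differentiableAt
  have h2 := (Measure.ae_ae_comm (μ := (volume : Measure ℝ)) (ν := (volume : Measure ℝ))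
    (p := fun x t => DifferentiableAt ℝ (fun t => W (t, x)) t) hm).1 h1
  filter_upwards [h2] with t ht
  filter_upwards [ht, ConcaveOn.ae_hasSecondOrderExpansion (h.space t)] with x hx1 hx2
  obtain ⟨q, M, hx2⟩ := hx2
  exact ⟨⟨_, hx1.hasDerivAt⟩, _, _,
    HasSecondOrderExpansion.add_quadratic (g := fun x => W (t, x)) Q hx2⟩

theorem continuous_diffQuot (α β : ℝ) {W : ℝ × ℝ → ℝ} (hW : Continuous W) (k : ℝ) :
    Continuous (diffQuot α β W k) := by
  unfold diffQuot
  fun_prop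

/-- Semiconcavity bounds the difference quotients from above only. Taking the maximum with `κ`
supplies the lower bound needed for dominated convergence and loses nothing, as an upper bound by
`κ` is wanted. -/
theorem IsSemiconcave.ae_tendsto_max {W : ℝ × ℝ → ℝ} {a Q : ℝ} (h : IsSemiconcave W a Q)
    {α β κ : ℝ} {U : Set (ℝ × ℝ)} (hU : MeasurableSet U)
    (hκ : ∀ t x p q M, (t, x) ∈ U → HasDerivAt (fun t => W (t, x)) p t →
      HasSecondOrderExpansion (fun x => W (t, x)) x q M → α * p + β * M ≤ κ) :
    ∀ᵐ z : ℝ × ℝ, z ∈ U →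
      Tendsto (fun n => max (diffQuot α β W (step n) z) κ) atTop (𝓝 κ) := by
  have hc := h.continuous
  have hm : MeasurableSet {z : ℝ × ℝ | z ∈ U →
      Tendsto (fun n => max (diffQuot α β W (step n) z) κ) atTop (𝓝 κ)} := by
    have h1 := measurableSet_tendsto (l := atTop) (𝓝 κ)
      (f := fun n z => max (diffQuot α β W (step n) z) κ)
      (fun n => ((continuous_diffQuot α β hc (step n)).max continuous_const).measurable)
    have h2 : {z : ℝ × ℝ | z ∈ U →
      Tendsto (fun n => max (diffQuot α β W (step n) z) κ) atTop (𝓝 κ)} =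
      Uᶜ ∪ {z | Tendsto (fun n => max (diffQuot α β W (step n) z) κ) atTop (𝓝 κ)} := by
      ext z
      simp only [mem_ofPred_eq, mem_union, mem_compl_iff]
      tauto
    rw [h2]
    exact hU.compl.union h1
  rw [Measure.volume_eq_prod, Measure.ae_prod_iff_ae_ae hm]
  filter_upwards [h.ae_expansion] with t ht
  filter_upwards [ht] with x hx hxU
  obtain ⟨⟨p, hp⟩, q, M, hq⟩ := hx
  have h1 := (tendsto_diffQuot α β hp hq).max (tendsto_const_nhds (x := κ))
  rwa [max_eq_right (hκ t x p q M hxU hp hq)] at h1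

theorem IsSemiconcave.diffQuot_le {W : ℝ × ℝ → ℝ} {a Q : ℝ} (h : IsSemiconcave W a Q)
    {α β : ℝ} (hα : 0 ≤ α) (hβ : 0 ≤ β) (R : ℝ) :
    ∃ B, ∀ n z, |z.1| ≤ R → |z.2| ≤ R → diffQuot α β W (step n) z ≤ B := by
  obtain ⟨K, hK0, hK⟩ := h.lipschitz_time (R + 1)
  refine ⟨α * K + β * Q, fun n z hz1 hz2 => ?_⟩
  have hk := step_pos n
  have hk1 := step_le_one n
  set k := step n
  refine add_le_add (mul_le_mul_of_nonneg_left ?_ hα) (mul_le_mul_of_nonneg_left ?_ hβ)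
  · rw [div_le_iff₀ hk]
    have := hK (z.1 + k) z.1 z.2
      ((abs_add_le _ _).trans (add_le_add hz1 (by rwa [abs_of_pos hk]))) (by linarith) (by linarith)
    rw [add_sub_cancel_left, abs_of_pos hk] at this
    exact (le_abs_self _).trans this
  · rw [div_le_iff₀ (by positivity)]
    have := ConcaveOn.secondDiff_le (h.space z.1) z.2 k
    rw [Prod.mk.eta] at this
    linarith

/-! ### Mollification -/

section
variable {E : Type*} [NormedAddCommGroup E] [NormedSpace ℝ E] [MeasureSpace E]
  [BorelSpace E] [FiniteDimensional ℝ E] [(volume : Measure E).IsAddHaarMeasure]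

open scoped Convolution

/-- Convolution with a normalised bump function. -/
noncomputable def mollify (ρ : ContDiffBump (0 : E)) (W : E → ℝ) : E → ℝ :=
  ρ.normed volume ⋆[ContinuousLinearMap.lsmul ℝ ℝ, volume] W

set_option linter.unusedSectionVars false in
theorem mollify_apply (ρ : ContDiffBump (0 : E)) (W : E → ℝ) (z : E) :
    mollify ρ W z = ∫ ζ, ρ.normed volume ζ * W (z - ζ) := rfl

theorem contDiff_mollify (ρ : ContDiffBump (0 : E)) {W : E → ℝ} (hW : Continuous W) {n : ℕ∞} :
    ContDiff ℝ n (mollify ρ W) :=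
  ρ.hasCompactSupport_normed.contDiff_convolution_left _ ρ.contDiff_normed
    hW.locallyIntegrable

theorem abs_mollify_sub_le (ρ : ContDiffBump (0 : E)) {W : E → ℝ} (hW : Continuous W) {z : E}
    {ε : ℝ} (h : ∀ w, dist w z < ρ.rOut → |W w - W z| ≤ ε) : |mollify ρ W z - W z| ≤ ε := by
  have := ρ.dist_normed_convolution_le (μ := volume) (x₀ := z) (g := W)
    hW.aestronglyMeasurable (fun x hx => by rw [Real.dist_eq]; exact h x hx)
  rwa [Real.dist_eq] at this

theorem integrable_normed_mul (ρ : ContDiffBump (0 : E)) {g : E → ℝ} (hg : Continuous g) :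
    Integrable fun ζ => ρ.normed volume ζ * g ζ :=
  (ρ.continuous_normed.mul hg).integrable_of_hasCompactSupport
    (ρ.hasCompactSupport_normed.mul_right)

end

/-- Finite differences commute with convolution, so no derivative of `W` has to be moved under the
integral sign. -/
theorem diffQuot_mollify (ρ : ContDiffBump (0 : ℝ × ℝ)) {W : ℝ × ℝ → ℝ} (hW : Continuous W)
    (α β k : ℝ) (z : ℝ × ℝ) : diffQuot α β (mollify ρ W) k z =
      ∫ ζ, ρ.normed volume ζ * diffQuot α β W k (z - ζ) := by
  have i : ∀ w : ℝ × ℝ, Integrable fun ζ => ρ.normed volume ζ * W (w - ζ) := fun w =>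
    integrable_normed_mul ρ (by fun_prop)
  have hT : Integrable fun ζ => α * ((ρ.normed volume ζ * W ((z.1 + k, z.2) - ζ) -
      ρ.normed volume ζ * W (z - ζ)) / k) := (((i _).sub (i _)).div_const k).const_mul α
  have hA : Integrable fun ζ => ρ.normed volume ζ * W ((z.1, z.2 + k) - ζ) +
      ρ.normed volume ζ * W ((z.1, z.2 - k) - ζ) := (i _).add (i _)
  have hS : Integrable fun ζ => β * ((ρ.normed volume ζ * W ((z.1, z.2 + k) - ζ) +
      ρ.normed volume ζ * W ((z.1, z.2 - k) - ζ) - 2 * (ρ.normed volume ζ * W (z - ζ))) / k ^ 2) :=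
    ((hA.sub ((i _).const_mul 2)).div_const _).const_mul β
  unfold diffQuot
  simp only [mollify_apply]
  rw [← integral_sub (i _) (i _), ← integral_add (i _) (i _), ← integral_const_mul 2,
    ← integral_sub hA ((i _).const_mul 2), ← integral_div, ← integral_div,
    ← integral_const_mul, ← integral_const_mul, ← integral_add hT hS]
  congr 1
  funext ζ
  have e1 : (z.1 + k, z.2) - ζ = ((z - ζ).1 + k, (z - ζ).2) := by
    ext <;> simp; ring
  have e2 : (z.1, z.2 + k) - ζ = ((z - ζ).1, (z - ζ).2 + k) := by
    ext <;> simp; ring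
  have e3 : (z.1, z.2 - k) - ζ = ((z - ζ).1, (z - ζ).2 - k) := by
    ext <;> simp; ring
  rw [e1, e2, e3]
  ring

/-- A linear differential inequality that holds almost everywhere passes to mollifications. -/
theorem IsSemiconcave.mollify_le {W : ℝ × ℝ → ℝ} {a Q : ℝ} (h : IsSemiconcave W a Q)
    (ρ : ContDiffBump (0 : ℝ × ℝ)) {α β κ : ℝ} (hα : 0 ≤ α) (hβ : 0 ≤ β) (z : ℝ × ℝ)
    (hκ : ∀ t x p q M, dist (t, x) z < ρ.rOut → HasDerivAt (fun t => W (t, x)) p t →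
      HasSecondOrderExpansion (fun x => W (t, x)) x q M → α * p + β * M ≤ κ) :
    α * timeDeriv (mollify ρ W) z + β * spaceDeriv2 (mollify ρ W) z ≤ κ := by
  have hc := h.continuous
  have hV : ContDiff ℝ 2 (mollify ρ W) := contDiff_mollify ρ hc (n := 2)
  have hlim := tendsto_diffQuot α β (hasDerivAt_slice_fst hV z)
    (hasSecondOrderExpansion_of_contDiff (contDiff_slice_snd hV z.1) z.2)
  rw [Prod.mk.eta] at hlim
  obtain ⟨B, hB⟩ := h.diffQuot_le hα hβ (‖z‖ + ρ.rOut)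
  have hae := h.ae_tendsto_max (U := Metric.ball z ρ.rOut) Metric.isOpen_ball.measurableSet hκ
  have hae2 : ∀ᵐ ζ : ℝ × ℝ, (z - ζ) ∈ Metric.ball z ρ.rOut →
      Tendsto (fun n => max (diffQuot α β W (step n) (z - ζ)) κ) atTop (𝓝 κ) :=
    (Measure.measurePreserving_sub_left (volume : Measure (ℝ × ℝ)) z).quasiMeasurePreserving.ae hae
  have hsupp : ∀ ζ, ρ.normed volume ζ ≠ 0 → z - ζ ∈ Metric.ball z ρ.rOut := by
    intro ζ hζ
    have : ζ ∈ Metric.ball (0 : ℝ × ℝ) ρ.rOut := by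
      rw [← ρ.support_normed_eq (μ := volume)]; exact hζ
    rw [mem_ball_zero_iff] at this
    rwa [mem_ball_iff_norm, sub_sub_cancel_left, norm_neg]
  have hdom : Tendsto (fun n => ∫ ζ, ρ.normed volume ζ * max (diffQuot α β W (step n) (z - ζ)) κ)
      atTop (𝓝 (∫ ζ, ρ.normed volume ζ * κ)) := by
    refine tendsto_integral_of_dominated_convergence
      (fun ζ => ρ.normed volume ζ * (|B| + |κ|)) (fun n => ?_) ?_ (fun n => ?_) ?_
    · refine (Continuous.mul ρ.continuous_normed ?_).aestronglyMeasurable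
      exact ((continuous_diffQuot α β hc (step n)).comp (by fun_prop)).max continuous_const
    · exact ρ.integrable_normed.mul_const _
    · refine Eventually.of_forall fun ζ => ?_
      rw [norm_mul, Real.norm_eq_abs, Real.norm_eq_abs, abs_of_nonneg (ρ.nonneg_normed ζ)]
      by_cases h0 : ρ.normed volume ζ = 0
      · simp [h0]
      refine mul_le_mul_of_nonneg_left ?_ (ρ.nonneg_normed ζ)
      have h1 := hsupp ζ h0
      rw [mem_ball_iff_norm] at h1
      have h2 : ‖z - ζ‖ ≤ ‖z‖ + ρ.rOut := by
        have := norm_add_le (z - ζ - z) z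
        rw [sub_add_cancel] at this
        linarith
      have h3 := hB n (z - ζ) ((norm_fst_le _).trans h2) ((norm_snd_le _).trans h2)
      have h4 := le_abs_self B
      have h5 := le_abs_self κ
      have h6 := neg_abs_le κ
      have h7 := abs_nonneg B
      have h8 := abs_nonneg κ
      rw [abs_le]
      refine ⟨(by linarith : -(|B| + |κ|) ≤ κ).trans (le_max_right _ _), max_le ?_ ?_⟩ <;> linarith
    · filter_upwards [hae2] with ζ hζ
      by_cases h0 : ρ.normed volume ζ = 0
      · simp [h0]
      · exact (hζ (hsupp ζ h0)).const_mul _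
  rw [integral_mul_const, ρ.integral_normed, one_mul] at hdom
  refine le_of_tendsto_of_tendsto' hlim hdom fun n => ?_
  rw [diffQuot_mollify ρ hc]
  have hcq : Continuous fun ζ => diffQuot α β W (step n) (z - ζ) :=
    (continuous_diffQuot α β hc (step n)).comp (by fun_prop)
  exact integral_mono (integrable_normed_mul ρ hcq)
    (integrable_normed_mul ρ (hcq.max continuous_const))
    fun ζ => mul_le_mul_of_nonneg_left (le_max_left _ _) (ρ.nonneg_normed ζ)

/-- Mollification of a semiconcave supersolution: if the inequalities hold with the coefficients
frozen at `y`, up to `ω`, then they hold for the mollified function. -/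
theorem CoeffBounds.mollify_super {f σ γ : ℝ → ℝ} {c B ι : ℝ} (hb : CoeffBounds f σ γ c B ι)
    {W : ℝ × ℝ → ℝ} {a Q : ℝ} (h : IsSemiconcave W a Q) (ρ : ContDiffBump (0 : ℝ × ℝ))
    (z : ℝ × ℝ) {y ω : ℝ} (hω : ω ≤ ι / 2)
    (hW : ∀ t x p q M, dist (t, x) z < ρ.rOut → HasDerivAt (fun t => W (t, x)) p t →
      HasSecondOrderExpansion (fun x => W (t, x)) x q M →
        M ≤ γ y + ω ∧ p + drift f σ y M ≤ ω) :
    spaceDeriv2 (mollify ρ W) z ≤ γ y + ω ∧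
      timeDeriv (mollify ρ W) z + drift f σ y (spaceDeriv2 (mollify ρ W) z) ≤ ω := by
  have h1 : spaceDeriv2 (mollify ρ W) z ≤ γ y + ω := by
    have := h.mollify_le ρ (α := 0) (β := 1) (κ := γ y + ω) le_rfl zero_le_one z
      (fun t x p q M hd hp hq => by
        have := (hW t x p q M hd hp hq).1
        linarith)
    linarith
  refine ⟨h1, ?_⟩
  set N := spaceDeriv2 (mollify ρ W) z
  -- Slope of the tangent to `drift` at `N`, the second derivative of the mollified function. The
  -- tangent lies below `drift`, so the inequality may be weakened to a linear one; after
  -- mollification it is read off at `N`, where tangent and `drift` agree.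
  set b := σ y ^ 2 / 2 / (1 - f y * N) ^ 2 with hb'
  have hb0 : 0 ≤ b := by positivity
  have := h.mollify_le ρ (α := 1) (β := b) (κ := ω - drift f σ y N + b * N) zero_le_one hb0 z
    (fun t x p q M hd hp hq => by
      obtain ⟨e1, e2⟩ := hW t x p q M hd hp hq
      have := hb.drift_tangent (x := y) (M := M) (N := N) (by linarith) (by linarith)
      rw [← hb'] at this
      linarith)
  linarith

end GammaPricing

namespace GammaPricing

/-! ### Comparison with mollified supersolutions -/

/-- For small `δ` a contact time is either close to `T`, where lower semicontinuity and compactness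
bound `w` from below, or so far that its penalty exceeds everything else. -/
theorem IsGlobalSuper.exists_le_infConv {G : ℝ → ℝ → ℝ → EReal} {A C T : ℝ}
    {w : ℝ × ℝ → ℝ} (hw : IsGlobalSuper G A C w) (hT : 0 ≤ T) {h : ℝ → ℝ} (hh : Continuous h)
    (hle : ∀ x, h x ≤ w (T, x)) (R : ℝ) {θ : ℝ} (hθ : 0 < θ) :
    ∃ δ, 0 < δ ∧ δ ≤ 1 ∧ ∀ x, |x| ≤ R → h x - θ ≤ infConv δ w (T, x) := by
  have hA := hw.A_nonneg
  have hC := hw.C_nonneg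
  have h1 : ∀ᶠ s in 𝓝 T, ∀ x ∈ Icc (-R) R, 0 ≤ s → h x - θ < w (s, x) := by
    refine isCompact_Icc.eventually_forall_of_forall_eventually fun x _ => ?_
    have hls := lowerSemicontinuousOn_sub (φ := fun z : ℝ × ℝ => h z.2) hw.lsc (by fun_prop)
    have := hls (T, x) ⟨hT, mem_univ _⟩ (-θ) (by have := hle x; simp only; linarith)
    rw [eventually_nhdsWithin_iff] at this
    filter_upwards [this] with z hz hz0
    have := hz ⟨hz0, mem_univ _⟩
    rw [Prod.mk.eta]
    linarith
  obtain ⟨r, hr, h2⟩ := Metric.eventually_nhds_iff.1 h1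
  obtain ⟨N, hN⟩ := (isCompact_Icc (a := -R) (b := R)).exists_bound_of_continuousOn hh.continuousOn
  set M := |N| + A * (1 + |R|) + C * T with hM
  have hM0 : 0 ≤ M := by positivity
  -- At distance `d ≥ r` from `T` the penalty `d ^ 2 / (2 * δ)` must dominate `M + C * d`; each of
  -- the two bounds on `δ` takes care of one summand.
  set δ := min 1 (min (r / (4 * (C + 1))) (r ^ 2 / (4 * (M + 1)))) with hδ
  have hδ0 : 0 < δ := by positivity
  have hδ1 : C * (4 * δ) ≤ r := by
    have : δ ≤ r / (4 * (C + 1)) := (min_le_right _ _).trans (min_le_left _ _)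
    rw [le_div_iff₀ (by positivity)] at this
    nlinarith
  have hδ2 : M * (4 * δ) ≤ r ^ 2 := by
    have : δ ≤ r ^ 2 / (4 * (M + 1)) := (min_le_right _ _).trans (min_le_right _ _)
    rw [le_div_iff₀ (by positivity)] at this
    nlinarith
  refine ⟨δ, hδ0, min_le_left _ _, fun x hx => ?_⟩
  have hxI : x ∈ Icc (-R) R := abs_le.1 hx
  obtain ⟨s, hs, he⟩ := hw.exists_contact hδ0 T x
  rw [he]
  rcases lt_or_ge |s - T| r with hc | hc
  · have := h2 (y := s) hc x hxI hs
    have : 0 ≤ (T - s) ^ 2 / (2 * δ) := by positivity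
    linarith
  · have e1 := hw.lower (s, x) hs
    have e2 := hN x hxI
    rw [Real.norm_eq_abs] at e2
    have e3 := (le_abs_self (h x)).trans (e2.trans (le_abs_self N))
    have e4 : A * (1 + |x|) ≤ A * (1 + |R|) :=
      mul_le_mul_of_nonneg_left (by linarith [le_abs_self R]) hA
    have e5 : (T - s) ^ 2 = |s - T| ^ 2 := by rw [sq_abs]; ring
    have e6 : C * s ≤ C * T + C * |s - T| := by
      have := mul_le_mul_of_nonneg_left (le_abs_self (s - T)) hC
      linarith
    have e7 : M + C * |s - T| ≤ (T - s) ^ 2 / (2 * δ) := by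
      rw [e5, le_div_iff₀ (by positivity)]
      have : r ^ 2 ≤ |s - T| ^ 2 := pow_le_pow_left₀ hr.le hc 2
      have := mul_le_mul_of_nonneg_right (hδ1.trans hc) (abs_nonneg (s - T))
      nlinarith
    simp only at e1
    linarith

/-! ### Smooth strict supersolutions and comparison -/

section
variable {T : ℝ} {f σ γ h : ℝ → ℝ} {c B ι L : ℝ} {D : ℝ → Set ℝ} {v : ℝ × ℝ → ℝ}

theorem IsViscositySupersolution.isGlobalSuper_extend (hb : CoeffBounds f σ γ c B ι)
    (hD : IsLipschitzFamily D L) (hv : IsViscositySupersolution T (infOperator f σ γ D) h v)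
    (hT : 0 < T) {A : ℝ} (hA : ∀ p ∈ strip T, |v p| ≤ A * (1 + |p.2|)) :
    IsGlobalSuper (infOperator f σ γ D) A (driftBound c B ι)
      (extendSuper T (driftBound c B ι) v) := by
  have hg : HasLinearGrowth T v := ⟨A, hA⟩
  have hC := hb.driftBound_nonneg
  refine ⟨lowerSemicontinuousOn_extendSuper hg hT hv.lsc _,
    fun φ hφ p hp hmin => hv.extend hb hD hg hT hφ hp hmin, fun z hz => ?_, fun x => ?_, ?_, hC⟩
  · rcases lt_or_ge z.1 T with h1 | h1
    · rw [extendSuper_of_lt h1]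
      have := (abs_le.1 (hA z ⟨⟨hz, h1.le⟩, mem_univ _⟩)).1
      have : 0 ≤ driftBound c B ι * z.1 := mul_nonneg hC hz
      linarith
    · rw [extendSuper_of_ge h1]
      have := (abs_le.1 (abs_terminalLimit_le hT hA z.2)).1
      have : 0 ≤ driftBound c B ι * T := mul_nonneg hC hT.le
      linarith
  · rw [extendSuper_of_lt (by exact hT)]
    exact (abs_le.1 (hA (0, x) ⟨⟨le_rfl, hT.le⟩, mem_univ _⟩)).2
  · have := hA (0, 0) ⟨⟨le_rfl, hT.le⟩, mem_univ _⟩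
    simp only [abs_zero, add_zero, mul_one] at this
    exact (abs_nonneg _).trans this

theorem IsLipschitzFamily.exists_bound (hD : IsLipschitzFamily D L) (R : ℝ) :
    ∃ R', ∀ x, |x| ≤ R → ∀ x' ∈ D x, |x'| ≤ R' := by
  obtain ⟨N, hN⟩ := (hD.compact 0).isBounded.exists_norm_le
  refine ⟨N + L * R, fun x hx x' hx' => ?_⟩
  obtain ⟨y, hy, hl⟩ := hD.lip x 0 x' hx'
  have h1 := hN y hy
  rw [zero_sub, abs_neg] at hl
  rw [Real.norm_eq_abs] at h1
  have h2 : L * |x| ≤ L * R := mul_le_mul_of_nonneg_left hx hD.nonneg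
  have h3 := abs_sub_abs_le_abs_sub x' y
  rw [abs_sub_comm] at h3
  linarith

/-- The mollification of a semiconcave supersolution is a supersolution up to a small error, also
for slightly larger sets of base points. -/
theorem CoeffBounds.exists_mollify_super (hb : CoeffBounds f σ γ c B ι)
    (hD : IsLipschitzFamily D L) {W : ℝ × ℝ → ℝ} {a Q : ℝ} (hW : IsSemiconcave W a Q)
    (hexp : ∀ t x p q M, HasDerivAt (fun t => W (t, x)) p t →
      HasSecondOrderExpansion (fun x => W (t, x)) x q M → 0 ≤ infOperator f σ γ D x p M)
    (R : ℝ) {ω : ℝ} (hω0 : 0 < ω) (hω : ω ≤ ι / 2) :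
    ∃ r > 0, ∀ ρ : ContDiffBump (0 : ℝ × ℝ), ρ.rOut ≤ r → ∀ z : ℝ × ℝ, |z.2| ≤ R →
      ∀ y', (∃ y ∈ D z.2, |y' - y| ≤ r) → spaceDeriv2 (mollify ρ W) z ≤ γ y' + ω ∧
        timeDeriv (mollify ρ W) z + drift f σ y' (spaceDeriv2 (mollify ρ W) z) ≤ ω := by
  obtain ⟨R', hR'⟩ := hD.exists_bound R
  obtain ⟨s, hs, hu⟩ := hb.uniform (R' + 1) hω0
  have hL := hD.nonneg
  set r := min 1 (s / (L + 1)) with hr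
  have hr0 : 0 < r := by positivity
  have hrs : (L + 1) * r ≤ s := by
    have : r ≤ s / (L + 1) := min_le_right _ _
    rw [le_div_iff₀ (by positivity)] at this
    linarith
  refine ⟨r, hr0, fun ρ hρ z hz y' ⟨y, hy, hyy⟩ => ?_⟩
  refine hb.mollify_super hW ρ z hω fun t x p q M hd hp hq => ?_
  have h0 := infOperator_nonneg_iff.1 (hexp t x p q M hp hq)
  -- The inequality at the nearby point `x` is used for the base point of `D x` that follows `y`;
  -- only then are the coefficients frozen at `y'`.
  obtain ⟨x', hx', hl⟩ := hD.lip z.2 x y hy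
  have h1 := h0 x' hx'
  rw [pricingF_eq, le_min_iff] at h1
  have h2 : |x - z.2| ≤ r := by
    have : dist x z.2 ≤ dist (t, x) z := le_max_right _ _
    rw [Real.dist_eq] at this
    linarith
  have h3 : |x' - y'| ≤ s := by
    have e1 : L * |x - z.2| ≤ L * r := mul_le_mul_of_nonneg_left h2 hL
    have e2 := abs_sub_le x' y y'
    rw [abs_sub_comm y] at e2
    linarith
  have h4 : |y'| ≤ R' + 1 := by
    have e1 := hR' z.2 hz y hy
    have e2 := abs_sub_abs_le_abs_sub y' y
    have e3 : r ≤ 1 := min_le_left _ _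
    linarith
  obtain ⟨hγ, hdr⟩ := hu y' x' h4 h3
  have h5 := abs_le.1 hγ
  have hM : M ≤ γ y' + ω := by linarith [h1.2]
  refine ⟨hM, ?_⟩
  have h6 := abs_le.1 (hdr M (by linarith) (by linarith [hb.iota_pos, h1.2]))
  linarith [h1.1]

/-- A convex combination of an approximate supersolution and a strict one is strict. -/
theorem CoeffBounds.le_pricingF_combination (hb : CoeffBounds f σ γ c B ι) {y μ ω P q : ℝ}
    (hμ0 : 0 < μ) (hμ1 : μ ≤ 1) (hω0 : 0 ≤ ω) (hω1 : 2 * ω ≤ μ) (hω2 : 4 * ω ≤ μ * ι)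
    (hω3 : ω ≤ ι / 2) (hP : P ≤ γ y + ω) (hq : q + drift f σ y P ≤ ω) :
    ω ≤ pricingF f σ γ y ((1 - μ) * q + μ * -(driftBound c B ι + 1))
      ((1 - μ) * P + μ * (ι / 2)) := by
  have hι := hb.iota_pos
  have hγ := hb.iota_le y
  -- The strict element has second derivative `ι / 2`, half the minimal `γ`, and time slope
  -- `-(driftBound c B ι + 1)`. With weight `μ` it leaves the slacks `μ` and `μ * ι / 2` in the two
  -- entries, which absorb `ω`.
  have h1 := hb.drift_convex (x := y) (M := P) (N := ι / 2) (lam := 1 - μ) (by linarith)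
    (by linarith) (by linarith) (by linarith)
  rw [sub_sub_cancel] at h1
  have h2 := (abs_le.1 (hb.abs_drift_le (x := y) (M := ι / 2) (by linarith))).2
  have h3 : (1 - μ) * (q + drift f σ y P) ≤ (1 - μ) * ω :=
    mul_le_mul_of_nonneg_left hq (by linarith)
  have h4 : (1 - μ) * P ≤ (1 - μ) * (γ y + ω) := mul_le_mul_of_nonneg_left hP (by linarith)
  have h5 : 0 ≤ μ * ω := by positivity
  have h6 : μ * drift f σ y (ι / 2) ≤ μ * driftBound c B ι := mul_le_mul_of_nonneg_left h2 hμ0.le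
  have h7 : μ * ι ≤ μ * γ y := mul_le_mul_of_nonneg_left hγ hμ0.le
  rw [pricingF_eq]
  refine le_min ?_ ?_
  · linarith
  · linarith

theorem exists_bump (r : ℝ) (hr : 0 < r) : ∃ ρ : ContDiffBump (0 : ℝ × ℝ), ρ.rOut = r :=
  ⟨⟨r / 2, r, by linarith, by linarith⟩, rfl⟩

theorem exists_mollify_close {W : ℝ × ℝ → ℝ} (hW : Continuous W) {K : Set (ℝ × ℝ)}
    (hK : IsCompact K) {θ : ℝ} (hθ : 0 < θ) : ∃ r > 0, ∀ ρ : ContDiffBump (0 : ℝ × ℝ),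
      ρ.rOut ≤ r → ∀ z ∈ K, |mollify ρ W z - W z| ≤ θ := by
  have h1 : ∀ᶠ ζ in 𝓝 (0 : ℝ × ℝ), ∀ z ∈ K, |W (z + ζ) - W z| < θ := by
    refine hK.eventually_forall_of_forall_eventually fun z _ => ?_
    exact ContinuousAt.eventually_lt (by fun_prop) continuousAt_const (by simpa)
  obtain ⟨r, hr, h2⟩ := Metric.eventually_nhds_iff.1 h1
  refine ⟨r, hr, fun ρ hρ z hz => abs_mollify_sub_le ρ hW fun w hw => ?_⟩
  have := h2 (y := w - z) (by rw [dist_zero_right, ← dist_eq_norm]; linarith) z hz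
  rw [add_sub_cancel] at this
  exact this.le

set_option maxHeartbeats 1600000 in
/-- Subsolutions of perturbed problems are asymptotically below the supersolutions of the limit
problem, locally uniformly. -/
theorem IsViscositySupersolution.eventually_le (hb : CoeffBounds f σ γ c B ι)
    (hD : IsLipschitzFamily D L) (hT : 0 < T)
    (hv : IsViscositySupersolution T (infOperator f σ γ D) h v) (hg : HasLinearGrowth T v)
    (hh : Continuous h) {α : Type*} {l : Filter α} {u : α → ℝ × ℝ → ℝ} {D' : α → ℝ → Set ℝ}
    {h' : α → ℝ → ℝ} {C : ℝ}
    (hu : ∀ᶠ a in l, IsViscositySubsolution T (infOperator f σ γ (D' a)) (h' a) (u a))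
    (hC : ∀ᶠ a in l, ∀ p ∈ strip T, u a p ≤ C * (1 + |p.2|))
    (hD' : ∀ R, ∀ θ > 0, ∀ᶠ a in l, ∀ x, |x| ≤ R → ∀ x' ∈ D' a x, ∃ y ∈ D x, |x' - y| ≤ θ)
    (hh' : ∀ R, ∀ θ > 0, ∀ᶠ a in l, ∀ x, |x| ≤ R → h' a x ≤ h x + θ) (R : ℝ) {θ : ℝ}
    (hθ : 0 < θ) : ∀ᶠ a in l, ∀ p ∈ strip T, |p.2| ≤ R →
      u a p ≤ extendSuper T (driftBound c B ι) v p + θ := by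
  obtain ⟨A, hA⟩ := hg
  have hw := hv.isGlobalSuper_extend hb hD hT hA
  have hhv : ∀ x, h x ≤ extendSuper T (driftBound c B ι) v (T, x) := by
    intro x
    rw [extendSuper_of_ge (by exact le_rfl)]
    have hg : HasLinearGrowth T v := ⟨A, hA⟩
    simp only [sub_self, mul_zero, sub_zero]
    refine le_of_forall_pos_sub_le fun ε hε => le_terminalLimit hg hT ?_
    have h1 := hv.terminal_le (fun y q M => hb.infOperator_neg_of_large hD) hT hh x
    have h2 := hv.lsc (T, x) ⟨⟨hT.le, le_rfl⟩, mem_univ _⟩ (h x - ε) (by linarith)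
    have h3 : ∀ᶠ z in 𝓝[openStrip T] (T, x), h x - ε < v z :=
      nhdsWithin_mono _ (openStrip_subset_strip T) h2
    exact h3.mono fun z hz => hz.le
  have hA0 := hw.A_nonneg
  have hΛ0 := hb.driftBound_nonneg
  have hι := hb.iota_pos
  set Λ := driftBound c B ι with hΛ
  set w := extendSuper T Λ v with hwdef
  set θ' := min 1 (θ / 10) with hθ'
  have hθ'0 : 0 < θ' := by positivity
  have hθ'1 : θ' ≤ 1 := min_le_left _ _
  have hθ'θ : 10 * θ' ≤ θ := by have : θ' ≤ θ / 10 := min_le_right _ _; linarith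
  -- Completing the square gives `A * (1 + |x|) ≤ a₀ + ι / 4 * x ^ 2`, so that `S` dominates the
  -- growth bound of `v`.
  set a₀ := A + A ^ 2 / ι with ha₀
  have ha₀0 : 0 ≤ a₀ := by positivity
  -- A bound for `S - w` on `|x| ≤ R`; mixing in `S` with weight `μ` then costs at most `μ * Z ≤ θ /
  -- 2`.
  set Z := a₀ + ι / 4 * R ^ 2 + (Λ + 1) * T + A * (1 + |R|) + Λ * T with hZ
  have hZ0 : 0 ≤ Z := by positivity
  set μ := min (1 / 2) (θ / (2 * (Z + 1))) with hμ
  have hμ0 : 0 < μ := by positivity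
  have hμ1 : μ ≤ 1 := (min_le_left _ _).trans (by norm_num)
  have hμZ : μ * Z ≤ θ / 2 := by
    have : μ ≤ θ / (2 * (Z + 1)) := min_le_right _ _
    rw [le_div_iff₀ (by positivity)] at this
    nlinarith
  set ω := μ * min 1 ι / 4 with hω
  have hω0 : 0 < ω := by positivity
  have hω1 : 4 * ω ≤ μ := by
    have : μ * min 1 ι ≤ μ * 1 := mul_le_mul_of_nonneg_left (min_le_left _ _) hμ0.le
    rw [hω]; linarith
  have hω2 : 4 * ω ≤ μ * ι := by
    have : μ * min 1 ι ≤ μ * ι := mul_le_mul_of_nonneg_left (min_le_right _ _) hμ0.le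
    rw [hω]; linarith
  have hω3 : ω ≤ ι / 2 := by nlinarith
  -- `m` is the quadratic coefficient of `μ * S`, and `N` collects the linear growth of the
  -- subsolutions and of the mollified function. For `|x| ≥ R'` the quadratic term wins, uniformly
  -- in the index `a`.
  set m := μ * ι / 4 with hm
  have hm0 : 0 < m := by positivity
  set N := A + |C| + Λ * T + Λ ^ 2 + 1 with hN
  have hN0 : 0 ≤ N := by positivity
  set R' := |R| + 1 + 2 * N / m with hR'
  have hNm : 0 ≤ 2 * N / m := by positivity
  have hRR' : |R| < R' := by linarith
  have hR'1 : 1 ≤ R' := by linarith [abs_nonneg R]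
  have hcoer : ∀ x, R' ≤ |x| → N * (1 + |x|) ≤ m * x ^ 2 := by
    intro x hx
    have e1 : 2 * N / m ≤ |x| := by linarith [abs_nonneg R]
    rw [div_le_iff₀ hm0] at e1
    have e2 := mul_le_mul_of_nonneg_right e1 (abs_nonneg x)
    have e3 : N * 1 ≤ N * |x| := mul_le_mul_of_nonneg_left (hR'1.trans hx) hN0
    rw [← sq_abs]
    nlinarith
  obtain ⟨δ, hδ0, hδ1, hδ⟩ := hw.exists_le_infConv hT.le hh hhv R' hθ'0
  set W := infConv δ w with hWdef
  have hQ : ∀ y q, ¬ 0 ≤ infOperator f σ γ D y q (1 / c) := fun y q =>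
    hb.not_infOperator_nonneg ⟨y, hD.mem_self y, by linarith [hb.gamma_le_inv y]⟩
  have hWs := hw.isSemiconcave_infConv hδ0 hQ
  have hexp : ∀ t x p q M, HasDerivAt (fun t => W (t, x)) p t →
      HasSecondOrderExpansion (fun x => W (t, x)) x q M → 0 ≤ infOperator f σ γ D x p M :=
    fun t x p q M h1 h2 => hWs.nonneg_of_expansion
      (fun x q M hneg => hb.eventually_infOperator_neg hD hneg)
      (fun φ hφ p hmin => hw.infConv_super hδ0 hφ hmin) h1 h2
  obtain ⟨r₁, hr₁, hmol⟩ := hb.exists_mollify_super hD hWs hexp R' hω0 hω3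
  obtain ⟨r₂, hr₂, hclose⟩ := exists_mollify_close hWs.continuous
    (isCompact_box 0 T (-R') R') hθ'0
  obtain ⟨ρ, hρ⟩ := exists_bump (min r₁ r₂) (lt_min hr₁ hr₂)
  have hVm : ContDiff ℝ 2 (mollify ρ W) := contDiff_mollify ρ hWs.continuous (n := 2)
  set S : ℝ × ℝ → ℝ := fun z => (Λ + 1) * (T - z.1) + (a₀ + ι / 4 * z.2 ^ 2) with hS
  have hSC : ContDiff ℝ 2 S := by fun_prop
  have hS1 : ∀ z, timeDeriv S z = -(Λ + 1) := fun z => by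
    refine timeDeriv_sep (a := fun t => (Λ + 1) * (T - t)) ?_ (fun x => a₀ + ι / 4 * x ^ 2)
    exact (((hasDerivAt_id z.1).const_sub T).const_mul (Λ + 1)).congr_deriv (by ring)
  have hS2 : ∀ z, spaceDeriv2 S z = ι / 2 := fun z => by
    rw [hS, spaceDeriv2_sep (fun t => (Λ + 1) * (T - t)) (fun x => a₀ + ι / 4 * x ^ 2)]
    refine iteratedDeriv_two_eq (b' := fun x => ι / 2 * x) (fun x => ?_) ?_
    · exact ((((hasDerivAt_id x).fun_pow 2).const_mul (ι / 4)).const_add a₀).congr_deriv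
        (by simp; ring)
    · exact ((hasDerivAt_id z.2).const_mul (ι / 2)).congr_deriv (by ring)
  -- This single test function is fixed before the index `a` is chosen. The margin `ω` in its
  -- inequality is what tolerates the varying sets `D' a`.
  set V : ℝ × ℝ → ℝ := fun z => (1 - μ) * mollify ρ W z + μ * S z with hV
  have hVC : ContDiff ℝ 2 V := by fun_prop
  have hV1 : ∀ z, timeDeriv V z = (1 - μ) * timeDeriv (mollify ρ W) z + μ * -(Λ + 1) := fun z => by
    rw [hV, timeDeriv_add (by fun_prop) (by fun_prop), timeDeriv_const_mul _ hVm,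
      timeDeriv_const_mul _ hSC, hS1]
  have hV2 : ∀ z, spaceDeriv2 V z = (1 - μ) * spaceDeriv2 (mollify ρ W) z + μ * (ι / 2) :=
    fun z => by
      rw [hV, spaceDeriv2_add (by fun_prop) (by fun_prop), spaceDeriv2_const_mul _ hVm,
        spaceDeriv2_const_mul _ hSC, hS2]
  filter_upwards [hu, hC, hD' R' (min r₁ r₂) (lt_min hr₁ hr₂), hh' R' θ' hθ'0]
    with a hua hCa hDa hha
  have hG : ∀ p : ℝ × ℝ, |p.2| ≤ R' →
      0 < infOperator f σ γ (D' a) p.2 (timeDeriv V p) (spaceDeriv2 V p) := by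
    intro p hp
    refine infOperator_pos_iff.2 ⟨ω, hω0, fun x' hx' => ?_⟩
    obtain ⟨y, hy, hxy⟩ := hDa p.2 hp x' hx'
    obtain ⟨e1, e2⟩ := hmol ρ (hρ.le.trans (min_le_left _ _)) p hp x'
      ⟨y, hy, hxy.trans (min_le_left _ _)⟩
    rw [hV1, hV2]
    exact hb.le_pricingF_combination hμ0 hμ1 hω0.le (by linarith) hω2 hω3 e1 e2
  have hbox : ∀ z ∈ strip T, |z.2| ≤ R' → |mollify ρ W z - W z| ≤ θ' := fun z hz hz2 =>
    hclose ρ (hρ.le.trans (min_le_right _ _)) z ⟨hz.1, abs_le.1 hz2⟩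
  have hWw : ∀ z ∈ strip T, W z ≤ w z := fun z hz => hw.infConv_le_self hδ0 z.1 z.2 hz.1.1
  have hSnn : ∀ z ∈ strip T, A * (1 + |z.2|) ≤ S z := by
    intro z hz
    have e1 : 0 ≤ (Λ + 1) * (T - z.1) := mul_nonneg (by linarith) (by linarith [hz.1.2])
    have e2 : 0 ≤ (ι * |z.2| / 2 - A) ^ 2 / ι := by positivity
    have e3 : (ι * |z.2| / 2 - A) ^ 2 / ι = ι / 4 * |z.2| ^ 2 - A * |z.2| + A ^ 2 / ι := by
      field_simp; ring
    rw [sq_abs] at e3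
    simp only [hS]
    linarith
  have hmain : ∀ p ∈ strip T, |p.2| ≤ R → u a p ≤ V p + 4 * θ' := by
    intro z₀ hz₀ hz₀R
    by_contra! hcon
    obtain ⟨p, hpK, hpU, hmax, hle⟩ := exists_isLocalMaxOn (S := strip T)
      (K := Icc 0 T ×ˢ Icc (-R') R') (U := univ ×ˢ Ioo (-R') R')
      (J := fun z => u a z - V z) (isCompact_box _ _ _ _)
      ((upperSemicontinuousOn_sub hua.usc hVC.continuous).mono fun z hz => ⟨hz.1, mem_univ _⟩)
      (isOpen_univ.prod isOpen_Ioo) (fun z hz => ⟨hz.2.1, Ioo_subset_Icc_self hz.1.2⟩)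
      (z₀ := z₀) ⟨hz₀.1, abs_le.1 (hz₀R.trans ((le_abs_self R).trans hRR'.le))⟩ (by
        intro z hz hzU
        have hzS : z ∈ strip T := ⟨hz.1, mem_univ _⟩
        have hz2 : |z.2| ≤ R' := abs_le.2 hz.2
        have hz3 : R' ≤ |z.2| := by
          by_contra! hlt
          exact hzU ⟨mem_univ _, abs_lt.1 hlt⟩
        have e1 := hcoer z.2 hz3
        have e2 := (abs_le.1 (hbox z hzS hz2)).1
        have e3 := hw.le_infConv hδ0 z.1 z.2
        rw [Prod.mk.eta] at e3
        have e4 := hCa z hzS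
        have e5 : C * (1 + |z.2|) ≤ |C| * (1 + |z.2|) :=
          mul_le_mul_of_nonneg_right (le_abs_self C) (by positivity)
        have e6 : Λ * z.1 ≤ Λ * T := mul_le_mul_of_nonneg_left hz.1.2 hΛ0
        have e7 : Λ ^ 2 * δ / 2 ≤ Λ ^ 2 := by nlinarith [sq_nonneg Λ]
        have e8 : Λ * T + Λ ^ 2 + 1 ≤ (Λ * T + Λ ^ 2 + 1) * (1 + |z.2|) :=
          le_mul_of_one_le_right (by positivity) (by linarith [abs_nonneg z.2])
        have e9 : -((A + (Λ * T + Λ ^ 2 + 1)) * (1 + |z.2|)) ≤ mollify ρ W z := by linarith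
        have e10 : -((A + (Λ * T + Λ ^ 2 + 1)) * (1 + |z.2|)) ≤ (1 - μ) * mollify ρ W z := by
          have i1 := mul_le_mul_of_nonneg_left e9 (by linarith : 0 ≤ 1 - μ)
          have i2 : 0 ≤ μ * ((A + (Λ * T + Λ ^ 2 + 1)) * (1 + |z.2|)) := by positivity
          linarith
        have e11 : m * z.2 ^ 2 ≤ μ * S z := by
          have i1 : ι / 4 * z.2 ^ 2 ≤ S z := by
            have : 0 ≤ (Λ + 1) * (T - z.1) := mul_nonneg (by linarith) (by linarith [hz.1.2])
            simp only [hS]; linarith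
          have i2 := mul_le_mul_of_nonneg_left i1 hμ0.le
          rw [hm]; linarith
        have e12 : N * (1 + |z.2|) =
          (A + (Λ * T + Λ ^ 2 + 1)) * (1 + |z.2|) + |C| * (1 + |z.2|) := by rw [hN]; ring
        have e13 : u a z ≤ V z := by simp only [hV]; linarith
        linarith)
    have hpS : p ∈ strip T := ⟨hpK.1, mem_univ _⟩
    have hp2 : |p.2| ≤ R' := abs_le.2 hpK.2
    have hpos := hG p hp2
    rcases lt_or_eq_of_le hpK.1.2 with hpT | hpT
    · exact (hua.interior V hVC p hpS hpT hmax).not_gt hpos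
    · have h1 := hua.terminal V hVC p hpS hpT hmax
      rcases min_le_iff.1 h1 with h1 | h1
      · exact h1.not_gt hpos
      · have h2 : u a p - h' a p.2 ≤ 0 := by exact_mod_cast h1
        have h3 := hha p.2 hp2
        have h4 := hδ p.2 hp2
        have hp' : (T, p.2) = p := by rw [← hpT]
        rw [hp'] at h4
        have h5 := abs_le.1 (hbox p hpS hp2)
        have h6 := hWw p hpS
        have h7 : w p ≤ A * (1 + |p.2|) := by
          rw [hwdef, extendSuper_of_ge hpT.ge, hpT, sub_self, mul_zero, sub_zero]
          exact (abs_le.1 (abs_terminalLimit_le hT hA p.2)).2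
        have h8 := hSnn p hpS
        -- At `T` the function `S` dominates `w`, so mixing it in lowers the mollified function by
        -- no more than `θ'`. The four errors `θ'` come from `h' a`, the inf-convolution, the
        -- mollification and this mixing.
        have h9 : mollify ρ W p - θ' ≤ V p := by
          have i1 : mollify ρ W p - θ' ≤ S p := by linarith
          have i2 := mul_le_mul_of_nonneg_left i1 hμ0.le
          have i3 : μ * θ' ≤ θ' := mul_le_of_le_one_left hθ'0.le hμ1
          simp only [hV]
          linarith
        linarith
  intro p hp hpR
  have h1 := hmain p hp hpR
  have hp2 : |p.2| ≤ R' := hpR.trans ((le_abs_self R).trans hRR'.le)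
  have h2 := (abs_le.1 (hbox p hp hp2)).2
  have h3 := hWw p hp
  have h4 := hw.lower p hp.1.1
  have h5 : (1 - μ) * mollify ρ W p ≤ (1 - μ) * (w p + θ') :=
    mul_le_mul_of_nonneg_left (by linarith) (by linarith)
  have h6 : S p - w p ≤ Z := by
    have i1 : Λ * p.1 ≤ Λ * T := mul_le_mul_of_nonneg_left hp.1.2 hΛ0
    have i2 : (Λ + 1) * (T - p.1) ≤ (Λ + 1) * T :=
      mul_le_mul_of_nonneg_left (by linarith [hp.1.1]) (by linarith)
    have i3 : A * (1 + |p.2|) ≤ A * (1 + |R|) :=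
      mul_le_mul_of_nonneg_left (by linarith [le_abs_self R]) hA0
    have i4 : p.2 ^ 2 ≤ R ^ 2 := by
      rw [← sq_abs]; exact pow_le_pow_left₀ (abs_nonneg _) hpR 2
    have i5 : ι / 4 * p.2 ^ 2 ≤ ι / 4 * R ^ 2 := mul_le_mul_of_nonneg_left i4 (by linarith)
    simp only [hS]
    linarith
  have h7 := mul_le_mul_of_nonneg_left h6 hμ0.le
  have h8 : 0 ≤ μ * θ' := by positivity
  simp only [hV] at h1
  linarith

/-- Comparison principle. -/
theorem IsViscositySubsolution.le_extendSuper (hb : CoeffBounds f σ γ c B ι)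
    (hD : IsLipschitzFamily D L) (hT : 0 < T) (hh : Continuous h) {u : ℝ × ℝ → ℝ}
    (hu : IsViscositySubsolution T (infOperator f σ γ D) h u) (hgu : HasLinearGrowth T u)
    (hv : IsViscositySupersolution T (infOperator f σ γ D) h v) (hg : HasLinearGrowth T v)
    {p : ℝ × ℝ} (hp : p ∈ strip T) : u p ≤ extendSuper T (driftBound c B ι) v p := by
  obtain ⟨C, hC⟩ := hgu
  refine le_of_forall_pos_le_add fun θ hθ => ?_
  -- Comparison is the constant family, along a nontrivial filter on one point.
  have := hv.eventually_le hb hD hT hg hh (l := (⊤ : Filter Unit)) (u := fun _ => u)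
    (D' := fun _ => D) (h' := fun _ => h) (C := C) (Eventually.of_forall fun _ => hu)
    (Eventually.of_forall fun _ p hp => (le_abs_self _).trans (hC p hp))
    (fun R θ hθ => Eventually.of_forall fun _ x _ x' hx' => ⟨x', hx', by simpa using hθ.le⟩)
    (fun R θ hθ => Eventually.of_forall fun _ x _ => by linarith) |p.2| hθ
  obtain ⟨_, h1⟩ := this.exists
  exact h1 p hp le_rfl

end

end GammaPricing

namespace GammaPricing

/-! ### Semicontinuous envelopes -/

theorem lscEnvelope_eq_neg (T : ℝ) (u : ℝ × ℝ → ℝ) (p : ℝ × ℝ) :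
    lscEnvelope T u p = -uscEnvelope T (fun z => -u z) p := by
  unfold lscEnvelope uscEnvelope
  rw [liminf_eq, limsup_eq, Real.sInf_def, neg_neg]
  congr 1
  ext a
  simp [neg_le_neg_iff]

section
variable {T : ℝ} {u : ℝ × ℝ → ℝ} {p : ℝ × ℝ}

theorem HasLinearGrowth.neg (hu : HasLinearGrowth T u) : HasLinearGrowth T fun z => -u z := by
  obtain ⟨C, hC⟩ := hu
  exact ⟨C, fun p hp => by rw [abs_neg]; exact hC p hp⟩

theorem HasLinearGrowth.isBoundedUnder (hu : HasLinearGrowth T u) (p : ℝ × ℝ) :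
    (𝓝[strip T] p).IsBoundedUnder (· ≥ ·) u ∧ (𝓝[strip T] p).IsBoundedUnder (· ≤ ·) u := by
  obtain ⟨B, hB⟩ := hu.exists_eventually_abs_le p
  exact isBoundedUnder_of_eventually_abs_le hB

theorem eventually_lt_of_uscEnvelope_lt (hu : HasLinearGrowth T u) {a : ℝ}
    (h : uscEnvelope T u p < a) : ∀ᶠ z in 𝓝[strip T] p, u z < a :=
  eventually_lt_of_limsup_lt h (hu.isBoundedUnder p).2

theorem frequently_lt_of_lt_uscEnvelope (hu : HasLinearGrowth T u) (hp : p ∈ strip T) {a : ℝ}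
    (h : a < uscEnvelope T u p) : ∃ᶠ z in 𝓝[strip T] p, a < u z := by
  have := nhdsWithin_neBot_of_mem hp
  exact frequently_lt_of_lt_limsup (hu.isBoundedUnder p).1.isCoboundedUnder_le h

theorem uscEnvelope_le (hu : HasLinearGrowth T u) (hp : p ∈ strip T) {a : ℝ}
    (h : ∀ᶠ z in 𝓝[strip T] p, u z ≤ a) : uscEnvelope T u p ≤ a := by
  have := nhdsWithin_neBot_of_mem hp
  exact limsup_le_of_le (hu.isBoundedUnder p).1.isCoboundedUnder_le h

theorem le_uscEnvelope (hu : HasLinearGrowth T u) (hp : p ∈ strip T) : u p ≤ uscEnvelope T u p := by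
  by_contra! hlt
  obtain ⟨a, h1, h2⟩ := exists_between hlt
  exact (((eventually_lt_of_uscEnvelope_lt hu h1).self_of_nhdsWithin hp).trans h2).false

theorem upperSemicontinuousOn_uscEnvelope (hu : HasLinearGrowth T u) :
    UpperSemicontinuousOn (uscEnvelope T u) (strip T) := by
  intro z _ a ha
  obtain ⟨a', h1, h2⟩ := exists_between ha
  filter_upwards [eventually_eventually_nhdsWithin.2 (eventually_lt_of_uscEnvelope_lt hu h1),
    self_mem_nhdsWithin] with w hw hwS
  exact (uscEnvelope_le hu hwS (hw.mono fun _ => le_of_lt)).trans_lt h2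

theorem abs_uscEnvelope_le {C : ℝ} (hC : ∀ p ∈ strip T, |u p| ≤ C * (1 + |p.2|))
    (hp : p ∈ strip T) : |uscEnvelope T u p| ≤ C * (1 + |p.2|) := by
  have hu : HasLinearGrowth T u := ⟨C, hC⟩
  refine abs_le.2 ⟨(abs_le.1 (hC p hp)).1.trans (le_uscEnvelope hu hp), ?_⟩
  refine le_of_forall_pos_le_add fun ε hε => uscEnvelope_le hu hp ?_
  have h1 : ∀ᶠ z : ℝ × ℝ in 𝓝 p, C * (1 + |z.2|) < C * (1 + |p.2|) + ε :=
    ContinuousAt.eventually_lt (by fun_prop) continuousAt_const (by simpa)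
  filter_upwards [nhdsWithin_le_nhds h1, self_mem_nhdsWithin] with z hz hzS
  exact (abs_le.1 (hC z hzS)).2.trans hz.le

theorem HasLinearGrowth.uscEnvelope (hu : HasLinearGrowth T u) :
    HasLinearGrowth T (uscEnvelope T u) := by
  obtain ⟨C, hC⟩ := hu
  exact ⟨C, fun p hp => abs_uscEnvelope_le hC hp⟩

theorem HasLinearGrowth.lscEnvelope (hu : HasLinearGrowth T u) :
    HasLinearGrowth T (lscEnvelope T u) := by
  obtain ⟨C, hC⟩ := hu.neg.uscEnvelope
  exact ⟨C, fun p hp => by rw [lscEnvelope_eq_neg, abs_neg]; exact hC p hp⟩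

theorem frequently_lt_of_lscEnvelope_lt (hu : HasLinearGrowth T u) (hp : p ∈ strip T) {a : ℝ}
    (h : lscEnvelope T u p < a) : ∃ᶠ z in 𝓝[strip T] p, u z < a := by
  rw [lscEnvelope_eq_neg] at h
  exact (frequently_lt_of_lt_uscEnvelope hu.neg hp (by linarith : -a < _)).mono
    fun z hz => by linarith

theorem lscEnvelope_le (hu : HasLinearGrowth T u) (hp : p ∈ strip T) : lscEnvelope T u p ≤ u p := by
  rw [lscEnvelope_eq_neg]
  linarith [le_uscEnvelope hu.neg hp]

theorem lowerSemicontinuousOn_lscEnvelope (hu : HasLinearGrowth T u) :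
    LowerSemicontinuousOn (lscEnvelope T u) (strip T) := by
  intro z hz a ha
  rw [lscEnvelope_eq_neg] at ha
  have := upperSemicontinuousOn_uscEnvelope hu.neg z hz (-a) (by linarith)
  filter_upwards [this] with w hw
  rw [lscEnvelope_eq_neg]
  linarith

theorem uscEnvelope_eqOn (hu : ContinuousOn u (strip T)) : EqOn (uscEnvelope T u) u (strip T) := by
  intro p hp
  have := nhdsWithin_neBot_of_mem hp
  exact (hu p hp).limsup_eq

theorem lscEnvelope_eqOn (hu : ContinuousOn u (strip T)) : EqOn (lscEnvelope T u) u (strip T) := by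
  intro p hp
  have := nhdsWithin_neBot_of_mem hp
  exact (hu p hp).liminf_eq

end

/-! ### Changes of the function, of the operator and of the terminal value -/

section
variable {T : ℝ} {G G' : ℝ → ℝ → ℝ → EReal} {h h' : ℝ → ℝ} {u u' : ℝ × ℝ → ℝ}

theorem isLocalMaxOn_congr_sub {φ : ℝ × ℝ → ℝ} {S : Set (ℝ × ℝ)} (he : EqOn u u' S) {p : ℝ × ℝ}
    (hp : p ∈ S) (h : IsLocalMaxOn (fun z => u' z - φ z) S p) :
    IsLocalMaxOn (fun z => u z - φ z) S p := by
  refine IsMaxFilter.congr h ?_ (by rw [he hp])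
  filter_upwards [self_mem_nhdsWithin] with z hz
  rw [he hz]

theorem isLocalMinOn_congr_sub {φ : ℝ × ℝ → ℝ} {S : Set (ℝ × ℝ)} (he : EqOn u u' S) {p : ℝ × ℝ}
    (hp : p ∈ S) (h : IsLocalMinOn (fun z => u' z - φ z) S p) :
    IsLocalMinOn (fun z => u z - φ z) S p := by
  refine IsMinFilter.congr h ?_ (by rw [he hp])
  filter_upwards [self_mem_nhdsWithin] with z hz
  rw [he hz]

theorem IsViscositySubsolution.congr (hu : IsViscositySubsolution T G h u)
    (he : EqOn u u' (strip T)) : IsViscositySubsolution T G h u' where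
  usc p hp a ha := by
    change u' p < a at ha
    rw [← he hp] at ha
    filter_upwards [hu.usc p hp a ha, self_mem_nhdsWithin] with z hz hzS
    change u' z < a
    rwa [← he hzS]
  interior φ hφ p hp hpT hmax :=
    hu.interior φ hφ p hp hpT (isLocalMaxOn_congr_sub he hp hmax)
  terminal φ hφ p hp hpT hmax := by
    rw [← he hp]
    exact hu.terminal φ hφ p hp hpT (isLocalMaxOn_congr_sub he hp hmax)

theorem IsViscositySupersolution.congr (hu : IsViscositySupersolution T G h u)
    (he : EqOn u u' (strip T)) : IsViscositySupersolution T G h u' where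
  lsc p hp a ha := by
    change u' p > a at ha
    rw [← he hp] at ha
    filter_upwards [hu.lsc p hp a ha, self_mem_nhdsWithin] with z hz hzS
    change u' z > a
    rwa [← he hzS]
  interior φ hφ p hp hpT hmin :=
    hu.interior φ hφ p hp hpT (isLocalMinOn_congr_sub he hp hmin)
  terminal φ hφ p hp hpT hmin := by
    rw [← he hp]
    exact hu.terminal φ hφ p hp hpT (isLocalMinOn_congr_sub he hp hmin)

/-- This is the easy half of the convergence: solutions for a smaller operator and a larger terminal
value are supersolutions of the limit problem. -/
theorem IsViscositySupersolution.mono (hu : IsViscositySupersolution T G h u)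
    (hG : ∀ x q M, G x q M ≤ G' x q M) (hh : ∀ x, h' x ≤ h x) :
    IsViscositySupersolution T G' h' u where
  lsc := hu.lsc
  interior φ hφ p hp hpT hmin := (hu.interior φ hφ p hp hpT hmin).trans (hG _ _ _)
  terminal φ hφ p hp hpT hmin := (hu.terminal φ hφ p hp hpT hmin).trans
    (max_le_max (hG _ _ _) (by exact_mod_cast sub_le_sub_left (hh p.2) _))

theorem IsLinearGrowthSolution.sub_self (hu : IsLinearGrowthSolution T G h u)
    (hc : ContinuousOn u (strip T)) : IsViscositySubsolution T G h u :=
  hu.sub.congr (uscEnvelope_eqOn hc)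

theorem IsLinearGrowthSolution.super_self (hu : IsLinearGrowthSolution T G h u)
    (hc : ContinuousOn u (strip T)) : IsViscositySupersolution T G h u :=
  hu.super.congr (lscEnvelope_eqOn hc)

theorem extendSuper_eqOn (hT : 0 < T) (hu : ContinuousOn u (strip T)) (A : ℝ) :
    EqOn (extendSuper T A u) u (strip T) := by
  intro p hp
  rcases lt_or_eq_of_le hp.1.2 with h1 | h1
  · exact extendSuper_of_lt h1
  · have hp' : p = (T, p.2) := by rw [← h1]
    have := openStrip_neBot hT p.2
    rw [extendSuper_of_ge h1.ge, h1, _root_.sub_self, mul_zero, sub_zero]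
    unfold terminalLimit
    rw [← hp']
    rw [← hp'] at this
    exact ((hu p hp).mono_left (nhdsWithin_mono _ (openStrip_subset_strip T))).liminf_eq

end

/-! ### Barriers -/

theorem nonneg_of_eventually_right {g : ℝ → ℝ} {m t : ℝ} (hg : HasDerivAt g m t)
    (h : ∀ᶠ s in 𝓝[>] t, g t ≤ g s) : 0 ≤ m := by
  have := nonpos_of_eventually_right hg.fun_neg (h.mono fun s hs => by linarith)
  linarith

theorem tendsto_mk_strip {T : ℝ} {p : ℝ × ℝ} (hp : p ∈ strip T) (hpT : p.1 < T) :
    Tendsto (fun s : ℝ => (s, p.2)) (𝓝[>] p.1) (𝓝[strip T] p) := by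
  refine tendsto_nhdsWithin_iff.2 ⟨?_, ?_⟩
  · exact ((by fun_prop : Continuous fun s : ℝ => (s, p.2)).tendsto p.1).mono_left
      nhdsWithin_le_nhds
  · filter_upwards [self_mem_nhdsWithin, nhdsWithin_le_nhds (Iio_mem_nhds hpT)] with s h1 h2
    exact ⟨⟨hp.1.1.trans (le_of_lt h1), le_of_lt h2⟩, mem_univ _⟩

theorem tendsto_mk_strip_space {T : ℝ} {p : ℝ × ℝ} (hp : p ∈ strip T) :
    Tendsto (fun y : ℝ => (p.1, y)) (𝓝 p.2) (𝓝[strip T] p) := by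
  refine tendsto_nhdsWithin_iff.2 ⟨?_, ?_⟩
  · exact (by fun_prop : Continuous fun y : ℝ => (p.1, y)).tendsto p.2
  · exact Eventually.of_forall fun y => ⟨hp.1, mem_univ _⟩

/-- At a local maximum over the strip, before the terminal time, of a difference of smooth
functions, the derivatives are ordered. -/
theorem timeDeriv_le_of_isLocalMaxOn {T : ℝ} {u φ : ℝ × ℝ → ℝ} {m : ℝ} {p : ℝ × ℝ}
    (hu : HasDerivAt (fun t => u (t, p.2)) m p.1) (hφ : ContDiff ℝ 2 φ) (hp : p ∈ strip T)
    (hpT : p.1 < T) (hmax : IsLocalMaxOn (fun z => u z - φ z) (strip T) p) :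
    m ≤ timeDeriv φ p := by
  have := nonpos_of_eventually_right (hu.fun_sub (hasDerivAt_slice_fst hφ p))
    (((tendsto_mk_strip hp hpT).eventually hmax).mono fun s hs => hs)
  linarith

theorem timeDeriv_ge_of_isLocalMinOn {T : ℝ} {u φ : ℝ × ℝ → ℝ} {m : ℝ} {p : ℝ × ℝ}
    (hu : HasDerivAt (fun t => u (t, p.2)) m p.1) (hφ : ContDiff ℝ 2 φ) (hp : p ∈ strip T)
    (hpT : p.1 < T) (hmin : IsLocalMinOn (fun z => u z - φ z) (strip T) p) :
    timeDeriv φ p ≤ m := by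
  have := nonneg_of_eventually_right (hu.fun_sub (hasDerivAt_slice_fst hφ p))
    (((tendsto_mk_strip hp hpT).eventually hmin).mono fun s hs => hs)
  linarith

theorem spaceDeriv2_le_of_isLocalMaxOn {T : ℝ} {ψ φ : ℝ × ℝ → ℝ} {p : ℝ × ℝ}
    (hψ : ContDiff ℝ 2 ψ) (hφ : ContDiff ℝ 2 φ) (hp : p ∈ strip T)
    (hmax : IsLocalMaxOn (fun z => ψ z - φ z) (strip T) p) :
    spaceDeriv2 ψ p ≤ spaceDeriv2 φ p := by
  have h1 := contDiff_slice_snd hψ p.1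
  have h2 := contDiff_slice_snd hφ p.1
  have h3 := iteratedDeriv_two_nonpos_of_isLocalMin (c := fun _ => 0) (x := p.2)
    (ψ := fun x => ψ (p.1, x) + -1 * φ (p.1, x)) (by simp) (by fun_prop) (by
      filter_upwards [(tendsto_mk_strip_space hp).eventually hmax] with y hy
      have hy : ψ (p.1, y) - φ (p.1, y) ≤ ψ p - φ p := hy
      simp only [Prod.mk.eta]
      linarith)
  rw [iteratedDeriv_two_add h1 (by fun_prop), iteratedDeriv_two_const_mul _ h2] at h3
  unfold spaceDeriv2
  linarith

section
variable {T : ℝ} {f σ γ h : ℝ → ℝ} {c B ι L : ℝ} {D : ℝ → Set ℝ}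

/-- A time slope of at least `driftBound` makes the operator nonpositive whatever the second
derivative is, so `h` needs no regularity beyond continuity. -/
theorem CoeffBounds.isViscositySubsolution_barrier (hb : CoeffBounds f σ γ c B ι)
    (hD : IsLipschitzFamily D L) (hh : Continuous h) :
    IsViscositySubsolution T (infOperator f σ γ D) h
      fun z => h z.2 - driftBound c B ι * (T - z.1) where
  usc := ContinuousOn.upperSemicontinuousOn (by fun_prop)
  interior φ hφ p hp hpT hmax := by
    refine hb.infOperator_nonpos_of_large hD (timeDeriv_le_of_isLocalMaxOn ?_ hφ hp hpT hmax)
    exact ((((hasDerivAt_id p.1).const_sub T).const_mul (driftBound c B ι)).const_sub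
      (h p.2)).congr_deriv (by ring)
  terminal φ hφ p hp hpT hmax := by
    refine (min_le_right _ _).trans ?_
    simp [hpT]

/-- A function that satisfies the gamma constraint gives a supersolution. -/
theorem CoeffBounds.isViscositySupersolution_barrier (hb : CoeffBounds f σ γ c B ι)
    {k : ℝ → ℝ} (hk : Continuous k) (hhk : ∀ x, h x ≤ k x)
    (hc : ∀ ψ : ℝ → ℝ, ContDiff ℝ 2 ψ → ∀ x, IsLocalMin (fun y => k y - ψ y) x →
      ∀ x' ∈ D x, iteratedDeriv 2 ψ x ≤ γ x') :
    IsViscositySupersolution T (infOperator f σ γ D) h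
      fun z => k z.2 + driftBound c B ι * (T - z.1) where
  lsc := ContinuousOn.lowerSemicontinuousOn (by fun_prop)
  interior φ hφ p hp hpT hmin := by
    refine hb.infOperator_nonneg_of_small (timeDeriv_ge_of_isLocalMinOn ?_ hφ hp hpT hmin) ?_
    · exact ((((hasDerivAt_id p.1).const_sub T).const_mul (driftBound c B ι)).const_add
        (k p.2)).congr_deriv (by ring)
    · refine hc _ (contDiff_slice_snd hφ p.1) p.2 ?_
      filter_upwards [(tendsto_mk_strip_space hp).eventually hmin] with y hy
      rw [Prod.mk.eta]
      linarith
  terminal φ hφ p hp hpT hmin := by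
    refine le_max_of_le_right ?_
    have := hhk p.2
    simp only [hpT, sub_self, mul_zero, add_zero]
    exact_mod_cast sub_nonneg.2 this

end

/-- The smooth barrier at infinity. -/
noncomputable def hyperbola (C R x : ℝ) : ℝ := C * (1 + √(R ^ 2 + x ^ 2))

theorem le_hyperbola {C : ℝ} (hC : 0 ≤ C) (R x : ℝ) : C * (1 + |x|) ≤ hyperbola C R x := by
  have : |x| ≤ √(R ^ 2 + x ^ 2) := Real.abs_le_sqrt (by nlinarith [sq_nonneg R])
  exact mul_le_mul_of_nonneg_left (by linarith) hC

theorem hyperbola_le {C R : ℝ} (hC : 0 ≤ C) (hR : 0 ≤ R) (x : ℝ) :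
    hyperbola C R x ≤ C * (1 + R) * (1 + |x|) := by
  have h1 : √(R ^ 2 + x ^ 2) ≤ R + |x| :=
    Real.sqrt_le_iff.2 ⟨by positivity, by rw [← sq_abs x]; nlinarith [abs_nonneg x]⟩
  have h2 : 1 + √(R ^ 2 + x ^ 2) ≤ (1 + R) * (1 + |x|) := by nlinarith [abs_nonneg x]
  rw [mul_assoc]
  exact mul_le_mul_of_nonneg_left h2 hC

theorem contDiff_hyperbola (C : ℝ) {R : ℝ} (hR : 0 < R) : ContDiff ℝ 2 (hyperbola C R) := by
  unfold hyperbola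
  refine contDiff_const.mul (contDiff_const.add (ContDiff.sqrt (by fun_prop) fun x => ?_))
  positivity

/-- The second derivative of the root is `R ^ 2 / s ^ 3` with `s ≥ R`. A large `R` thus gives linear
growth with slope `C` together with a second derivative below `ι`. -/
theorem iteratedDeriv_two_hyperbola_le {C R : ℝ} (hC : 0 ≤ C) (hR : 0 < R) (x : ℝ) :
    iteratedDeriv 2 (hyperbola C R) x ≤ C / R := by
  have hd : ∀ z : ℝ, HasDerivAt (fun x => √(R ^ 2 + x ^ 2)) (z / √(R ^ 2 + z ^ 2)) z := by
    intro z
    have h1 := ((hasDerivAt_id z).fun_pow 2).const_add (R ^ 2)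
    have h2 := h1.sqrt (by simp only [id]; positivity)
    refine h2.congr_deriv ?_
    simp only [id]
    rw [div_eq_div_iff (by positivity) (by positivity)]
    push_cast
    ring
  have hs : 0 < √(R ^ 2 + x ^ 2) := by positivity
  have hsq : √(R ^ 2 + x ^ 2) ^ 2 = R ^ 2 + x ^ 2 := Real.sq_sqrt (by positivity)
  have h2 : iteratedDeriv 2 (hyperbola C R) x =
      C * ((√(R ^ 2 + x ^ 2) - x * (x / √(R ^ 2 + x ^ 2))) / √(R ^ 2 + x ^ 2) ^ 2) := by
    refine iteratedDeriv_two_eq (b' := fun z => C * (z / √(R ^ 2 + z ^ 2))) (fun z => ?_) ?_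
    · exact ((hd z).const_add 1).const_mul C
    · exact (((hasDerivAt_id x).div (hd x) hs.ne').const_mul C).congr_deriv (by simp)
  rw [h2, mul_div_assoc' , ← mul_one_div C R, mul_div_assoc]
  refine mul_le_mul_of_nonneg_left ?_ hC
  have hRs : R ≤ √(R ^ 2 + x ^ 2) := Real.le_sqrt_of_sq_le (by nlinarith [sq_nonneg x])
  set s := √(R ^ 2 + x ^ 2)
  have e : s - x * (x / s) = R ^ 2 / s := by
    field_simp
    linarith
  rw [e, div_div, div_le_div_iff₀ (by positivity) hR, one_mul]
  have e1 : R ^ 2 * R ≤ s ^ 2 * s :=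
    mul_le_mul (pow_le_pow_left₀ hR.le hRs 2) hRs hR.le (by positivity)
  linarith

end GammaPricing

namespace GammaPricing

/-! ### Perron's method -/

/-- The penalisation used to make extrema strict. -/
def bump (p z : ℝ × ℝ) : ℝ := (z.1 - p.1) ^ 2 + (z.2 - p.2) ^ 4

theorem contDiff_bump (p : ℝ × ℝ) : ContDiff ℝ 2 (bump p) := by
  unfold bump
  fun_prop

theorem bump_self (p : ℝ × ℝ) : bump p p = 0 := by simp [bump]

theorem timeDeriv_bump (p : ℝ × ℝ) : timeDeriv (bump p) p = 0 := by
  refine timeDeriv_sep (a := fun t => (t - p.1) ^ 2) ?_ (fun x => (x - p.2) ^ 4)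
  exact (((hasDerivAt_id p.1).sub_const p.1).fun_pow 2).congr_deriv (by simp)

/-- The fourth power in space, rather than a square, is chosen so that the second derivative is
unchanged at the contact point; in time a square is enough. -/
theorem spaceDeriv2_bump (p : ℝ × ℝ) : spaceDeriv2 (bump p) p = 0 := by
  have := spaceDeriv2_sep (fun t => (t - p.1) ^ 2) (fun x => (x - p.2) ^ 4) p
  have h2 := iteratedDeriv_two_quartic 1 p.2 p.2
  simp only [one_mul, sub_self] at h2
  exact this.trans (h2.trans (by simp))

/-- The open box around `p`. -/
def openBox (p : ℝ × ℝ) (r : ℝ) : Set (ℝ × ℝ) := Ioo (p.1 - r) (p.1 + r) ×ˢ Ioo (p.2 - r) (p.2 + r)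

/-- The closed box around `p`. -/
def closedBox (p : ℝ × ℝ) (r : ℝ) : Set (ℝ × ℝ) := Icc (p.1 - r) (p.1 + r) ×ˢ Icc (p.2 - r) (p.2 + r)

theorem isOpen_openBox (p : ℝ × ℝ) (r : ℝ) : IsOpen (openBox p r) := isOpen_Ioo.prod isOpen_Ioo

theorem isCompact_closedBox (p : ℝ × ℝ) (r : ℝ) : IsCompact (closedBox p r) := isCompact_box _ _ _ _

theorem openBox_subset_closedBox (p : ℝ × ℝ) (r : ℝ) : openBox p r ⊆ closedBox p r :=
  prod_mono Ioo_subset_Icc_self Ioo_subset_Icc_self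

theorem mem_closedBox {p z : ℝ × ℝ} {r : ℝ} :
    z ∈ closedBox p r ↔ |z.1 - p.1| ≤ r ∧ |z.2 - p.2| ≤ r := by
  simp only [closedBox, mem_prod, mem_Icc, abs_le]
  constructor
  · rintro ⟨⟨h1, h2⟩, h3, h4⟩; exact ⟨⟨by linarith, by linarith⟩, by linarith, by linarith⟩
  · rintro ⟨⟨h1, h2⟩, h3, h4⟩; exact ⟨⟨by linarith, by linarith⟩, by linarith, by linarith⟩

theorem mem_openBox {p z : ℝ × ℝ} {r : ℝ} :
    z ∈ openBox p r ↔ |z.1 - p.1| < r ∧ |z.2 - p.2| < r := by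
  simp only [openBox, mem_prod, mem_Ioo, abs_lt]
  constructor
  · rintro ⟨⟨h1, h2⟩, h3, h4⟩; exact ⟨⟨by linarith, by linarith⟩, by linarith, by linarith⟩
  · rintro ⟨⟨h1, h2⟩, h3, h4⟩; exact ⟨⟨by linarith, by linarith⟩, by linarith, by linarith⟩

theorem self_mem_openBox (p : ℝ × ℝ) {r : ℝ} (hr : 0 < r) : p ∈ openBox p r :=
  mem_openBox.2 ⟨by simpa, by simpa⟩

theorem closedBox_subset_openBox (p : ℝ × ℝ) {r s : ℝ} (h : r < s) : closedBox p r ⊆ openBox p s :=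
  fun _ hz => mem_openBox.2 ⟨(mem_closedBox.1 hz).1.trans_lt h, (mem_closedBox.1 hz).2.trans_lt h⟩

theorem exists_closedBox {p : ℝ × ℝ} {P : ℝ × ℝ → Prop} (h : ∀ᶠ z in 𝓝 p, P z) :
    ∃ r, 0 < r ∧ r ≤ 1 ∧ ∀ z ∈ closedBox p r, P z := by
  obtain ⟨r, hr, hb⟩ := Metric.eventually_nhds_iff.1 h
  refine ⟨min 1 (r / 2), by positivity, min_le_left _ _, fun z hz => hb ?_⟩
  obtain ⟨h1, h2⟩ := mem_closedBox.1 hz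
  rw [Prod.dist_eq, Real.dist_eq, Real.dist_eq]
  have : min 1 (r / 2) ≤ r / 2 := min_le_right _ _
  exact max_lt (by linarith) (by linarith)

theorem pow_le_bump {p z : ℝ × ℝ} {r : ℝ} (hr0 : 0 < r) (hr1 : r ≤ 1) (h : z ∉ openBox p r) :
    r ^ 4 ≤ bump p z := by
  rw [mem_openBox, not_and_or, not_lt, not_lt] at h
  unfold bump
  rcases h with h | h
  · have h1 : r ^ 2 ≤ |z.1 - p.1| ^ 2 := pow_le_pow_left₀ hr0.le h 2
    rw [sq_abs] at h1
    have h2 : r ^ 4 ≤ r ^ 2 := pow_le_pow_of_le_one hr0.le hr1 (by norm_num)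
    have h3 : 0 ≤ (z.2 - p.2) ^ 4 := by positivity
    linarith
  · have h1 : r ^ 4 ≤ |z.2 - p.2| ^ 4 := pow_le_pow_left₀ hr0.le h 4
    rw [← abs_pow, abs_of_nonneg (by positivity)] at h1
    have h3 : 0 ≤ (z.1 - p.1) ^ 2 := by positivity
    linarith

section
variable {T : ℝ} {G : ℝ → ℝ → ℝ → EReal} {h : ℝ → ℝ}

/-- Subsolutions with linear growth. -/
def subsolutions (T : ℝ) (G : ℝ → ℝ → ℝ → EReal) (h : ℝ → ℝ) : Set (ℝ × ℝ → ℝ) :=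
  {u | IsViscositySubsolution T G h u ∧ HasLinearGrowth T u}

/-- The largest subsolution. -/
noncomputable def perron (T : ℝ) (G : ℝ → ℝ → ℝ → EReal) (h : ℝ → ℝ) (p : ℝ × ℝ) : ℝ :=
  sSup ((fun u => u p) '' subsolutions T G h)

theorem le_perron {b : ℝ × ℝ → ℝ} (hb : ∀ u ∈ subsolutions T G h, ∀ p ∈ strip T, u p ≤ b p)
    {u : ℝ × ℝ → ℝ} (hu : u ∈ subsolutions T G h) {p : ℝ × ℝ} (hp : p ∈ strip T) :
    u p ≤ perron T G h p :=
  le_csSup ⟨b p, by rintro _ ⟨u, hu, rfl⟩; exact hb u hu p hp⟩ ⟨u, hu, rfl⟩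

theorem exists_lt_of_lt_perron (hne : (subsolutions T G h).Nonempty) {p : ℝ × ℝ} {a : ℝ}
    (ha : a < perron T G h p) : ∃ u ∈ subsolutions T G h, a < u p := by
  obtain ⟨_, ⟨u, hu, rfl⟩, h1⟩ := exists_lt_of_lt_csSup (hne.image _) ha
  exact ⟨u, hu, h1⟩

/-- A supremum of subsolutions has an upper semicontinuous envelope that is a subsolution. -/
theorem uscEnvelope_perron_contradiction
    (hG : ∀ x q M, 0 < G x q M → ∀ᶠ z : ℝ × ℝ × ℝ in 𝓝 (x, q, M), 0 < G z.1 z.2.1 z.2.2)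
    (hh : Continuous h) {b : ℝ × ℝ → ℝ}
    (hb : ∀ u ∈ subsolutions T G h, ∀ p ∈ strip T, u p ≤ b p)
    (hne : (subsolutions T G h).Nonempty) (hg : HasLinearGrowth T (perron T G h))
    {φ : ℝ × ℝ → ℝ} (hφ : ContDiff ℝ 2 φ) {p : ℝ × ℝ} (hp : p ∈ strip T)
    (hmax : IsLocalMaxOn (fun z => uscEnvelope T (perron T G h) z - φ z) (strip T) p)
    (hpos : 0 < G p.2 (timeDeriv φ p) (spaceDeriv2 φ p))
    (hor : p.1 < T ∨ h p.2 < uscEnvelope T (perron T G h) p) : False := by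
  set v := perron T G h
  set V := uscEnvelope T v p with hV
  set ψ : ℝ × ℝ → ℝ := fun z => φ z + bump p z with hψ
  have hψC : ContDiff ℝ 2 ψ := hφ.add (contDiff_bump p)
  have e1 : timeDeriv ψ p = timeDeriv φ p := by
    rw [hψ, timeDeriv_add hφ (contDiff_bump p), timeDeriv_bump, add_zero]
  have e2 : spaceDeriv2 ψ p = spaceDeriv2 φ p := by
    rw [hψ, spaceDeriv2_add hφ (contDiff_bump p), spaceDeriv2_bump, add_zero]
  have e3 : ψ p = φ p := by simp [hψ, bump_self]
  rw [← e1, ← e2] at hpos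
  have n1 : ∀ᶠ z : ℝ × ℝ in 𝓝 p, 0 < G z.2 (timeDeriv ψ z) (spaceDeriv2 ψ z) := by
    have hc : Continuous fun z : ℝ × ℝ => (z.2, timeDeriv ψ z, spaceDeriv2 ψ z) :=
      continuous_snd.prodMk ((continuous_timeDeriv hψC).prodMk (continuous_spaceDeriv2 hψC))
    exact (hc.tendsto p).eventually (hG _ _ _ hpos)
  obtain ⟨η, hη0, n2⟩ : ∃ η > 0, ∀ᶠ z : ℝ × ℝ in 𝓝 p,
      z.1 < T ∨ h z.2 < V - ψ p + ψ z - η := by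
    rcases hor with h1 | h1
    · exact ⟨1, one_pos, (ContinuousAt.eventually_lt continuousAt_fst continuousAt_const h1).mono
        fun z hz => Or.inl hz⟩
    · refine ⟨(V - h p.2) / 2, by linarith, Eventually.mono ?_ fun z hz => Or.inr hz⟩
      have := hψC.continuous
      refine ContinuousAt.eventually_lt (by fun_prop) (by fun_prop) ?_
      linarith
  have n3 := eventually_nhdsWithin_iff.1 hmax
  obtain ⟨r, hr0, hr1, hbox⟩ := exists_closedBox (n1.and (n2.and n3))
  set m := min η (r ^ 4) with hm
  have hm0 : 0 < m := by positivity
  have hball : ∀ᶠ z in 𝓝 p, z ∈ openBox p r :=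
    (isOpen_openBox p r).mem_nhds (self_mem_openBox p hr0)
  have n4 : ∀ᶠ z in 𝓝 p, ψ z < ψ p + m / 2 := by
    have := hψC.continuous
    exact ContinuousAt.eventually_lt (by fun_prop) (by fun_prop) (by linarith)
  -- A point where the Perron function is nearly equal to its envelope at `p`, then one subsolution
  -- `u` nearly attaining it there. The penalty keeps the maximum of `u - ψ` in the box, where all
  -- inequalities are strict.
  obtain ⟨z, hz, hzb, hz4, hzS⟩ := ((frequently_lt_of_lt_uscEnvelope hg hp
    (show V - m / 2 < uscEnvelope T v p by linarith)).and_eventually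
    ((hball.filter_mono nhdsWithin_le_nhds).and
      ((n4.filter_mono nhdsWithin_le_nhds).and self_mem_nhdsWithin))).exists
  obtain ⟨u, hu, hlt⟩ := exists_lt_of_lt_perron hne hz
  have hzu : V - ψ p - m < u z - ψ z := by linarith
  have hub : ∀ w ∈ strip T, u w ≤ uscEnvelope T v w := fun w hw =>
    (le_perron hb hu hw).trans (le_uscEnvelope hg hw)
  obtain ⟨w, hwK, hwU, hwmax, hwle⟩ := exists_isLocalMaxOn (S := strip T)
    (K := closedBox p r ∩ strip T) (U := openBox p r) (J := fun z => u z - ψ z)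
    ((isCompact_closedBox p r).inter_right (isClosed_Icc.prod isClosed_univ))
    ((upperSemicontinuousOn_sub hu.1.usc hψC.continuous).mono inter_subset_right)
    (isOpen_openBox p r) (fun w hw => ⟨openBox_subset_closedBox p r hw.1, hw.2⟩)
    (z₀ := z) ⟨openBox_subset_closedBox p r hzb, hzS⟩ (by
      intro w hw hwU
      have h1 := pow_le_bump hr0 hr1 hwU
      have h2 := (hbox w hw.1).2.2 hw.2
      have h3 := hub w hw.2
      have h4 : m ≤ r ^ 4 := min_le_right _ _
      refine lt_of_le_of_lt ?_ hzu
      have h2 : uscEnvelope T v w - φ w ≤ V - φ p := h2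
      simp only [hψ, bump_self]
      linarith)
  have hGw := (hbox w hwK.1).1
  rcases lt_or_eq_of_le hwK.2.1.2 with hwT | hwT
  · exact (hu.1.interior ψ hψC w hwK.2 hwT hwmax).not_gt hGw
  · rcases min_le_iff.1 (hu.1.terminal ψ hψC w hwK.2 hwT hwmax) with h1 | h1
    · exact h1.not_gt hGw
    · have h2 : u w - h w.2 ≤ 0 := by exact_mod_cast h1
      have h3 : m ≤ η := min_le_left _ _
      rcases (hbox w hwK.1).2.1 with h4 | h4
      · exact h4.ne hwT
      · linarith

theorem isViscositySubsolution_uscEnvelope_perron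
    (hG : ∀ x q M, 0 < G x q M → ∀ᶠ z : ℝ × ℝ × ℝ in 𝓝 (x, q, M), 0 < G z.1 z.2.1 z.2.2)
    (hh : Continuous h) {b : ℝ × ℝ → ℝ}
    (hb : ∀ u ∈ subsolutions T G h, ∀ p ∈ strip T, u p ≤ b p)
    (hne : (subsolutions T G h).Nonempty) (hg : HasLinearGrowth T (perron T G h)) :
    IsViscositySubsolution T G h (uscEnvelope T (perron T G h)) where
  usc := upperSemicontinuousOn_uscEnvelope hg
  interior φ hφ p hp hpT hmax := by
    by_contra! hcon
    exact uscEnvelope_perron_contradiction hG hh hb hne hg hφ hp hmax hcon (Or.inl hpT)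
  terminal φ hφ p hp hpT hmax := by
    by_contra! hcon
    rw [lt_min_iff] at hcon
    have h2 : 0 < uscEnvelope T (perron T G h) p - h p.2 := by exact_mod_cast hcon.2
    exact uscEnvelope_perron_contradiction hG hh hb hne hg hφ hp hmax hcon.1
      (Or.inr (by linarith))

/-- The largest subsolution is upper semicontinuous. -/
theorem perron_mem_subsolutions
    (hG : ∀ x q M, 0 < G x q M → ∀ᶠ z : ℝ × ℝ × ℝ in 𝓝 (x, q, M), 0 < G z.1 z.2.1 z.2.2)
    (hh : Continuous h) {b : ℝ × ℝ → ℝ}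
    (hb : ∀ u ∈ subsolutions T G h, ∀ p ∈ strip T, u p ≤ b p)
    (hne : (subsolutions T G h).Nonempty) (hg : HasLinearGrowth T (perron T G h)) :
    perron T G h ∈ subsolutions T G h := by
  have h1 := isViscositySubsolution_uscEnvelope_perron hG hh hb hne hg
  refine ⟨h1.congr fun p hp => ?_, hg⟩
  exact le_antisymm (le_perron hb ⟨h1, hg.uscEnvelope⟩ hp) (le_uscEnvelope hg hp)

open scoped Classical in
/-- Local modification of a subsolution. -/
theorem IsViscositySubsolution.max_local {v ψ : ℝ × ℝ → ℝ} (hv : IsViscositySubsolution T G h v)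
    (hψ : ContDiff ℝ 2 ψ) {U K : Set (ℝ × ℝ)} (hU : IsOpen U) (hK : IsClosed K)
    (hout : ∀ z ∈ strip T, z ∈ U → z ∉ K → ψ z ≤ v z)
    (hneg : ∀ z ∈ strip T, z ∈ U → ∀ q M, timeDeriv ψ z ≤ q → spaceDeriv2 ψ z ≤ M →
      G z.2 q M ≤ 0)
    (hter : ∀ z ∈ strip T, z ∈ U → z.1 = T → ψ z ≤ h z.2) (hKU : K ⊆ U) :
    IsViscositySubsolution T G h fun z => if z ∈ U then max (v z) (ψ z) else v z := by
  set u : ℝ × ℝ → ℝ := fun z => if z ∈ U then max (v z) (ψ z) else v z with hu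
  have hvu : ∀ z, v z ≤ u z := by
    intro z
    simp only [hu]
    split_ifs
    · exact le_max_left _ _
    · exact le_rfl
  have hψu : ∀ z ∈ U, ψ z ≤ u z := by
    intro z hz
    simp only [hu, if_pos hz]
    exact le_max_right _ _
  have huK : ∀ z ∈ strip T, z ∉ K → u z = v z := by
    intro z hz hzK
    simp only [hu]
    split_ifs with h1
    · exact max_eq_left (hout z hz h1 hzK)
    · rfl
  have hcase : ∀ z, u z = v z ∨ (z ∈ U ∧ u z = ψ z) := by
    intro z
    by_cases h1 : z ∈ U
    · rcases le_total (ψ z) (v z) with h2 | h2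
      · left; simp [hu, h1, h2]
      · right; exact ⟨h1, by simp [hu, h1, h2]⟩
    · left; simp [hu, h1]
  have hmaxv : ∀ φ : ℝ × ℝ → ℝ, ∀ p, u p = v p →
      IsLocalMaxOn (fun z => u z - φ z) (strip T) p →
      IsLocalMaxOn (fun z => v z - φ z) (strip T) p := by
    intro φ p he hmax
    filter_upwards [hmax] with z hz
    have := hvu z
    rw [he] at hz
    linarith
  have hmaxψ : ∀ φ : ℝ × ℝ → ℝ, ∀ p ∈ U, u p = ψ p →
      IsLocalMaxOn (fun z => u z - φ z) (strip T) p →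
      IsLocalMaxOn (fun z => ψ z - φ z) (strip T) p := by
    intro φ p hpU he hmax
    filter_upwards [hmax, nhdsWithin_le_nhds (hU.mem_nhds hpU)] with z hz hzU
    have := hψu z hzU
    rw [he] at hz
    linarith
  refine ⟨fun p hp a ha => ?_, fun φ hφ p hp hpT hmax => ?_, fun φ hφ p hp hpT hmax => ?_⟩
  · change u p < a at ha
    by_cases hpU : p ∈ U
    · have h1 : v p < a := (hvu p).trans_lt ha
      have h2 : ψ p < a := (hψu p hpU).trans_lt ha
      filter_upwards [hv.usc p hp a h1, nhdsWithin_le_nhds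
        (hψ.continuous.continuousAt.eventually_lt continuousAt_const h2)] with z h3 h4
      change u z < a
      rcases hcase z with h5 | h5
      · rw [h5]; exact h3
      · rw [h5.2]; exact h4
    · have hpK : p ∉ K := fun h1 => hpU (hKU h1)
      rw [huK p hp hpK] at ha
      filter_upwards [hv.usc p hp a ha, nhdsWithin_le_nhds (hK.isOpen_compl.mem_nhds hpK),
        self_mem_nhdsWithin] with z h3 h4 h5
      change u z < a
      rw [huK z h5 h4]
      exact h3
  · rcases hcase p with he | ⟨hpU, he⟩
    · exact hv.interior φ hφ p hp hpT (hmaxv φ p he hmax)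
    · have h1 := hmaxψ φ p hpU he hmax
      -- A test function touching from above at a point where the new function equals `ψ` has larger
      -- time slope and second derivative than `ψ`; hence the quantifiers over `q` and `M` in
      -- `hneg`.
      exact hneg p hp hpU _ _
        (timeDeriv_le_of_isLocalMaxOn (hasDerivAt_slice_fst hψ p) hφ hp hpT h1)
        (spaceDeriv2_le_of_isLocalMaxOn hψ hφ hp h1)
  · rcases hcase p with he | ⟨hpU, he⟩
    · rw [he]
      exact hv.terminal φ hφ p hp hpT (hmaxv φ p he hmax)
    · refine (min_le_right _ _).trans ?_
      rw [he]
      exact_mod_cast sub_nonpos.2 (hter p hp hpU hpT)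

theorem HasLinearGrowth.of_eq_or {v u : ℝ × ℝ → ℝ} {M : ℝ} (hv : HasLinearGrowth T v)
    (hu : ∀ z, u z = v z ∨ |u z| ≤ M) : HasLinearGrowth T u := by
  obtain ⟨C, hC⟩ := hv
  refine ⟨|C| + |M|, fun p hp => ?_⟩
  have h1 := le_abs_self C
  have h2 := le_abs_self M
  have h3 := abs_nonneg C
  have h4 := abs_nonneg M
  have h5 := abs_nonneg p.2
  rcases hu p with h | h
  · rw [h]
    exact (hC p hp).trans (mul_le_mul_of_nonneg_right (by linarith) (by linarith))
  · nlinarith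

/-- If the lower envelope failed to be a supersolution, the test function, raised slightly, would be
a local subsolution near `p`. Its maximum with the Perron function would be a subsolution exceeding
the largest one. -/
theorem lscEnvelope_perron_contradiction
    (hG : ∀ x q M, G x q M < 0 → ∀ᶠ z : ℝ × ℝ × ℝ in 𝓝 (x, q, M), G z.1 z.2.1 z.2.2 < 0)
    (hGm : ∀ x q M q' M', G x q M < 0 → q ≤ q' → M ≤ M' → G x q' M' < 0)
    (hh : Continuous h) {b : ℝ × ℝ → ℝ}
    (hb : ∀ u ∈ subsolutions T G h, ∀ p ∈ strip T, u p ≤ b p)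
    (hmem : perron T G h ∈ subsolutions T G h)
    {φ : ℝ × ℝ → ℝ} (hφ : ContDiff ℝ 2 φ) {p : ℝ × ℝ} (hp : p ∈ strip T)
    (hmin : IsLocalMinOn (fun z => lscEnvelope T (perron T G h) z - φ z) (strip T) p)
    (hneg : G p.2 (timeDeriv φ p) (spaceDeriv2 φ p) < 0)
    (hor : p.1 < T ∨ lscEnvelope T (perron T G h) p < h p.2) : False := by
  obtain ⟨hsub, hg⟩ := hmem
  set v := perron T G h with hvdef
  set V := lscEnvelope T v p with hV
  set ψ : ℝ × ℝ → ℝ := fun z => φ z + -1 * bump p z with hψ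
  have hbC := contDiff_bump p
  have hψC : ContDiff ℝ 2 ψ := by fun_prop
  have e1 : timeDeriv ψ p = timeDeriv φ p := by
    rw [hψ, timeDeriv_add hφ (by fun_prop), timeDeriv_const_mul _ hbC, timeDeriv_bump]; ring
  have e2 : spaceDeriv2 ψ p = spaceDeriv2 φ p := by
    rw [hψ, spaceDeriv2_add hφ (by fun_prop), spaceDeriv2_const_mul _ hbC, spaceDeriv2_bump]; ring
  have e3 : ψ p = φ p := by simp [hψ, bump_self]
  rw [← e1, ← e2] at hneg
  have n1 : ∀ᶠ z : ℝ × ℝ in 𝓝 p, G z.2 (timeDeriv ψ z) (spaceDeriv2 ψ z) < 0 := by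
    have hc : Continuous fun z : ℝ × ℝ => (z.2, timeDeriv ψ z, spaceDeriv2 ψ z) :=
      continuous_snd.prodMk ((continuous_timeDeriv hψC).prodMk (continuous_spaceDeriv2 hψC))
    exact (hc.tendsto p).eventually (hG _ _ _ hneg)
  obtain ⟨η, hη0, n2⟩ : ∃ η > 0, ∀ᶠ z : ℝ × ℝ in 𝓝 p,
      z.1 < T ∨ V - ψ p + ψ z + η < h z.2 := by
    rcases hor with h1 | h1
    · exact ⟨1, one_pos, (ContinuousAt.eventually_lt continuousAt_fst continuousAt_const h1).mono
        fun z hz => Or.inl hz⟩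
    · refine ⟨(h p.2 - V) / 2, by linarith, Eventually.mono ?_ fun z hz => Or.inr hz⟩
      have := hψC.continuous
      refine ContinuousAt.eventually_lt (by fun_prop) (by fun_prop) ?_
      linarith
  have n3 := eventually_nhdsWithin_iff.1 hmin
  obtain ⟨r, hr0, hr1, hbox⟩ := exists_closedBox (n1.and (n2.and n3))
  set m := min η ((r / 2) ^ 4) with hm
  have hm0 : 0 < m := by positivity
  -- The raise `m / 2` lifts `ψ` above `V` at `p`. Outside the half box the penalty is at least `(r
  -- / 2) ^ 4 ≥ m`, so there the raised function stays below the Perron function and the gluing is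
  -- clean.
  set a := V - ψ p + m / 2 with ha
  set χ : ℝ × ℝ → ℝ := fun z => ψ z + a with hχ
  have hχC : ContDiff ℝ 2 χ := hψC.add contDiff_const
  have f1 : ∀ z, timeDeriv χ z = timeDeriv ψ z := fun z => by
    unfold timeDeriv; simp only [hχ]; rw [deriv_add_const]
  have f2 : ∀ z, spaceDeriv2 χ z = spaceDeriv2 ψ z := fun z => by
    rw [hχ, spaceDeriv2_add hψC contDiff_const]
    simp [spaceDeriv2, iteratedDeriv_const]
  have hUc : openBox p r ⊆ closedBox p r := openBox_subset_closedBox p r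
  classical
  have hnew := hsub.max_local hχC (U := openBox p r) (K := closedBox p (r / 2))
    (isOpen_openBox p r) (isCompact_closedBox p _).isClosed (by
      intro z hzS hzU hzK
      have h1 := (hbox z (hUc hzU)).2.2 hzS
      have h2 := pow_le_bump (p := p) (z := z) (by linarith : 0 < r / 2) (by linarith)
        (fun h3 => hzK (openBox_subset_closedBox p _ h3))
      have h3 := lscEnvelope_le hg hzS
      have h4 : m ≤ (r / 2) ^ 4 := min_le_right _ _
      have h1 : V - φ p ≤ lscEnvelope T v z - φ z := h1
      simp only [hχ, ha, hψ, bump_self]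
      linarith)
    (by
      intro z hzS hzU q M hq hM
      rw [f1] at hq
      rw [f2] at hM
      exact (hGm _ _ _ _ _ (hbox z (hUc hzU)).1 hq hM).le)
    (by
      intro z hzS hzU hzT
      have h4 : m ≤ η := min_le_left _ _
      rcases (hbox z (hUc hzU)).2.1 with h1 | h1
      · exact absurd hzT h1.ne
      · simp only [hχ, ha]
        linarith)
    (closedBox_subset_openBox p (by linarith))
  obtain ⟨M, hM⟩ := (isCompact_closedBox p r).exists_bound_of_continuousOn
    hχC.continuous.continuousOn
  have hnewg : HasLinearGrowth T fun z => if z ∈ openBox p r then max (v z) (χ z) else v z := by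
    refine hg.of_eq_or (M := M) fun z => ?_
    by_cases hz : z ∈ openBox p r
    · rcases le_total (χ z) (v z) with h1 | h1
      · left; simp [hz, h1]
      · right; simp only [if_pos hz, max_eq_right h1]; exact hM z (hUc hz)
    · left; simp [hz]
  have hball : ∀ᶠ z in 𝓝 p, z ∈ openBox p r :=
    (isOpen_openBox p r).mem_nhds (self_mem_openBox p hr0)
  have n4 : ∀ᶠ z in 𝓝 p, ψ p - m / 8 < ψ z := by
    have := hψC.continuous
    exact ContinuousAt.eventually_lt (by fun_prop) (by fun_prop) (by linarith)
  obtain ⟨z, hz, hzb, hz4, hzS⟩ := ((frequently_lt_of_lscEnvelope_lt hg hp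
    (show lscEnvelope T v p < V + m / 8 by linarith)).and_eventually
    ((hball.filter_mono nhdsWithin_le_nhds).and
      ((n4.filter_mono nhdsWithin_le_nhds).and self_mem_nhdsWithin))).exists
  have h1 := le_perron hb ⟨hnew, hnewg⟩ hzS
  rw [if_pos hzb, ← hvdef] at h1
  have h2 := (le_max_right _ _).trans h1
  simp only [hχ, ha] at h2
  linarith

theorem isViscositySupersolution_lscEnvelope_perron
    (hG : ∀ x q M, G x q M < 0 → ∀ᶠ z : ℝ × ℝ × ℝ in 𝓝 (x, q, M), G z.1 z.2.1 z.2.2 < 0)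
    (hGm : ∀ x q M q' M', G x q M < 0 → q ≤ q' → M ≤ M' → G x q' M' < 0)
    (hh : Continuous h) {b : ℝ × ℝ → ℝ}
    (hb : ∀ u ∈ subsolutions T G h, ∀ p ∈ strip T, u p ≤ b p)
    (hmem : perron T G h ∈ subsolutions T G h) :
    IsViscositySupersolution T G h (lscEnvelope T (perron T G h)) where
  lsc := lowerSemicontinuousOn_lscEnvelope hmem.2
  interior φ hφ p hp hpT hmin := by
    by_contra! hcon
    exact lscEnvelope_perron_contradiction hG hGm hh hb hmem hφ hp hmin hcon (Or.inl hpT)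
  terminal φ hφ p hp hpT hmin := by
    by_contra! hcon
    rw [max_lt_iff] at hcon
    have h2 : lscEnvelope T (perron T G h) p - h p.2 < 0 := by exact_mod_cast hcon.2
    exact lscEnvelope_perron_contradiction hG hGm hh hb hmem hφ hp hmin hcon.1
      (Or.inr (by linarith))

end

/-! ### Existence and uniqueness of continuous solutions -/

section
variable {T : ℝ} {f σ γ h : ℝ → ℝ} {c B ι L : ℝ} {D : ℝ → Set ℝ}

/-- A bound of the solutions in terms of the growth of the terminal value. -/
noncomputable def growthBound (c B ι T C : ℝ) : ℝ := C * (1 + (C / ι + 1)) + driftBound c B ι * T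

/-- Comparison of a subsolution with a continuous supersolution. -/
theorem IsViscositySubsolution.le_of_continuousOn (hb : CoeffBounds f σ γ c B ι)
    (hD : IsLipschitzFamily D L) (hT : 0 < T) (hh : Continuous h) {u v : ℝ × ℝ → ℝ}
    (hu : IsViscositySubsolution T (infOperator f σ γ D) h u) (hgu : HasLinearGrowth T u)
    (hv : IsViscositySupersolution T (infOperator f σ γ D) h v) (hg : HasLinearGrowth T v)
    (hc : ContinuousOn v (strip T)) {p : ℝ × ℝ} (hp : p ∈ strip T) : u p ≤ v p := by
  rw [← extendSuper_eqOn hT hc (driftBound c B ι) hp]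
  exact hu.le_extendSuper hb hD hT hh hgu hv hg hp

theorem hasLinearGrowth_affine {k : ℝ → ℝ} {C : ℝ} (hk : ∀ x, |k x| ≤ C * (1 + |x|)) (A : ℝ) :
    HasLinearGrowth T fun z => k z.2 + A * (T - z.1) := by
  refine ⟨C + |A| * |T|, fun p hp => ?_⟩
  have h1 : |A * (T - p.1)| ≤ |A| * |T| := by
    rw [abs_mul]
    refine mul_le_mul_of_nonneg_left ?_ (abs_nonneg _)
    rw [abs_of_nonneg (by linarith [hp.1.2])]
    have := le_abs_self T
    linarith [hp.1.1]
  have h2 : |A| * |T| ≤ |A| * |T| * (1 + |p.2|) :=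
    le_mul_of_one_le_right (by positivity) (by linarith [abs_nonneg p.2])
  have h3 := hk p.2
  have h4 := abs_add_le (k p.2) (A * (T - p.1))
  rw [add_mul]
  linarith

/-- Existence of a continuous solution, with a bound depending only on the growth of the
terminal value. -/
theorem CoeffBounds.exists_solution (hb : CoeffBounds f σ γ c B ι)
    (hD : IsLipschitzFamily D L) (hT : 0 < T) (hh : Continuous h) {C : ℝ}
    (hC : ∀ x, |h x| ≤ C * (1 + |x|)) : ∃ v, ContinuousOn v (strip T) ∧
      IsLinearGrowthSolution T (infOperator f σ γ D) h v ∧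
      ∀ p ∈ strip T, |v p| ≤ growthBound c B ι T C * (1 + |p.2|) := by
  have hC0 : 0 ≤ C := by
    have := (abs_nonneg _).trans (hC 0)
    simpa using this
  have hι := hb.iota_pos
  have hΛ := hb.driftBound_nonneg
  set Λ := driftBound c B ι with hΛdef
  -- Chosen so that the second derivative of the hyperbola, at most `C / R`, is below `ι` and hence
  -- below `γ` at every base point.
  set R := C / ι + 1 with hR
  have hR0 : 0 < R := by positivity
  have hCR : C / R ≤ ι := by
    rw [div_le_iff₀ hR0, hR, mul_add, mul_div_cancel₀ _ hι.ne']
    linarith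
  set S : ℝ × ℝ → ℝ := fun z => hyperbola C R z.2 + Λ * (T - z.1) with hS
  have hkc := contDiff_hyperbola C hR0
  have hsuper : IsViscositySupersolution T (infOperator f σ γ D) h S :=
    hb.isViscositySupersolution_barrier hkc.continuous
      (fun x => (le_abs_self _).trans ((hC x).trans (le_hyperbola hC0 R x)))
      (fun ψ hψ x hmin x' hx' => by
        have h1 := iteratedDeriv_two_nonpos_of_isLocalMin (c := fun _ => 0) (x := x)
          (ψ := fun y => ψ y + -1 * hyperbola C R y) (by simp) (by fun_prop) (by
            filter_upwards [hmin] with y hy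
            linarith)
        rw [iteratedDeriv_two_add hψ (by fun_prop), iteratedDeriv_two_const_mul _ hkc] at h1
        have h2 := iteratedDeriv_two_hyperbola_le hC0 hR0 x
        have h3 := hb.iota_le x'
        linarith)
  have hkb : ∀ x, |hyperbola C R x| ≤ C * (1 + R) * (1 + |x|) := fun x => by
    rw [abs_of_nonneg ((by positivity : 0 ≤ C * (1 + |x|)).trans (le_hyperbola hC0 R x))]
    exact hyperbola_le hC0 hR0.le x
  have hSg : HasLinearGrowth T S := hasLinearGrowth_affine hkb Λ
  have hSc : ContinuousOn S (strip T) := by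
    have := hkc.continuous
    fun_prop
  set G := infOperator f σ γ D with hGdef
  have hbd : ∀ u ∈ subsolutions T G h, ∀ p ∈ strip T, u p ≤ S p := fun u hu p hp =>
    hu.1.le_of_continuousOn hb hD hT hh hu.2 hsuper hSg hSc hp
  have hbar : (fun z : ℝ × ℝ => h z.2 - Λ * (T - z.1)) ∈ subsolutions T G h := by
    refine ⟨hb.isViscositySubsolution_barrier hD hh, ?_⟩
    obtain ⟨N, hN⟩ := hasLinearGrowth_affine (T := T) hC (-Λ)
    exact ⟨N, fun p hp => by
      have := hN p hp
      simp only [neg_mul, ← sub_eq_add_neg] at this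
      exact this⟩
  set v := perron T G h with hv
  have hlow : ∀ p ∈ strip T, h p.2 - Λ * (T - p.1) ≤ v p := fun p hp => le_perron hbd hbar hp
  have hup : ∀ p ∈ strip T, v p ≤ S p := fun p hp =>
    csSup_le (Set.Nonempty.image _ ⟨_, hbar⟩) (by rintro _ ⟨u, hu, rfl⟩; exact hbd u hu p hp)
  have hvb : ∀ p ∈ strip T, |v p| ≤ growthBound c B ι T C * (1 + |p.2|) := by
    intro p hp
    have h1 := hlow p hp
    have h2 := hup p hp
    have h3 := (abs_le.1 (hC p.2)).1
    have h4 := (abs_le.1 (hkb p.2)).2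
    have h5 : Λ * (T - p.1) ≤ Λ * T := mul_le_mul_of_nonneg_left (by linarith [hp.1.1]) hΛ
    have h6 : Λ * T ≤ Λ * T * (1 + |p.2|) :=
      le_mul_of_one_le_right (by positivity) (by linarith [abs_nonneg p.2])
    have h7 : C * (1 + |p.2|) ≤ C * (1 + R) * (1 + |p.2|) :=
      mul_le_mul_of_nonneg_right (le_mul_of_one_le_right hC0 (by linarith))
        (by linarith [abs_nonneg p.2])
    have h8 : growthBound c B ι T C * (1 + |p.2|) =
      C * (1 + R) * (1 + |p.2|) + Λ * T * (1 + |p.2|) := by rw [growthBound]; ring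
    simp only [hS] at h2
    rw [h8]
    exact abs_le.2 ⟨by linarith, by linarith⟩
  have hvg : HasLinearGrowth T v := ⟨_, hvb⟩
  have hmem := perron_mem_subsolutions (fun x q M => hb.eventually_infOperator_pos hD) hh hbd
    ⟨_, hbar⟩ hvg
  have hsup := isViscositySupersolution_lscEnvelope_perron
    (fun x q M => hb.eventually_infOperator_neg hD)
    (fun x q M q' M' => hb.infOperator_neg_mono) hh hbd hmem
  have hle : ∀ p ∈ strip T, v p ≤ extendSuper T Λ (lscEnvelope T v) p := fun p hp =>
    hmem.1.le_extendSuper hb hD hT hh hvg hsup hvg.lscEnvelope hp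
  -- Before `T` this is trivial, and at `T` it is upper semicontinuity of `v`. With `hle` it
  -- identifies the upper semicontinuous `v` with a lower semicontinuous function, which gives
  -- continuity up to `T`.
  have hge : ∀ p ∈ strip T, extendSuper T Λ (lscEnvelope T v) p ≤ v p := by
    intro p hp
    rcases lt_or_eq_of_le hp.1.2 with hpT | hpT
    · rw [extendSuper_of_lt hpT]
      exact lscEnvelope_le hvg hp
    · rw [extendSuper_of_ge hpT.ge, hpT, sub_self, mul_zero, sub_zero]
      refine le_of_forall_pos_le_add fun ε hε => ?_
      have hp' : p = (T, p.2) := by rw [← hpT]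
      have h1 : ∀ᶠ z in 𝓝[strip T] p, v z < v p + ε := hmem.1.usc p hp _ (by linarith)
      refine terminalLimit_le hvg.lscEnvelope hT ?_
      rw [← hp']
      filter_upwards [nhdsWithin_mono _ (openStrip_subset_strip T) h1, self_mem_nhdsWithin]
        with z hz hzS
      exact (lscEnvelope_le hvg (openStrip_subset_strip T hzS)).trans hz.le
  have heq : EqOn v (extendSuper T Λ (lscEnvelope T v)) (strip T) := fun p hp =>
    le_antisymm (hle p hp) (hge p hp)
  have hls := (lowerSemicontinuousOn_extendSuper hvg.lscEnvelope hT hsup.lsc Λ).mono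
    (fun z hz => ⟨hz.1.1, mem_univ _⟩ : strip T ⊆ Ici 0 ×ˢ univ)
  have hcont : ContinuousOn v (strip T) := by
    refine continuousOn_iff_lower_upperSemicontinuousOn.2 ⟨fun p hp a ha => ?_, hmem.1.usc⟩
    change a < v p at ha
    rw [heq hp] at ha
    filter_upwards [hls p hp a ha, self_mem_nhdsWithin] with z hz hzS
    change a < v z
    rw [heq hzS]
    exact hz
  exact ⟨v, hcont, ⟨hvg, hmem.1.congr fun p hp => (uscEnvelope_eqOn hcont hp).symm, hsup⟩, hvb⟩

/-- Uniqueness among continuous solutions. -/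
theorem IsLinearGrowthSolution.eqOn_of_continuousOn (hb : CoeffBounds f σ γ c B ι)
    (hD : IsLipschitzFamily D L) (hT : 0 < T) (hh : Continuous h) {u v : ℝ × ℝ → ℝ}
    (hu : IsLinearGrowthSolution T (infOperator f σ γ D) h u) (huc : ContinuousOn u (strip T))
    (hv : IsLinearGrowthSolution T (infOperator f σ γ D) h v) (hvc : ContinuousOn v (strip T)) :
    EqOn u v (strip T) := fun _ hp => le_antisymm
  ((hu.sub_self huc).le_of_continuousOn hb hD hT hh hu.growth (hv.super_self hvc) hv.growth hvc hp)
  ((hv.sub_self hvc).le_of_continuousOn hb hD hT hh hv.growth (hu.super_self huc) hu.growth huc hp)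

end

end GammaPricing

namespace GammaPricing

/-! ### Semiconcave functions of one variable -/

theorem concaveOn_of_forall {S : Set (ℝ → ℝ)} {F : ℝ → ℝ} (hS : ∀ φ ∈ S, ConcaveOn ℝ univ φ)
    (hle : ∀ φ ∈ S, ∀ x, F x ≤ φ x) (hinf : ∀ x a, (∀ φ ∈ S, a ≤ φ x) → a ≤ F x) :
    ConcaveOn ℝ univ F := by
  refine ⟨convex_univ, fun a _ b _ μ ν hμ hν hμν => hinf _ _ fun φ hφ => ?_⟩
  refine le_trans ?_ ((hS φ hφ).2 (mem_univ a) (mem_univ b) hμ hν hμν)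
  simp only [smul_eq_mul]
  exact add_le_add (mul_le_mul_of_nonneg_left (hle φ hφ a) hμ)
    (mul_le_mul_of_nonneg_left (hle φ hφ b) hν)

theorem concaveOn_concaveEnvelope (h : ℝ → ℝ) : ConcaveOn ℝ univ (concaveEnvelope h) := by
  by_cases hne : ∃ φ : ℝ → ℝ, ConcaveOn ℝ univ φ ∧ ∀ z, h z ≤ φ z
  · obtain ⟨φ₀, hφ₀, hφ₀h⟩ := hne
    refine concaveOn_of_forall (S := {φ | ConcaveOn ℝ univ φ ∧ ∀ z, h z ≤ φ z})
      (fun φ hφ => hφ.1) (fun φ hφ x => ?_) fun x a ha => ?_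
    · refine csInf_le ⟨h x, ?_⟩ ⟨φ, hφ.1, hφ.2, rfl⟩
      rintro _ ⟨ψ, _, hψ, rfl⟩
      exact hψ x
    · refine le_csInf ⟨_, φ₀, hφ₀, hφ₀h, rfl⟩ ?_
      rintro _ ⟨ψ, hψ, hψh, rfl⟩
      exact ha ψ ⟨hψ, hψh⟩
  -- Without a concave majorant the infimum runs over the empty set and is `0` by convention, which
  -- is still concave.
  · have h0 : concaveEnvelope h = fun _ => 0 := by
      funext x
      unfold concaveEnvelope
      convert Real.sInf_empty
      refine eq_empty_of_forall_notMem ?_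
      rintro _ ⟨φ, h1, h2, _⟩
      exact hne ⟨φ, h1, h2⟩
    rw [h0]
    exact concaveOn_const 0 convex_univ

theorem concaveOn_faceLift_sub (Γ g : ℝ → ℝ) :
    ConcaveOn ℝ univ fun x => faceLift Γ g x - Γ x := by
  simpa [faceLift] using concaveOn_concaveEnvelope fun z => g z - Γ z

theorem ConcaveOn.exists_supergradient {e : ℝ → ℝ} (he : ConcaveOn ℝ univ e) (x : ℝ) :
    ∃ s, ∀ z, e z ≤ e x + s * (z - x) := by
  have hx : x ∈ interior (univ : Set ℝ) := by simp
  have hc := he.neg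
  refine ⟨-derivWithin (-e) (Ioi x) x, fun z => ?_⟩
  rcases lt_trichotomy z x with h | h | h
  · have h1 := hc.slope_le_leftDeriv_of_mem_interior (mem_univ z) hx h
    have h2 := h1.trans (hc.leftDeriv_le_rightDeriv_of_mem_interior hx)
    rw [slope_def_field, div_le_iff₀ (by linarith), Pi.neg_apply, Pi.neg_apply] at h2
    linarith
  · rw [h]; simp
  · have h1 := hc.rightDeriv_le_slope_of_mem_interior hx (mem_univ z) h
    rw [slope_def_field, le_div_iff₀ (by linarith), Pi.neg_apply, Pi.neg_apply] at h1
    linarith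

/-- Splitting the interval into `n` equal steps divides the total quadratic error by `n`, so only
the linear term remains, with its sharp constant. -/
theorem abs_sub_le_of_quadratic {k : ℝ → ℝ} {L Q : ℝ}
    (h : ∀ x z, k z ≤ k x + L * |z - x| + Q * (z - x) ^ 2) (x z : ℝ) :
    |k z - k x| ≤ L * |z - x| := by
  have key : ∀ x z, k z ≤ k x + L * |z - x| := by
    intro x z
    refine le_of_forall_pos_le_add fun ε hε => ?_
    obtain ⟨n, hn⟩ := exists_nat_gt (|Q| * (z - x) ^ 2 / ε)
    have hn0 : (0 : ℝ) < n := lt_of_le_of_lt (by positivity) hn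
    rw [div_lt_iff₀ hε] at hn
    set d := (z - x) / n with hd
    have hi : ∀ i : ℕ, k (x + i * d) ≤ k x + i * (L * |d| + Q * d ^ 2) := by
      intro i
      induction i with
      | zero => simp
      | succ i ih =>
        have := h (x + i * d) (x + (i + 1 : ℕ) * d)
        have e : x + (i + 1 : ℕ) * d - (x + i * d) = d := by push_cast; ring
        rw [e] at this
        push_cast at this ⊢
        linarith
    have h1 := hi n
    have e1 : x + n * d = z := by rw [hd]; field_simp; ring
    have e2 : n * (L * |d|) = L * |z - x| := by
      rw [hd, abs_div, abs_of_pos hn0]; field_simp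
    have e3 : n * (Q * d ^ 2) ≤ ε := by
      rw [hd]
      have : n * (Q * ((z - x) / n) ^ 2) = Q * (z - x) ^ 2 / n := by field_simp
      rw [this, div_le_iff₀ hn0]
      have := mul_le_mul_of_nonneg_right (le_abs_self Q) (sq_nonneg (z - x))
      linarith
    rw [e1] at h1
    linarith
  have h1 := key x z
  have h2 := key z x
  rw [abs_sub_comm x z] at h2
  exact abs_le.2 ⟨by linarith, by linarith⟩

section
variable {γ Γ : ℝ → ℝ}

theorem IsSecondPrimitive.hasDerivAt (hΓ : IsSecondPrimitive γ Γ) (x : ℝ) :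
    HasDerivAt Γ (deriv Γ x) x :=
  (hΓ.1.differentiable (by norm_num) x).hasDerivAt

theorem IsSecondPrimitive.hasDerivAt_deriv (hΓ : IsSecondPrimitive γ Γ) (x : ℝ) :
    HasDerivAt (deriv Γ) (γ x) x := by
  have h1 := hΓ.1.differentiable_iteratedDeriv 1 (by norm_num)
  rw [iteratedDeriv_one] at h1
  have h2 := hΓ.2 x
  rw [iteratedDeriv_succ, iteratedDeriv_one] at h2
  rw [← h2]
  exact (h1 x).hasDerivAt

theorem IsSecondPrimitive.continuous_deriv (hΓ : IsSecondPrimitive γ Γ) : Continuous (deriv Γ) :=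
  continuous_iff_continuousAt.2 fun x => (hΓ.hasDerivAt_deriv x).continuousAt

/-- Two second primitives differ by an affine function. -/
theorem IsSecondPrimitive.concaveOn_sub {Γ' : ℝ → ℝ} (hΓ : IsSecondPrimitive γ Γ)
    (hΓ' : IsSecondPrimitive γ Γ') {k : ℝ → ℝ} (hk : ConcaveOn ℝ univ fun x => k x - Γ x) :
    ConcaveOn ℝ univ fun x => k x - Γ' x := by
  have hd : ∀ x, HasDerivAt (fun x => Γ x - Γ' x) (deriv Γ x - deriv Γ' x) x := fun x =>
    (hΓ.hasDerivAt x).fun_sub (hΓ'.hasDerivAt x)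
  have hd2 : ∀ x, HasDerivAt (fun x => deriv Γ x - deriv Γ' x) 0 x := fun x =>
    ((hΓ.hasDerivAt_deriv x).fun_sub (hΓ'.hasDerivAt_deriv x)).congr_deriv (sub_self _)
  have h1 : ConcaveOn ℝ univ fun x => Γ x - Γ' x := by
    refine Antitone.concaveOn_univ_of_deriv (fun x => (hd x).differentiableAt) fun x y _ => ?_
    rw [(hd x).deriv, (hd y).deriv]
    exact (is_const_of_deriv_eq_zero (fun x => (hd2 x).differentiableAt)
      (fun x => (hd2 x).deriv) x y).ge
  refine (hk.add h1).congr fun x _ => ?_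
  simp

theorem IsSecondPrimitive.le_deriv_sub (hΓ : IsSecondPrimitive γ Γ) {ι : ℝ} (hι : ∀ x, ι ≤ γ x)
    {x y : ℝ} (hxy : x ≤ y) : ι * (y - x) ≤ deriv Γ y - deriv Γ x := by
  have hd : ∀ x, HasDerivAt (fun x => deriv Γ x - ι * x) (γ x - ι) x := fun x =>
    ((hΓ.hasDerivAt_deriv x).fun_sub ((hasDerivAt_id x).const_mul ι)).congr_deriv (by simp)
  have := monotone_of_deriv_nonneg (fun x => (hd x).differentiableAt)
    (fun x => by rw [(hd x).deriv]; linarith [hι x]) hxy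
  simp only at this
  linarith

theorem IsSecondPrimitive.abs_deriv_sub_le (hΓ : IsSecondPrimitive γ Γ) {Q : ℝ}
    (hQ : ∀ x, |γ x| ≤ Q) (x y : ℝ) : |deriv Γ y - deriv Γ x| ≤ Q * |y - x| :=
  convex_univ.norm_image_sub_le_of_norm_hasDerivWithin_le
    (fun x _ => (hΓ.hasDerivAt_deriv x).hasDerivWithinAt) (fun x _ => hQ x) (mem_univ x)
    (mem_univ y)

theorem IsSecondPrimitive.abs_taylor_le (hΓ : IsSecondPrimitive γ Γ) {Q : ℝ}
    (hQ : ∀ x, |γ x| ≤ Q) (x z : ℝ) : |Γ z - Γ x - deriv Γ x * (z - x)| ≤ Q * (z - x) ^ 2 := by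
  have hd : ∀ w, HasDerivAt (fun w => Γ w - deriv Γ x * w) (deriv Γ w - deriv Γ x) w := fun w =>
    ((hΓ.hasDerivAt w).fun_sub ((hasDerivAt_id w).const_mul _)).congr_deriv (by simp)
  have hQ0 : 0 ≤ Q := (abs_nonneg _).trans (hQ 0)
  have := (convex_closedBall x |z - x|).norm_image_sub_le_of_norm_hasDerivWithin_le
    (f := fun w => Γ w - deriv Γ x * w) (C := Q * |z - x|)
    (fun w _ => (hd w).hasDerivWithinAt) (fun w hw => by
      refine (hΓ.abs_deriv_sub_le hQ x w).trans (mul_le_mul_of_nonneg_left ?_ hQ0)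
      rwa [mem_closedBall_iff_norm] at hw)
    (Metric.mem_closedBall_self (abs_nonneg _))
    (by rw [mem_closedBall_iff_norm, Real.norm_eq_abs] : z ∈ Metric.closedBall x |z - x|)
  rw [Real.norm_eq_abs, Real.norm_eq_abs, mul_assoc, ← sq, sq_abs] at this
  convert this using 2
  ring

/-- A uniformly continuous function whose second derivative is bounded above is Lipschitz, and
has bounded slopes. -/
theorem exists_lipschitz_of_concaveOn_sub (hΓ : IsSecondPrimitive γ Γ) {Q : ℝ}
    (hQ : ∀ x, |γ x| ≤ Q) {k : ℝ → ℝ} (hk : UniformContinuous k)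
    (hc : ConcaveOn ℝ univ fun x => k x - Γ x) : ∃ L, 1 ≤ L ∧ (∀ x z, |k z - k x| ≤ L * |z - x|) ∧
      ∀ x, ∃ s, |s + deriv Γ x| ≤ L ∧ ∀ z, k z - Γ z ≤ k x - Γ x + s * (z - x) := by
  obtain ⟨δ', hδ', hu⟩ := Metric.uniformContinuous_iff.1 hk 1 one_pos
  set δ := δ' / 2 with hδ
  have hδ0 : 0 < δ := by positivity
  have hu : ∀ x y, |x - y| ≤ δ → |k x - k y| ≤ 1 := fun x y h =>
    (hu (by rw [Real.dist_eq]; linarith)).le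
  have hQ0 : 0 ≤ Q := (abs_nonneg _).trans (hQ 0)
  -- Testing the supergradient at `x ± δ`: the oscillation of `k` contributes `1 / δ` and the Taylor
  -- remainder of `Γ` contributes `Q * δ`. The last `1` only ensures `1 ≤ L`.
  set L := 1 / δ + Q * δ + 1 with hL
  have hL1 : 1 ≤ L := by
    have : 0 ≤ 1 / δ + Q * δ := by positivity
    linarith
  have hs : ∀ x, ∃ s, |s + deriv Γ x| ≤ L ∧ ∀ z, k z - Γ z ≤ k x - Γ x + s * (z - x) := by
    intro x
    obtain ⟨s, hs⟩ := ConcaveOn.exists_supergradient hc x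
    refine ⟨s, ?_, hs⟩
    have h1 := hs (x + δ)
    have h2 := hs (x - δ)
    have t1 := abs_le.1 (hΓ.abs_taylor_le hQ x (x + δ))
    have t2 := abs_le.1 (hΓ.abs_taylor_le hQ x (x - δ))
    have u1 := abs_le.1 (hu (x + δ) x (by simp [abs_of_pos hδ0]))
    have u2 := abs_le.1 (hu (x - δ) x (by simp [abs_of_pos hδ0]))
    have e1 : x + δ - x = δ := by ring
    have e2 : x - δ - x = -δ := by ring
    rw [e1] at h1 t1
    rw [e2] at h2 t2
    have e3 : (1 / δ + Q * δ) * δ = 1 + Q * δ ^ 2 := by field_simp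
    have hL2 : 1 / δ + Q * δ ≤ L := by linarith
    refine (abs_le.2 ⟨?_, ?_⟩ : _ ≤ 1 / δ + Q * δ).trans hL2
    · refine le_of_mul_le_mul_right ?_ hδ0
      rw [neg_mul, e3]
      linarith
    · refine le_of_mul_le_mul_right ?_ hδ0
      rw [e3]
      linarith
  refine ⟨L, hL1, abs_sub_le_of_quadratic (Q := Q) fun x z => ?_, hs⟩
  obtain ⟨s, h1, h2⟩ := hs x
  have h3 := h2 z
  have h4 := (abs_le.1 (hΓ.abs_taylor_le hQ x z)).2
  have h5 : (s + deriv Γ x) * (z - x) ≤ L * |z - x| :=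
    (le_abs_self _).trans (by rw [abs_mul]; exact mul_le_mul_of_nonneg_right h1 (abs_nonneg _))
  linarith

/-! ### Majorants with bounded slopes -/

/-- Truncation to `[-L, L]`. -/
noncomputable def clamp (L x : ℝ) : ℝ := max (-L) (min L x)

theorem continuous_clamp (L : ℝ) : Continuous (clamp L) := by
  unfold clamp
  fun_prop

theorem clamp_of_abs_le {L x : ℝ} (h : |x| ≤ L) : clamp L x = x := by
  have := abs_le.1 h
  rw [clamp, min_eq_right this.2, max_eq_right this.1]

theorem clamp_of_ge {L x : ℝ} (hL : 0 ≤ L) (h : L ≤ x) : clamp L x = L := by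
  rw [clamp, min_eq_left h, max_eq_right (by linarith)]

theorem clamp_of_le {L x : ℝ} (hL : 0 ≤ L) (h : x ≤ -L) : clamp L x = -L := by
  rw [clamp, min_eq_right (by linarith), max_eq_left h]

theorem abs_clamp_le {L : ℝ} (hL : 0 ≤ L) (x : ℝ) : |clamp L x| ≤ L :=
  abs_le.2 ⟨le_max_left _ _, max_le (by linarith) (min_le_left _ _)⟩

theorem clamp_sub_antitone (L : ℝ) : Antitone fun x => clamp L x - x := by
  intro x y h
  have h1 : min L y ≤ min L x + (y - x) := by
    rcases le_total L x with h2 | h2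
    · rw [min_eq_left h2]; exact (min_le_left _ _).trans (by linarith)
    · rw [min_eq_right h2]; exact (min_le_right _ _).trans (by linarith)
  have h2 : clamp L y ≤ clamp L x + (y - x) := by
    refine max_le ?_ (h1.trans ?_)
    · have : -L ≤ clamp L x := le_max_left _ _
      linarith
    · have : min L x ≤ clamp L x := le_max_right _ _
      linarith
  simp only
  linarith

/-- The function that vanishes at `z` and has derivative `s + Γ'`, truncated to `[-L, L]`. -/
noncomputable def ramp (Γ : ℝ → ℝ) (L s z x : ℝ) : ℝ := ∫ t in z..x, clamp L (s + deriv Γ t)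

theorem IsSecondPrimitive.continuous_clamp (hΓ : IsSecondPrimitive γ Γ) (L s : ℝ) :
    Continuous fun t => clamp L (s + deriv Γ t) :=
  (GammaPricing.continuous_clamp L).comp (continuous_const.add hΓ.continuous_deriv)

theorem IsSecondPrimitive.hasDerivAt_ramp (hΓ : IsSecondPrimitive γ Γ) (L s z x : ℝ) :
    HasDerivAt (ramp Γ L s z) (clamp L (s + deriv Γ x)) x :=
  ((hΓ.continuous_clamp L s).integral_hasStrictDerivAt z x).hasDerivAt

theorem IsSecondPrimitive.ramp_add (hΓ : IsSecondPrimitive γ Γ) (L s z y x : ℝ) :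
    ramp Γ L s z x = ramp Γ L s z y + ∫ t in y..x, clamp L (s + deriv Γ t) :=
  (intervalIntegral.integral_add_adjacent_intervals
    ((hΓ.continuous_clamp L s).intervalIntegrable _ _)
    ((hΓ.continuous_clamp L s).intervalIntegrable _ _)).symm

theorem IsSecondPrimitive.abs_ramp_sub_le (hΓ : IsSecondPrimitive γ Γ) {L : ℝ} (hL : 0 ≤ L)
    (s z x y : ℝ) : |ramp Γ L s z y - ramp Γ L s z x| ≤ L * |y - x| :=
  convex_univ.norm_image_sub_le_of_norm_hasDerivWithin_le
    (fun x _ => (hΓ.hasDerivAt_ramp L s z x).hasDerivWithinAt) (fun _ _ => abs_clamp_le hL _)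
    (mem_univ x) (mem_univ y)

/-- Truncation is nondecreasing and expands no increment, so the truncated slope increases no faster
than `Γ'`, which itself increases because `γ` is positive. -/
theorem IsSecondPrimitive.concaveOn_ramp_sub (hΓ : IsSecondPrimitive γ Γ) {ι : ℝ} (hι0 : 0 ≤ ι)
    (hι : ∀ x, ι ≤ γ x) (L s z : ℝ) : ConcaveOn ℝ univ fun x => ramp Γ L s z x - Γ x := by
  have hd : ∀ x, HasDerivAt (fun x => ramp Γ L s z x - Γ x)
      (clamp L (s + deriv Γ x) - deriv Γ x) x := fun x =>
    (hΓ.hasDerivAt_ramp L s z x).fun_sub (hΓ.hasDerivAt x)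
  refine Antitone.concaveOn_univ_of_deriv (fun x => (hd x).differentiableAt) fun x y hxy => ?_
  rw [(hd x).deriv, (hd y).deriv]
  have h1 := hΓ.le_deriv_sub hι hxy
  have h2 : 0 ≤ ι * (y - x) := mul_nonneg hι0 (by linarith)
  have := clamp_sub_antitone L (show s + deriv Γ x ≤ s + deriv Γ y by linarith)
  simp only at this
  linarith

theorem IsSecondPrimitive.integral_clamp_eq (hΓ : IsSecondPrimitive γ Γ) {L s x y : ℝ}
    (h : ∀ t ∈ uIcc x y, |s + deriv Γ t| ≤ L) :
    ∫ t in x..y, clamp L (s + deriv Γ t) = s * (y - x) + (Γ y - Γ x) := by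
  rw [intervalIntegral.integral_congr (g := fun t => s + deriv Γ t)
    fun t ht => clamp_of_abs_le (h t ht)]
  have hd : ∀ t, HasDerivAt (fun t => s * t + Γ t) (s + deriv Γ t) t := fun t =>
    (((hasDerivAt_id t).const_mul s).fun_add (hΓ.hasDerivAt t)).congr_deriv (by simp)
  rw [intervalIntegral.integral_eq_sub_of_hasDerivAt (fun t _ => hd t)
    ((continuous_const.add hΓ.continuous_deriv).intervalIntegrable _ _)]
  ring

theorem integral_clamp_of_ge {L s x y : ℝ} (hL : 0 ≤ L) (h : ∀ t ∈ uIcc x y, L ≤ s + deriv Γ t) :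
    ∫ t in x..y, clamp L (s + deriv Γ t) = L * (y - x) := by
  rw [intervalIntegral.integral_congr (g := fun _ => L) fun t ht => clamp_of_ge hL (h t ht),
    intervalIntegral.integral_const, smul_eq_mul]
  ring

theorem integral_clamp_of_le {L s x y : ℝ} (hL : 0 ≤ L) (h : ∀ t ∈ uIcc x y, s + deriv Γ t ≤ -L) :
    ∫ t in x..y, clamp L (s + deriv Γ t) = -L * (y - x) := by
  rw [intervalIntegral.integral_congr (g := fun _ => -L) fun t ht => clamp_of_le hL (h t ht),
    intervalIntegral.integral_const, smul_eq_mul]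
  ring

theorem IsSecondPrimitive.monotone_deriv (hΓ : IsSecondPrimitive γ Γ) {ι : ℝ} (hι0 : 0 ≤ ι)
    (hι : ∀ x, ι ≤ γ x) : Monotone (deriv Γ) := fun x y hxy => by
  have h1 := hΓ.le_deriv_sub hι hxy
  have h2 : 0 ≤ ι * (y - x) := mul_nonneg hι0 (by linarith)
  linarith

/-- As long as the slope has not been truncated, the ramp is the supergradient bound at `z`. From
the point where it reaches `L` or `-L` on, the Lipschitz bound of `k` takes over. -/
theorem IsSecondPrimitive.le_add_ramp (hΓ : IsSecondPrimitive γ Γ) {ι : ℝ} (hι0 : 0 ≤ ι)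
    (hι : ∀ x, ι ≤ γ x) {k : ℝ → ℝ} {L s z : ℝ} (hk : ∀ x z, |k z - k x| ≤ L * |z - x|)
    (hL : 0 ≤ L) (hs : |s + deriv Γ z| ≤ L) (hsup : ∀ x, k x - Γ x ≤ k z - Γ z + s * (x - z))
    (x : ℝ) : k x ≤ k z + ramp Γ L s z x := by
  have hm := hΓ.monotone_deriv hι0 hι
  have hs' := abs_le.1 hs
  have hcont : Continuous fun t => s + deriv Γ t := continuous_const.add hΓ.continuous_deriv
  rcases le_total z x with hzx | hxz
  · have hin : ∀ y, z ≤ y → s + deriv Γ y ≤ L → ramp Γ L s z y = s * (y - z) + (Γ y - Γ z) := by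
      intro y hy hyL
      refine hΓ.integral_clamp_eq fun t ht => ?_
      rw [uIcc_of_le hy] at ht
      have h1 := hm ht.1
      have h2 := hm ht.2
      exact abs_le.2 ⟨by linarith, by linarith⟩
    rcases le_total (s + deriv Γ x) L with h | h
    · rw [hin x hzx h]
      linarith [hsup x]
    · obtain ⟨y, hy, hyL⟩ := intermediate_value_Icc hzx hcont.continuousOn
        (show L ∈ Icc (s + deriv Γ z) (s + deriv Γ x) from ⟨hs'.2, h⟩)
      simp only at hyL
      rw [hΓ.ramp_add L s z y x, hin y hy.1 hyL.le, integral_clamp_of_ge hL fun t ht => by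
        rw [uIcc_of_le hy.2] at ht
        linarith [hm ht.1]]
      have h1 := (abs_le.1 (hk y x)).2
      rw [abs_of_nonneg (by linarith [hy.2])] at h1
      linarith [hsup y]
  · have hin : ∀ y, y ≤ z → -L ≤ s + deriv Γ y → ramp Γ L s z y = s * (y - z) + (Γ y - Γ z) := by
      intro y hy hyL
      refine hΓ.integral_clamp_eq fun t ht => ?_
      rw [uIcc_of_ge hy] at ht
      have h1 := hm ht.1
      have h2 := hm ht.2
      exact abs_le.2 ⟨by linarith, by linarith⟩
    rcases le_total (-L) (s + deriv Γ x) with h | h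
    · rw [hin x hxz h]
      linarith [hsup x]
    · obtain ⟨y, hy, hyL⟩ := intermediate_value_Icc hxz hcont.continuousOn
        (show -L ∈ Icc (s + deriv Γ x) (s + deriv Γ z) from ⟨h, hs'.1⟩)
      simp only at hyL
      rw [hΓ.ramp_add L s z y x, hin y hy.2 hyL.ge, integral_clamp_of_le hL fun t ht => by
        rw [uIcc_of_ge hy.1] at ht
        linarith [hm ht.2]]
      have h1 := (abs_le.1 (hk y x)).2
      rw [abs_of_nonpos (by linarith [hy.1])] at h1
      linarith [hsup y]

/-- The untruncated slope grows at rate at least `ι` from a value at least `-L`, so it has reached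
`L` at distance `2 * L / ι`, uniformly in `z`. -/
theorem IsSecondPrimitive.ramp_right (hΓ : IsSecondPrimitive γ Γ) {ι : ℝ} (hι0 : 0 < ι)
    (hι : ∀ x, ι ≤ γ x) {L s z X x : ℝ} (hL : 0 ≤ L) (hs : |s + deriv Γ z| ≤ L)
    (hX : z + 2 * L / ι ≤ X) (hx : X ≤ x) :
    ramp Γ L s z x = ramp Γ L s z X + L * (x - X) := by
  have h0 : 0 ≤ 2 * L / ι := by positivity
  rw [hΓ.ramp_add L s z X x, integral_clamp_of_ge hL fun t ht => ?_]
  rw [uIcc_of_le hx] at ht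
  have h1 := hΓ.le_deriv_sub hι (show z ≤ t by linarith [ht.1])
  have h2 : ι * (2 * L / ι) ≤ ι * (t - z) := mul_le_mul_of_nonneg_left (by linarith [ht.1]) hι0.le
  rw [mul_div_cancel₀ _ hι0.ne'] at h2
  linarith [(abs_le.1 hs).1]

theorem IsSecondPrimitive.ramp_left (hΓ : IsSecondPrimitive γ Γ) {ι : ℝ} (hι0 : 0 < ι)
    (hι : ∀ x, ι ≤ γ x) {L s z X x : ℝ} (hL : 0 ≤ L) (hs : |s + deriv Γ z| ≤ L)
    (hX : X ≤ z - 2 * L / ι) (hx : x ≤ X) :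
    ramp Γ L s z x = ramp Γ L s z X + -L * (x - X) := by
  have h0 : 0 ≤ 2 * L / ι := by positivity
  rw [hΓ.ramp_add L s z X x, integral_clamp_of_le hL fun t ht => ?_]
  rw [uIcc_of_ge hx] at ht
  have h1 := hΓ.le_deriv_sub hι (show t ≤ z by linarith [ht.2])
  have h2 : ι * (2 * L / ι) ≤ ι * (z - t) := mul_le_mul_of_nonneg_left (by linarith [ht.2]) hι0.le
  rw [mul_div_cancel₀ _ hι0.ne'] at h2
  linarith [(abs_le.1 hs).2]

/-- A function with second derivative bounded above by `γ` can be modified outside `[-K, K]` into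
a larger one that is affine at infinity, with the same bounds on the derivatives. -/
theorem IsSecondPrimitive.exists_majorant (hΓ : IsSecondPrimitive γ Γ) {ι : ℝ} (hι0 : 0 < ι)
    (hι : ∀ x, ι ≤ γ x) {k : ℝ → ℝ} {L : ℝ} (hk : ∀ x z, |k z - k x| ≤ L * |z - x|)
    (hL : 0 ≤ L)
    (hs : ∀ x, ∃ s, |s + deriv Γ x| ≤ L ∧ ∀ z, k z - Γ z ≤ k x - Γ x + s * (z - x)) {K : ℝ}
    (hK : 0 < K) : ∃ m : ℝ → ℝ, (∀ x ∈ Icc (-K) K, m x = k x) ∧ (∀ x, k x ≤ m x) ∧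
      (∀ x z, |m z - m x| ≤ L * |z - x|) ∧ ConcaveOn ℝ univ (fun x => m x - Γ x) ∧
      (∀ x, K + 2 * L / ι ≤ x → m x = m (K + 2 * L / ι) + L * (x - (K + 2 * L / ι))) ∧
      ∀ x, x ≤ -(K + 2 * L / ι) →
        m x = m (-(K + 2 * L / ι)) + -L * (x - -(K + 2 * L / ι)) := by
  choose s hs1 hs2 using hs
  set q : ℝ → ℝ → ℝ := fun z x => k z + ramp Γ L (s z) z x with hq
  have hkq : ∀ z x, k x ≤ q z x := fun z x =>
    hΓ.le_add_ramp hι0.le hι hk hL (hs1 z) (hs2 z) x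
  -- Each `q z` lies above `k` and touches it at `z`, so restricting `z` to `[-K, K]` gives `m = k`
  -- there. Outside, all `q z` become affine at the same place with the same slope, and so does
  -- their infimum.
  set m : ℝ → ℝ := fun x => sInf ((fun z => q z x) '' Icc (-K) K) with hm
  have hne : (Icc (-K) K).Nonempty := ⟨0, by linarith, by linarith⟩
  have hle : ∀ z ∈ Icc (-K) K, ∀ x, m x ≤ q z x := fun z hz x =>
    csInf_le ⟨k x, by rintro _ ⟨w, _, rfl⟩; exact hkq w x⟩ ⟨z, hz, rfl⟩
  have hge : ∀ x a, (∀ z ∈ Icc (-K) K, a ≤ q z x) → a ≤ m x := fun x a ha =>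
    le_csInf (hne.image _) (by rintro _ ⟨z, hz, rfl⟩; exact ha z hz)
  have haff : ∀ X x A, (∀ z ∈ Icc (-K) K, q z x = q z X + A) → m x = m X + A := by
    intro X x A h
    refine le_antisymm ?_ (hge _ _ fun z hz => ?_)
    · rw [← sub_le_iff_le_add]
      refine hge _ _ fun z hz => ?_
      linarith [hle z hz x, h z hz]
    · linarith [hle z hz X, h z hz]
  have hlip : ∀ x y, m y ≤ m x + L * |y - x| := by
    intro x y
    rw [← sub_le_iff_le_add]
    refine hge _ _ fun z hz => ?_
    have h1 := (abs_le.1 (hΓ.abs_ramp_sub_le hL (s z) z x y)).2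
    have h2 := hle z hz y
    simp only [hq] at h2 ⊢
    linarith
  refine ⟨m, fun x hx => le_antisymm ?_ (hge _ _ fun z _ => hkq z x),
    fun x => hge _ _ fun z _ => hkq z x, fun x z => ?_, ?_, fun x hx => ?_, fun x hx => ?_⟩
  · refine (hle x hx x).trans_eq ?_
    simp [hq, ramp]
  · have h1 := hlip x z
    have h2 := hlip z x
    rw [abs_sub_comm x z] at h2
    exact abs_le.2 ⟨by linarith, by linarith⟩
  · refine concaveOn_of_forall (S := (fun z x => q z x - Γ x) '' Icc (-K) K) ?_ ?_ ?_
    · rintro _ ⟨z, _, rfl⟩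
      refine ((hΓ.concaveOn_ramp_sub hι0.le hι L (s z) z).add_const (k z)).congr fun x _ => ?_
      simp only [hq, Pi.add_apply]
      ring
    · rintro _ ⟨z, hz, rfl⟩ x
      linarith [hle z hz x]
    · intro x a ha
      rw [le_sub_iff_add_le]
      refine hge _ _ fun z hz => ?_
      have := ha _ ⟨z, hz, rfl⟩
      simp only at this
      linarith
  · refine haff _ _ _ fun z hz => ?_
    simp only [hq]
    rw [hΓ.ramp_right hι0 hι hL (hs1 z) (by linarith [hz.2]) hx]
    ring
  · refine haff _ _ _ fun z hz => ?_
    simp only [hq]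
    rw [hΓ.ramp_left hι0 hι hL (hs1 z) (by linarith [hz.1]) hx]
    ring

end

end GammaPricing

namespace GammaPricing

open MeasureTheory

/-! ### One-dimensional mollification -/

/-- The normalised bump is even, so its first moment vanishes and affine functions are reproduced
exactly. This is what makes the exact formula for the weights at infinity possible. -/
theorem mollify_eq_affine (ρ : ContDiffBump (0 : ℝ)) {m : ℝ → ℝ} {a b x : ℝ}
    (h : ∀ w, |w - x| < ρ.rOut → m w = a + b * w) : mollify ρ m x = a + b * x := by
  have h0 : ∫ ζ, ρ.normed volume ζ * ζ = 0 := by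
    have h1 := integral_neg_eq_self (fun ζ => ρ.normed volume ζ * ζ) volume
    simp only [ρ.normed_neg, mul_neg] at h1
    rw [integral_neg] at h1
    linarith
  rw [mollify_apply]
  have h1 : ∀ ζ, ρ.normed volume ζ * m (x - ζ) =
      ρ.normed volume ζ * (a + b * x) - b * (ρ.normed volume ζ * ζ) := by
    intro ζ
    by_cases hζ : ρ.normed volume ζ = 0
    · simp [hζ]
    · have h2 : ζ ∈ Metric.ball (0 : ℝ) ρ.rOut := by
        rw [← ρ.support_normed_eq (μ := volume)]; exact hζ
      rw [mem_ball_zero_iff, Real.norm_eq_abs] at h2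
      rw [h (x - ζ) (by rwa [sub_sub_cancel_left, abs_neg])]
      ring
  simp only [h1]
  rw [integral_sub (ρ.integrable_normed.mul_const _)
    ((integrable_normed_mul ρ (g := fun ζ => ζ) continuous_id).const_mul b), integral_mul_const, ρ.integral_normed,
    integral_const_mul, h0]
  ring

theorem mollify_sub_le (ρ : ContDiffBump (0 : ℝ)) {m : ℝ → ℝ} (hm : Continuous m) {x y A : ℝ}
    (h : ∀ ζ, m (x - ζ) ≤ m (y - ζ) + A) : mollify ρ m x ≤ mollify ρ m y + A := by
  rw [mollify_apply, mollify_apply]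
  have i : ∀ x, Integrable fun ζ => ρ.normed volume ζ * m (x - ζ) := fun x =>
    integrable_normed_mul ρ (by fun_prop)
  have e : A = ∫ ζ, ρ.normed volume ζ * A := by
    rw [integral_mul_const, ρ.integral_normed, one_mul]
  rw [e, ← integral_add (i y) (ρ.integrable_normed.mul_const A)]
  refine integral_mono (i x) ((i y).add (ρ.integrable_normed.mul_const A)) fun ζ => ?_
  have := mul_le_mul_of_nonneg_left (h ζ) (ρ.nonneg_normed (μ := volume) ζ)
  simp only
  linarith

theorem le_mollify (ρ : ContDiffBump (0 : ℝ)) {m : ℝ → ℝ} (hm : Continuous m) {A : ℝ}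
    (h : ∀ x, A ≤ m x) (x : ℝ) : A ≤ mollify ρ m x := by
  rw [mollify_apply]
  have e : A = ∫ ζ, ρ.normed volume ζ * A := by
    rw [integral_mul_const, ρ.integral_normed, one_mul]
  rw [e]
  exact integral_mono (ρ.integrable_normed.mul_const A) (integrable_normed_mul ρ (by fun_prop))
    fun ζ => mul_le_mul_of_nonneg_left (h _) (ρ.nonneg_normed ζ)

theorem abs_mollify_sub_mollify_le (ρ : ContDiffBump (0 : ℝ)) {m : ℝ → ℝ} (hm : Continuous m)
    {L : ℝ} (h : ∀ x z, |m z - m x| ≤ L * |z - x|) (x z : ℝ) :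
    |mollify ρ m z - mollify ρ m x| ≤ L * |z - x| := by
  have key : ∀ x z, mollify ρ m z ≤ mollify ρ m x + L * |z - x| := fun x z =>
    mollify_sub_le ρ hm fun ζ => by
      have := (abs_le.1 (h (x - ζ) (z - ζ))).2
      rw [sub_sub_sub_cancel_right] at this
      linarith
  have h1 := key x z
  have h2 := key z x
  rw [abs_sub_comm x z] at h2
  exact abs_le.2 ⟨by linarith, by linarith⟩

/-! ### Existence of approximation schemes -/

theorem iteratedDeriv_succ_affine (n : ℕ) (a b x : ℝ) :
    |iteratedDeriv (n + 1) (fun x => a + b * x) x| ≤ |b| := by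
  have h1 : deriv (fun x => a + b * x) = fun _ => b := by
    funext y
    exact ((((hasDerivAt_id y).const_mul b).const_add a).congr_deriv (by simp)).deriv
  rw [iteratedDeriv_succ', h1, iteratedDeriv_const]
  split_ifs <;> simp

theorem exists_bound_iteratedDeriv {k : ℝ → ℝ} (hk : ContDiff ℝ ((⊤ : ℕ∞) : WithTop ℕ∞) k)
    {X a b a' b' : ℝ} (hr : ∀ x, X ≤ x → k x = a + b * x) (hl : ∀ x, x ≤ -X → k x = a' + b' * x)
    {n : ℕ} (hn : 1 ≤ n) : ∃ C : ℝ, ∀ x, |iteratedDeriv n k x| ≤ C := by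
  obtain ⟨n, rfl⟩ : ∃ m, n = m + 1 := ⟨n - 1, by omega⟩
  have hc : Continuous (iteratedDeriv (n + 1) k) :=
    hk.continuous_iteratedDeriv (n + 1) (by exact_mod_cast le_top)
  obtain ⟨N, hN⟩ := (isCompact_Icc (a := -X) (b := X)).exists_bound_of_continuousOn hc.continuousOn
  refine ⟨|N| + |b| + |b'|, fun x => ?_⟩
  have hb := abs_nonneg b
  have hb' := abs_nonneg b'
  have hN0 := abs_nonneg N
  rcases lt_or_ge X x with h | h
  · have : k =ᶠ[𝓝 x] fun x => a + b * x := by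
      filter_upwards [Ioi_mem_nhds h] with y hy
      exact hr y (le_of_lt hy)
    rw [this.iteratedDeriv_eq]
    linarith [iteratedDeriv_succ_affine n a b x]
  · rcases lt_or_ge x (-X) with h' | h'
    · have : k =ᶠ[𝓝 x] fun x => a' + b' * x := by
        filter_upwards [Iio_mem_nhds h'] with y hy
        exact hl y (le_of_lt hy)
      rw [this.iteratedDeriv_eq]
      linarith [iteratedDeriv_succ_affine n a' b' x]
    · have := hN x ⟨h', h⟩
      rw [Real.norm_eq_abs] at this
      linarith [le_abs_self N]

theorem continuous_of_abs_sub_le {k : ℝ → ℝ} {L : ℝ} (h : ∀ x z, |k z - k x| ≤ L * |z - x|) :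
    UniformContinuous k := by
  have : LipschitzWith L.toNNReal k := LipschitzWith.of_dist_le_mul fun x y => by
    rw [Real.dist_eq, Real.dist_eq]
    exact (h y x).trans (mul_le_mul_of_nonneg_right (Real.le_coe_toNNReal L) (abs_nonneg _))
  exact this.uniformContinuous

/-- The majorants have slopes `±L` at infinity with `L` independent of `K`, so growth and weights
are controlled uniformly. The weight mollifies `max (m K) 0 + 1`; far out this is affine and equal
to `|m K| + 1`, and mollification does not change it. -/
theorem IsSecondPrimitive.exists_scheme {γ Γ : ℝ → ℝ} (hΓ : IsSecondPrimitive γ Γ) {ι Q : ℝ}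
    (hι0 : 0 < ι) (hι : ∀ x, ι ≤ γ x) (hQ : ∀ x, |γ x| ≤ Q) {k : ℝ → ℝ}
    (hk : UniformContinuous k) (hc : ConcaveOn ℝ univ fun x => k x - Γ x) :
    ∃ (ε₀ : ℝ) (gK : ℝ → ℝ → ℝ) (xK : ℝ → ℝ) (κ : ℝ → ℝ → ℝ),
      IsApproximationScheme γ k ε₀ gK xK κ ∧ LocallyBoundedWeights κ := by
  obtain ⟨L, hL1, hLip, hs⟩ := exists_lipschitz_of_concaveOn_sub hΓ hQ hk hc
  have hL : 0 ≤ L := by linarith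
  have hex : ∀ K : ℝ, ∃ m : ℝ → ℝ, 0 < K → (∀ x ∈ Icc (-K) K, m x = k x) ∧ (∀ x, k x ≤ m x) ∧
      (∀ x z, |m z - m x| ≤ L * |z - x|) ∧ ConcaveOn ℝ univ (fun x => m x - Γ x) ∧
      (∀ x, K + 2 * L / ι ≤ x → m x = m (K + 2 * L / ι) + L * (x - (K + 2 * L / ι))) ∧
      ∀ x, x ≤ -(K + 2 * L / ι) →
        m x = m (-(K + 2 * L / ι)) + -L * (x - -(K + 2 * L / ι)) := by
    intro K
    by_cases hK : 0 < K
    · obtain ⟨m, hm⟩ := hΓ.exists_majorant hι0 hι hLip hL hs hK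
      exact ⟨m, fun _ => hm⟩
    · exact ⟨0, fun h => absurd h hK⟩
  choose m hm using hex
  have h2L : 0 ≤ 2 * L / ι := by positivity
  obtain ⟨ρ, hρ⟩ : ∃ ρ : ContDiffBump (0 : ℝ), ρ.rOut = 1 :=
    ⟨⟨1 / 2, 1, by norm_num, by norm_num⟩, rfl⟩
  set p : ℝ → ℝ → ℝ := fun K x => max (m K x) 0 + 1 with hp
  have hpl : ∀ K > 0, ∀ x z, |p K z - p K x| ≤ L * |z - x| := fun K hK x z => by
    simp only [hp]
    rw [add_sub_add_right_eq_sub]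
    exact (abs_max_sub_max_le_abs _ _ _).trans ((hm K hK).2.2.1 x z)
  have hpc : ∀ K > 0, Continuous (p K) := fun K hK =>
    (continuous_of_abs_sub_le (hpl K hK)).continuous
  have hm0 : ∀ K > 0, m K 0 = k 0 := fun K hK => (hm K hK).1 0 ⟨by linarith, hK.le⟩
  set X : ℝ → ℝ := fun K => K + 2 * L / ι with hX
  -- From `0` to `X K` the majorant drops by at most `L * X K` and afterwards it rises with slope
  -- `L`. Since `L ≥ 1`, the extra distance `|k 0|` makes up for a negative value at `0`.
  have hpos : ∀ K > 0, ∀ x, 2 * X K + |k 0| ≤ |x| → 0 ≤ m K x ∧ X K ≤ |x| := by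
    intro K hK x hx
    have hX0 : 0 ≤ X K := by simp only [hX]; linarith
    have hk0 := abs_nonneg (k 0)
    refine ⟨?_, by linarith⟩
    obtain ⟨-, -, h3, -, h5, h6⟩ := hm K hK
    have e1 : L * |k 0| ≤ L * (|x| - 2 * X K) := mul_le_mul_of_nonneg_left (by linarith) hL
    have e2 : |k 0| ≤ L * |k 0| := le_mul_of_one_le_left hk0 hL1
    have e3 := neg_abs_le (k 0)
    rcases le_total 0 x with h0 | h0
    · rw [abs_of_nonneg h0] at hx e1
      have h7 := h5 x (by simp only [hX] at hx hX0; linarith)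
      have h8 := (abs_le.1 (h3 0 (X K))).1
      rw [hm0 K hK, sub_zero, abs_of_nonneg hX0] at h8
      rw [h7]
      change 0 ≤ m K (X K) + L * (x - X K)
      linarith
    · rw [abs_of_nonpos h0] at hx e1
      have h7 := h6 x (by simp only [hX] at hx hX0; linarith)
      have h8 := (abs_le.1 (h3 0 (-X K))).1
      rw [hm0 K hK, sub_zero, abs_neg, abs_of_nonneg hX0] at h8
      rw [h7]
      change 0 ≤ m K (-X K) + -L * (x - -X K)
      linarith
  -- The last `1` is the radius of the mollifier.
  set Y : ℝ → ℝ := fun K => 2 * X K + |k 0| + 1 with hY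
  have hYX : ∀ K > 0, X K ≤ Y K := fun K hK => by
    have := abs_nonneg (k 0)
    simp only [hY, hX]
    linarith
  have hright : ∀ K > 0, ∀ x, Y K ≤ x → mollify ρ (p K) x =
      (m K (X K) - L * X K + 1) + L * x ∧ m K x = (m K (X K) - L * X K) + L * x ∧ 0 ≤ m K x := by
    intro K hK x hx
    have hX0 : 0 ≤ X K := by simp only [hX]; linarith
    have hk0 := abs_nonneg (k 0)
    have haff : ∀ w, |w - x| < 1 → 0 ≤ m K w ∧ m K w = (m K (X K) - L * X K) + L * w := by
      intro w hw
      have hw' : 2 * X K + |k 0| ≤ w := by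
        have := (abs_lt.1 hw).1
        simp only [hY] at hx
        linarith
      obtain ⟨h1, h2⟩ := hpos K hK w (hw'.trans (le_abs_self w))
      refine ⟨h1, ?_⟩
      rw [(hm K hK).2.2.2.2.1 w (by change X K ≤ w; linarith)]
      change m K (X K) + L * (w - X K) = _
      ring
    obtain ⟨h1, h2⟩ := haff x (by simp)
    refine ⟨mollify_eq_affine ρ fun w hw => ?_, h2, h1⟩
    obtain ⟨h3, h4⟩ := haff w (by rwa [hρ] at hw)
    simp only [hp]
    rw [max_eq_left h3, h4]
    ring
  have hleft : ∀ K > 0, ∀ x, x ≤ -Y K → mollify ρ (p K) x =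
      (m K (-X K) - L * X K + 1) + -L * x ∧ m K x = (m K (-X K) - L * X K) + -L * x ∧
        0 ≤ m K x := by
    intro K hK x hx
    have hX0 : 0 ≤ X K := by simp only [hX]; linarith
    have hk0 := abs_nonneg (k 0)
    have haff : ∀ w, |w - x| < 1 → 0 ≤ m K w ∧ m K w = (m K (-X K) - L * X K) + -L * w := by
      intro w hw
      have hw' : 2 * X K + |k 0| ≤ -w := by
        have := (abs_lt.1 hw).2
        simp only [hY] at hx
        linarith
      obtain ⟨h1, h2⟩ := hpos K hK w (hw'.trans (neg_le_abs w))
      refine ⟨h1, ?_⟩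
      rw [(hm K hK).2.2.2.2.2 w (by change w ≤ -X K; linarith)]
      change m K (-X K) + -L * (w - -X K) = _
      ring
    obtain ⟨h1, h2⟩ := haff x (by simp)
    refine ⟨mollify_eq_affine ρ fun w hw => ?_, h2, h1⟩
    obtain ⟨h3, h4⟩ := haff w (by rwa [hρ] at hw)
    simp only [hp]
    rw [max_eq_left h3, h4]
    ring
  have hsm : ∀ K > 0, ContDiff ℝ ((⊤ : ℕ∞) : WithTop ℕ∞) (mollify ρ (p K)) := fun K hK =>
    contDiff_mollify ρ (hpc K hK)
  have hlipm : ∀ K > 0, ∀ x, |deriv (mollify ρ (p K)) x| ≤ L := fun K hK x => by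
    have : LipschitzWith L.toNNReal (mollify ρ (p K)) := LipschitzWith.of_dist_le_mul fun x y => by
      rw [Real.dist_eq, Real.dist_eq, Real.coe_toNNReal _ hL]
      exact abs_mollify_sub_mollify_le ρ (hpc K hK) (hpl K hK) y x
    have h1 := norm_deriv_le_of_lipschitz this (x₀ := x)
    rwa [Real.coe_toNNReal _ hL] at h1
  have hmg : ∀ K > 0, ∀ x, |m K x| ≤ (|k 0| + L) * (1 + |x|) := fun K hK x => by
    have h1 := (hm K hK).2.2.1 0 x
    rw [hm0 K hK, sub_zero] at h1
    have h2 := abs_sub_abs_le_abs_sub (m K x) (k 0)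
    have h3 : 0 ≤ |k 0| * |x| := by positivity
    linarith
  -- The weights have slope at most `L`, strictly below `L + 2`, the inverse of the chosen bound on
  -- `ε`.
  have hε : 1 / (1 / (L + 2)) = L + 2 := one_div_one_div _
  refine ⟨1 / (L + 2), m, Y, fun K => mollify ρ (p K), ⟨by positivity, ?_, fun K hK => ?_,
    fun K hK => ?_, fun K hK => ?_, fun K hK => ?_, fun K hK => (hm K hK).1,
    fun K hK => (hm K hK).2.1, fun K hK Γ' hΓ' => hΓ.concaveOn_sub hΓ' (hm K hK).2.2.2.1,
    ⟨_, hmg⟩, hsm, fun K hK n hn => ?_, fun K hK => ⟨1, one_pos, ?_⟩, fun K hK x hx => ?_,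
    fun K hK x => ?_⟩, fun R => ?_⟩
  · rw [div_lt_one (by linarith)]
    linarith
  · exact continuous_of_abs_sub_le (hm K hK).2.2.1
  · have := hYX K hK
    simp only [hX] at this
    linarith
  · exact ⟨_, _, fun x hx => (hright K hK x hx).2.1⟩
  · exact ⟨_, _, fun x hx => (hleft K hK x hx).2.1⟩
  · exact exists_bound_iteratedDeriv (hsm K hK) (fun x hx => (hright K hK x hx).1)
      (fun x hx => (hleft K hK x hx).1) hn
  · refine le_mollify ρ (hpc K hK) fun x => ?_
    have : 0 ≤ max (m K x) 0 := le_max_right _ _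
    simp only [hp]
    linarith
  · rcases le_total 0 x with h0 | h0
    · rw [abs_of_nonneg h0] at hx
      obtain ⟨h1, h2, h3⟩ := hright K hK x hx
      rw [abs_of_nonneg h3, h1, h2]
      ring
    · rw [abs_of_nonpos h0] at hx
      obtain ⟨h1, h2, h3⟩ := hleft K hK x (by linarith)
      rw [abs_of_nonneg h3, h1, h2]
      ring
  · rw [hε]
    have := abs_le.1 (hlipm K hK x)
    exact ⟨by linarith, by linarith⟩
  · refine ⟨(|k 0| + L) * (1 + |R|) + 1 + L, ?_⟩
    filter_upwards [eventually_gt_atTop 0] with K hK x hx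
    have h1 := (abs_le.1 (abs_mollify_sub_le ρ (hpc K hK) (z := x) (ε := L) fun w hw => by
      rw [hρ, Real.dist_eq] at hw
      exact (hpl K hK x w).trans (mul_le_of_le_one_right hL hw.le))).2
    have h2 := (le_abs_self _).trans (hmg K hK x)
    have h3 : |x| ≤ |R| := (abs_le.2 hx).trans (le_abs_self R)
    have h4 : (|k 0| + L) * (1 + |x|) ≤ (|k 0| + L) * (1 + |R|) :=
      mul_le_mul_of_nonneg_left (by linarith) (by positivity)
    have h5 : max (m K x) 0 ≤ (|k 0| + L) * (1 + |R|) := max_le (h2.trans h4) (by positivity)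
    simp only [hp] at h1 ⊢
    linarith

/-! ### The shaken sets -/

section
variable {κ : ℝ → ℝ} {ε η : ℝ}

theorem mem_shakenSet (hκ : ∀ x, 0 < κ x) {x x' : ℝ} :
    x' ∈ shakenSet κ ε x ↔ |x - x'| ≤ ε * κ x' := by
  simp only [shakenSet, mem_ofPred_eq, mem_Icc]
  rw [le_div_iff₀ (hκ x'), div_le_iff₀ (hκ x'), abs_le, neg_mul]

theorem shakenSet_zero (hκ : ∀ x, 0 < κ x) : shakenSet κ 0 = fun x => {x} := by
  funext x
  ext x'
  rw [mem_shakenSet hκ, zero_mul, mem_singleton_iff, abs_nonpos_iff, sub_eq_zero]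
  exact eq_comm

theorem abs_sub_le_of_mem_shakenSet (hκ : ∀ x, 0 < κ x)
    (hη : ∀ x y, |κ y - κ x| ≤ η * |y - x|) (hε : 0 ≤ ε) {x x' : ℝ} (h : x' ∈ shakenSet κ ε x) :
    (1 - ε * η) * |x' - x| ≤ ε * κ x := by
  rw [mem_shakenSet hκ, abs_sub_comm] at h
  have h1 := mul_le_mul_of_nonneg_left ((le_abs_self _).trans (hη x x')) hε
  linarith

/-- A point `x'` of the set solves `x' + c * κ x' = x` with `|c| ≤ ε`. Keeping `c` and moving `x` to
`y`, the left-hand side grows at rate at least `1 - ε * η > 0`, so the intermediate value theorem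
gives a solution within the stated distance. -/
theorem isLipschitzFamily_shakenSet (hκ : ∀ x, 0 < κ x)
    (hη : ∀ x y, |κ y - κ x| ≤ η * |y - x|) (hη0 : 0 ≤ η) (hε : 0 ≤ ε) (hεη : ε * η < 1) :
    IsLipschitzFamily (shakenSet κ ε) (1 / (1 - ε * η)) := by
  have hθ : 0 < 1 - ε * η := by linarith
  have hκc : Continuous κ := (continuous_of_abs_sub_le hη).continuous
  refine ⟨fun x => ?_, fun x => ?_, by positivity, fun x y x' hx' => ?_⟩
  · rw [mem_shakenSet hκ, sub_self, abs_zero]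
    exact mul_nonneg hε (hκ x).le
  · refine IsCompact.of_isClosed_subset (isCompact_closedBall x (ε * κ x / (1 - ε * η))) ?_ ?_
    · have : shakenSet κ ε x = {x' | |x - x'| ≤ ε * κ x'} := by
        ext x'
        exact mem_shakenSet hκ
      rw [this]
      exact isClosed_le (by fun_prop) (by fun_prop)
    · intro x' hx'
      rw [mem_closedBall_iff_norm, Real.norm_eq_abs, le_div_iff₀ hθ, mul_comm]
      exact abs_sub_le_of_mem_shakenSet hκ hη hε hx'
  · set r := 1 / (1 - ε * η) * |y - x| with hr
    have hr0 : 0 ≤ r := by positivity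
    have hrx : (1 - ε * η) * r = |y - x| := by rw [hr]; field_simp
    set c := (x - x') / κ x' with hc
    have hcabs : |c| ≤ ε := abs_le.2 hx'
    have hcx : c * κ x' = x - x' := by rw [hc]; field_simp [(hκ x').ne']
    have hbound : ∀ w, |w - x'| ≤ r → |c * (κ w - κ x')| ≤ ε * η * r := by
      intro w hw
      rw [abs_mul, mul_assoc]
      exact mul_le_mul hcabs ((hη x' w).trans (mul_le_mul_of_nonneg_left hw hη0)) (abs_nonneg _) hε
    have hxy := abs_le.1 hrx.ge
    obtain ⟨y', hy', hyy⟩ := intermediate_value_Icc (f := fun w => w + c * κ w)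
      (show x' - r ≤ x' + r by linarith) (by fun_prop) (show y ∈ Icc _ _ by
        have h1 := abs_le.1 (hbound (x' - r) (by simp [abs_of_nonneg hr0]))
        have h2 := abs_le.1 (hbound (x' + r) (by simp [abs_of_nonneg hr0]))
        constructor
        · linarith [h1.2]
        · linarith [h2.1])
    refine ⟨y', ?_, abs_le.2 ⟨by linarith [hy'.1], by linarith [hy'.2]⟩⟩
    rw [mem_shakenSet hκ, ← hyy]
    simp only [add_sub_cancel_left]
    rw [abs_mul, abs_of_pos (hκ y')]
    exact mul_le_mul_of_nonneg_right hcabs (hκ y').le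

end

/-! ### The weights of an approximation scheme -/

theorem exists_affine_abs {k : ℝ → ℝ} {X a b : ℝ} (h : ∀ x, X ≤ x → k x = a + b * x) :
    ∃ X' a' b', X ≤ X' ∧ ∀ x, X' ≤ x → |k x| = a' + b' * x := by
  rcases lt_trichotomy b 0 with hb | hb | hb
  · refine ⟨max X (|a| / -b), -a, -b, le_max_left _ _, fun x hx => ?_⟩
    have h1 := (le_max_right _ _).trans hx
    rw [div_le_iff₀ (by linarith)] at h1
    rw [h x ((le_max_left _ _).trans hx), abs_of_nonpos (by linarith [le_abs_self a])]
    ring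
  · refine ⟨X, |a|, 0, le_rfl, fun x hx => ?_⟩
    rw [h x hx, hb]
    simp
  · refine ⟨max X (|a| / b), a, b, le_max_left _ _, fun x hx => ?_⟩
    have h1 := (le_max_right _ _).trans hx
    rw [div_le_iff₀ hb] at h1
    rw [h x ((le_max_left _ _).trans hx), abs_of_nonneg (by linarith [neg_abs_le a])]

theorem deriv_eq_of_affine {k : ℝ → ℝ} {X a b : ℝ} (h : ∀ x, X ≤ x → k x = a + b * x) {x : ℝ}
    (hx : X < x) : deriv k x = b := by
  have : k =ᶠ[𝓝 x] fun x => a + b * x := by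
    filter_upwards [Ioi_mem_nhds hx] with y hy
    exact h y (le_of_lt hy)
  rw [this.deriv_eq]
  exact ((((hasDerivAt_id x).const_mul b).const_add a).congr_deriv (by simp)).deriv

section
variable {γ ghat : ℝ → ℝ} {ε₀ : ℝ} {gK : ℝ → ℝ → ℝ} {xK : ℝ → ℝ} {κ : ℝ → ℝ → ℝ} {K : ℝ}

theorem IsApproximationScheme.kappa_pos (hs : IsApproximationScheme γ ghat ε₀ gK xK κ)
    (hK : 0 < K) (x : ℝ) : 0 < κ K x := by
  obtain ⟨c, hc, h⟩ := hs.kappa_inf_pos K hK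
  exact hc.trans_le (h x)

/-- The strict pointwise bound on the slope has to be made uniform, so that `ε = ε₀` is allowed. Far
out `κ K` is `|gK K| + 1` with `gK K` affine, so its derivative is eventually constant on each side
and `|deriv (κ K)|` attains its maximum on a compact set. -/
theorem IsApproximationScheme.exists_lipschitz (hs : IsApproximationScheme γ ghat ε₀ gK xK κ)
    (hK : 0 < K) : ∃ η, 0 ≤ η ∧ ε₀ * η < 1 ∧ ∀ x y, |κ K y - κ K x| ≤ η * |y - x| := by
  have hε := hs.eps_pos
  have hsm : ContDiff ℝ 1 (κ K) := (hs.kappa_smooth K hK).of_le (by exact_mod_cast le_top)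
  have hdc : Continuous (deriv (κ K)) := hsm.continuous_deriv le_rfl
  have hxK : 0 < xK K := hK.trans_le (hs.le_xK K hK)
  obtain ⟨a, b, hr⟩ := hs.gK_affine_right K hK
  obtain ⟨a', b', hl⟩ := hs.gK_affine_left K hK
  obtain ⟨X₁, a₁, b₁, hX₁, h₁⟩ := exists_affine_abs hr
  obtain ⟨X₂, a₂, b₂, hX₂, h₂⟩ := exists_affine_abs (k := fun x => gK K (-x)) (X := xK K)
    (a := a') (b := -b') (fun x hx => by rw [hl (-x) (by linarith)]; ring)
  have d₁ : ∀ x, X₁ < x → deriv (κ K) x = b₁ := fun x hx =>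
    deriv_eq_of_affine (X := X₁) (a := a₁ + 1) (fun y hy => by
      rw [hs.kappa_eq K hK y (by rw [abs_of_nonneg (by linarith)]; linarith), h₁ y hy]
      ring) hx
  have d₂ : ∀ x, X₂ < x → deriv (κ K) (-x) = -b₂ := fun x hx => by
    have h3 := deriv_eq_of_affine (k := fun x => κ K (-x)) (X := X₂) (a := a₂ + 1) (b := b₂)
      (fun y hy => by
        rw [hs.kappa_eq K hK (-y) (by rw [abs_neg, abs_of_nonneg (by linarith)]; linarith), h₂ y hy]
        ring) hx
    rw [deriv_comp_neg] at h3
    linarith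
  set Y := max X₁ X₂ + 1 with hY
  have hY1 : X₁ < Y := by linarith [le_max_left X₁ X₂]
  have hY2 : X₂ < Y := by linarith [le_max_right X₁ X₂]
  have hY0 : 0 < Y := by linarith
  obtain ⟨z, -, hmax⟩ := (isCompact_Icc (a := -Y) (b := Y)).exists_isMaxOn
    ⟨0, by linarith, hY0.le⟩ hdc.abs.continuousOn
  have hall : ∀ x, |deriv (κ K) x| ≤ |deriv (κ K) z| := by
    intro x
    rcases lt_or_ge Y x with h | h
    · rw [d₁ x (hY1.trans h), ← d₁ Y hY1]
      exact hmax (right_mem_Icc.2 (by linarith))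
    · rcases lt_or_ge x (-Y) with h' | h'
      · have h3 := d₂ (-x) (by linarith)
        rw [neg_neg] at h3
        rw [h3, ← d₂ Y hY2]
        exact hmax (left_mem_Icc.2 (by linarith))
      · exact hmax ⟨h', h⟩
  refine ⟨|deriv (κ K) z|, abs_nonneg _, ?_, fun x y => ?_⟩
  · have := abs_lt.2 (hs.kappa_slope K hK z)
    rw [lt_div_iff₀ hε] at this
    linarith
  · exact convex_univ.norm_image_sub_le_of_norm_deriv_le
      (fun x _ => hsm.differentiable one_ne_zero x) (fun x _ => hall x) (mem_univ x) (mem_univ y)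

theorem IsApproximationScheme.isLipschitzFamily (hs : IsApproximationScheme γ ghat ε₀ gK xK κ)
    (hK : 0 < K) {ε : ℝ} (hε : ε ∈ Icc 0 ε₀) : ∃ L, IsLipschitzFamily (shakenSet (κ K) ε) L := by
  obtain ⟨η, hη0, hη1, hη⟩ := hs.exists_lipschitz hK
  exact ⟨_, isLipschitzFamily_shakenSet (hs.kappa_pos hK) hη hη0 hε.1
    ((mul_le_mul_of_nonneg_right hε.2 hη0).trans_lt hη1)⟩

/-- For `2 * ε ≤ ε₀` the factor `1 - ε * η` is at least `1 / 2` whatever `K` is, so the bound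
involves `K` only through `κ K x`. -/
theorem IsApproximationScheme.abs_sub_le_of_mem (hs : IsApproximationScheme γ ghat ε₀ gK xK κ)
    (hK : 0 < K) {ε : ℝ} (hε0 : 0 ≤ ε) (hε1 : 2 * ε ≤ ε₀) {x x' : ℝ}
    (h : x' ∈ shakenSet (κ K) ε x) : |x' - x| ≤ 2 * ε * κ K x := by
  obtain ⟨η, hη0, hη1, hη⟩ := hs.exists_lipschitz hK
  have h1 := abs_sub_le_of_mem_shakenSet (hs.kappa_pos hK) hη hε0 h
  have h2 : 2 * ε * η ≤ ε₀ * η := mul_le_mul_of_nonneg_right hε1 hη0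
  have h3 : 1 / 2 * |x' - x| ≤ (1 - ε * η) * |x' - x| :=
    mul_le_mul_of_nonneg_right (by linarith) (abs_nonneg _)
  linarith

end

end GammaPricing

namespace GammaPricing

/-! ### The limit equation and the approximations -/

theorem StandingAssumptions.exists_coeffBounds {T : ℝ} {f σ γ Γ g : ℝ → ℝ}
    (hyp : StandingAssumptions T f σ γ Γ g) : ∃ c B ι, CoeffBounds f σ γ c B ι := by
  obtain ⟨c, hc, hfc⟩ := hyp.f_inf_pos
  obtain ⟨B, hB⟩ := hyp.sigma_bounded
  obtain ⟨ι, hι, hγ⟩ := hyp.gamma_gap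
  obtain ⟨L, hL⟩ := hyp.sigma_lipschitz
  exact ⟨c, B, ι, hyp.f_contDiff.continuous, hL.continuous, hyp.gamma_continuous, hc, hι, hfc, hB,
    fun x => (hγ x).1, fun x => (hγ x).2⟩

theorem StandingAssumptions.faceLift_growth {T : ℝ} {f σ γ Γ g : ℝ → ℝ}
    (hyp : StandingAssumptions T f σ γ Γ g) : ∃ C, ∀ x, |faceLift Γ g x| ≤ C * (1 + |x|) := by
  obtain ⟨Q, hQ⟩ := hyp.gamma_bounded
  obtain ⟨L, hL1, hL, -⟩ := exists_lipschitz_of_concaveOn_sub hyp.secondPrimitive hQ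
    hyp.faceLift_uniformContinuous (concaveOn_faceLift_sub Γ g)
  refine ⟨|faceLift Γ g 0| + L, fun x => ?_⟩
  have h1 := hL 0 x
  rw [sub_zero] at h1
  have h2 := abs_sub_abs_le_abs_sub (faceLift Γ g x) (faceLift Γ g 0)
  have h3 : 0 ≤ |faceLift Γ g 0| * |x| := by positivity
  linarith

theorem tendstoLocallyUniformlyOn_strip {T : ℝ} {α : Type*} {l : Filter α} {u : α → ℝ × ℝ → ℝ}
    {v : ℝ × ℝ → ℝ}
    (h : ∀ R, ∀ θ > 0, ∀ᶠ a in l, ∀ p ∈ strip T, |p.2| ≤ R → |u a p - v p| ≤ θ) :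
    TendstoLocallyUniformlyOn u v l (strip T) := by
  rw [Metric.tendstoLocallyUniformlyOn_iff]
  intro ε hε p hp
  refine ⟨{z | |z.2| < |p.2| + 1} ∩ strip T, ?_, ?_⟩
  · refine inter_mem (mem_nhdsWithin_of_mem_nhds ?_) self_mem_nhdsWithin
    exact ContinuousAt.eventually_lt (by fun_prop) continuousAt_const (by simp)
  · filter_upwards [h (|p.2| + 1) (ε / 2) (by linarith)] with a ha z hz
    rw [dist_comm, Real.dist_eq]
    exact (ha z hz.2 (le_of_lt hz.1)).trans_lt (by linarith)

section
variable {T : ℝ} {f σ γ h : ℝ → ℝ} {c B ι L : ℝ} {D : ℝ → Set ℝ} {v : ℝ × ℝ → ℝ}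

/-- By uniqueness the solution is the one squeezed between the barriers, whose bound depends neither
on `D` nor on the Lipschitz constant `L`. This is the growth bound uniform in the index that the
stability lemma requires. -/
theorem IsLinearGrowthSolution.abs_le (hb : CoeffBounds f σ γ c B ι)
    (hD : IsLipschitzFamily D L) (hT : 0 < T) (hh : Continuous h) {C : ℝ}
    (hC : ∀ x, |h x| ≤ C * (1 + |x|)) (hv : IsLinearGrowthSolution T (infOperator f σ γ D) h v)
    (hvc : ContinuousOn v (strip T)) {p : ℝ × ℝ} (hp : p ∈ strip T) :
    |v p| ≤ growthBound c B ι T C * (1 + |p.2|) := by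
  obtain ⟨w, hwc, hw, hwb⟩ := hb.exists_solution hD hT hh hC
  rw [hv.eqOn_of_continuousOn hb hD hT hh hvc hw hwc hp]
  exact hwb p hp

theorem CoeffBounds.exists_isUniqueContinuousSolution (hb : CoeffBounds f σ γ c B ι)
    (hD : IsLipschitzFamily D L) (hT : 0 < T) (hh : Continuous h)
    (hC : ∃ C, ∀ x, |h x| ≤ C * (1 + |x|)) :
    ∃ v, IsUniqueContinuousSolution T (infOperator f σ γ D) h v := by
  obtain ⟨C, hC⟩ := hC
  obtain ⟨v, hvc, hv, -⟩ := hb.exists_solution hD hT hh hC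
  exact ⟨v, ⟨hvc, hv⟩, fun w hwc hw => hw.eqOn_of_continuousOn hb hD hT hh hwc hv hvc⟩

/-- The pricing equation is the one without shaking. -/
noncomputable abbrev pricingOperator (f σ γ : ℝ → ℝ) (x q M : ℝ) : EReal :=
  ((pricingF f σ γ x q M : ℝ) : EReal)

theorem infOperator_le_pricingOperator (hD : IsLipschitzFamily D L) (x q M : ℝ) :
    infOperator f σ γ D x q M ≤ pricingOperator f σ γ x q M :=
  iInf₂_le x (hD.mem_self x)

/-- A terminal value that satisfies the gamma constraint is attained, also by the discontinuous
solutions. -/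
theorem CoeffBounds.subsolution_terminal_le (hb : CoeffBounds f σ γ c B ι) (hT : 0 < T)
    {Γ : ℝ → ℝ} (hΓ : IsSecondPrimitive γ Γ) (hh : Continuous h) {C : ℝ}
    (hC : ∀ x, |h x| ≤ C * (1 + |x|)) (hc : ConcaveOn ℝ univ fun x => h x - Γ x)
    {u : ℝ × ℝ → ℝ} (hu : IsViscositySubsolution T (pricingOperator f σ γ) h u)
    (hgu : HasLinearGrowth T u) (x : ℝ) : u (T, x) ≤ h x := by
  have hu' : IsViscositySubsolution T (infOperator f σ γ fun x => {x}) h u := by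
    rw [infOperator_singleton]; exact hu
  have hsup : IsViscositySupersolution T (infOperator f σ γ fun x => {x}) h
      fun z => h z.2 + driftBound c B ι * (T - z.1) :=
    hb.isViscositySupersolution_barrier hh (fun x => le_rfl) fun ψ hψ x hmin x' hx' => by
      rw [mem_singleton_iff.1 hx']
      have hΓ2 := hΓ.1
      have h1 := iteratedDeriv_two_nonpos_of_isLocalMin (c := fun y => h y - Γ y) (x := x)
        (ψ := fun y => ψ y + -1 * Γ y) (fun y => ConcaveOn.secondDiff_le hc x y) (by fun_prop) (by
          filter_upwards [hmin] with y hy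
          linarith)
      rw [iteratedDeriv_two_add hψ (by fun_prop), iteratedDeriv_two_const_mul _ hΓ2, hΓ.2] at h1
      linarith
  have := hu'.le_of_continuousOn hb isLipschitzFamily_singleton hT hh hgu hsup
    (hasLinearGrowth_affine hC _) (by fun_prop) (p := (T, x)) ⟨⟨hT.le, le_rfl⟩, mem_univ _⟩
  simpa using this

theorem CoeffBounds.le_supersolution_terminal (hb : CoeffBounds f σ γ c B ι) (hT : 0 < T)
    (hh : Continuous h) (hv : IsViscositySupersolution T (pricingOperator f σ γ) h v) (x : ℝ) :
    h x ≤ v (T, x) :=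
  hv.terminal_le (Λ := driftBound c B ι)
    (fun y _ M hq => EReal.coe_neg'.2 (hb.pricingF_neg_of_large (x := y) (M := M) hq)) hT hh x

/-- Uniqueness of the solution of the pricing equation among all solutions. -/
theorem CoeffBounds.eqOn_of_isLinearGrowthSolution (hb : CoeffBounds f σ γ c B ι) (hT : 0 < T)
    {Γ : ℝ → ℝ} (hΓ : IsSecondPrimitive γ Γ) (hh : Continuous h) {C : ℝ}
    (hC : ∀ x, |h x| ≤ C * (1 + |x|)) (hc : ConcaveOn ℝ univ fun x => h x - Γ x)
    (hv : IsLinearGrowthSolution T (pricingOperator f σ γ) h v) (hvc : ContinuousOn v (strip T))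
    {w : ℝ × ℝ → ℝ} (hw : IsLinearGrowthSolution T (pricingOperator f σ γ) h w) :
    EqOn w v (strip T) := by
  have hD := isLipschitzFamily_singleton
  have hvsub := hv.sub_self hvc
  have hvsup := hv.super_self hvc
  have hwsub := hw.sub
  have hwsup := hw.super
  intro p hp
  have hlow := lscEnvelope_le hw.growth hp
  have hup := le_uscEnvelope hw.growth hp
  have h1 : uscEnvelope T w p ≤ v p := by
    unfold pricingOperator at hvsup hwsub
    rw [← infOperator_singleton] at hvsup hwsub
    exact hwsub.le_of_continuousOn hb hD hT hh hw.growth.uscEnvelope hvsup hv.growth hvc hp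
  have h2 : v p ≤ lscEnvelope T w p := by
    -- At `T` comparison controls only the limit of the lower envelope from earlier times. There `v
    -- ≤ h`, by the gamma constraint on `h`, is combined with the bound `h` from below for
    -- supersolutions.
    rcases lt_or_eq_of_le hp.1.2 with hpT | hpT
    · unfold pricingOperator at hvsub hwsup
      rw [← infOperator_singleton] at hvsub hwsup
      rw [← extendSuper_of_lt (v := lscEnvelope T w) (A := driftBound c B ι) hpT]
      exact hvsub.le_extendSuper hb hD hT hh hv.growth hwsup hw.growth.lscEnvelope hp
    · have hp' : p = (T, p.2) := by rw [← hpT]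
      rw [hp']
      exact (hb.subsolution_terminal_le hT hΓ hh hC hc hvsub hv.growth p.2).trans
        (hb.le_supersolution_terminal hT hh hwsup p.2)
  linarith

/-- Stability: solutions with larger terminal values and smaller operators converge to the solution
of the pricing equation. -/
theorem CoeffBounds.tendsto_solution (hb : CoeffBounds f σ γ c B ι) (hT : 0 < T)
    (hh : Continuous h) (hv : IsLinearGrowthSolution T (pricingOperator f σ γ) h v)
    (hvc : ContinuousOn v (strip T)) {α : Type*} {l : Filter α} {u : α → ℝ × ℝ → ℝ}
    {D' : α → ℝ → Set ℝ} {h' : α → ℝ → ℝ} {C : ℝ}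
    (hu : ∀ᶠ a in l, IsLinearGrowthSolution T (infOperator f σ γ (D' a)) (h' a) (u a) ∧
      ContinuousOn (u a) (strip T) ∧ (∃ L, IsLipschitzFamily (D' a) L) ∧ Continuous (h' a) ∧
      (∀ x, |h' a x| ≤ C * (1 + |x|)) ∧ ∀ x, h x ≤ h' a x)
    (hD' : ∀ R, ∀ θ > 0, ∀ᶠ a in l, ∀ x, |x| ≤ R → ∀ x' ∈ D' a x, |x' - x| ≤ θ)
    (hh' : ∀ R, ∀ θ > 0, ∀ᶠ a in l, ∀ x, |x| ≤ R → h' a x ≤ h x + θ) :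
    TendstoLocallyUniformlyOn u v l (strip T) := by
  have hD := isLipschitzFamily_singleton
  have hvsub : IsViscositySubsolution T (infOperator f σ γ fun x => {x}) h v := by
    rw [infOperator_singleton]; exact hv.sub_self hvc
  have hvsup : IsViscositySupersolution T (infOperator f σ γ fun x => {x}) h v := by
    rw [infOperator_singleton]; exact hv.super_self hvc
  refine tendstoLocallyUniformlyOn_strip fun R θ hθ => ?_
  have hup := hvsup.eventually_le hb hD hT hv.growth hh (u := u) (D' := D') (h' := h')
    (C := growthBound c B ι T C) (hu.mono fun a ha => ha.1.sub_self ha.2.1)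
    (hu.mono fun a ⟨h1, h2, ⟨L, h3⟩, h4, h5, _⟩ p hp =>
      (le_abs_self _).trans (h1.abs_le hb h3 hT h4 h5 h2 hp))
    (fun R θ hθ => (hD' R θ hθ).mono fun a ha x hx x' hx' => ⟨x, rfl, ha x hx x' hx'⟩) hh' R hθ
  filter_upwards [hup, hu] with a h1 ⟨h2, h3, ⟨L, h4⟩, h5, h6, h7⟩ p hp hpR
  have h8 := h1 p hp hpR
  rw [extendSuper_eqOn hT hvc _ hp] at h8
  -- The lower bound holds for each approximation, without any limit: each `u a` is a supersolution
  -- of the limit problem.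
  have h9 : IsViscositySupersolution T (infOperator f σ γ fun x => {x}) h (u a) := by
    rw [infOperator_singleton]
    exact (h2.super_self h3).mono (infOperator_le_pricingOperator h4) h7
  have h10 := hvsub.le_of_continuousOn hb hD hT hh hv.growth h9 h2.growth h3 hp
  exact abs_le.2 ⟨by linarith, by linarith⟩

end

end GammaPricing

namespace GammaPricing

/-! ### Convergence of approximation schemes -/

section
variable {T : ℝ} {f σ γ k : ℝ → ℝ} {c B ι ε₀ : ℝ} {gK : ℝ → ℝ → ℝ} {xK : ℝ → ℝ} {κ : ℝ → ℝ → ℝ}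

theorem IsApproximationScheme.continuous_add_const
    (hs : IsApproximationScheme γ k ε₀ gK xK κ) {K : ℝ} (hK : 0 < K) (ε : ℝ) :
    Continuous fun x => gK K x + ε :=
  (hs.gK_uniformContinuous K hK).continuous.add continuous_const

theorem IsApproximationScheme.exists_growth (hs : IsApproximationScheme γ k ε₀ gK xK κ) :
    ∃ C, ∀ K > 0, ∀ ε ∈ Icc 0 ε₀, ∀ x, |gK K x + ε| ≤ C * (1 + |x|) := by
  obtain ⟨C, hC⟩ := hs.gK_growth
  refine ⟨C + 1, fun K hK ε hε x => ?_⟩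
  have h1 := hC K hK x
  have h2 := abs_add_le (gK K x) ε
  rw [abs_of_nonneg hε.1] at h2
  have h3 := hs.eps_lt_one
  have h4 := hε.2
  have h5 := abs_nonneg x
  linarith

theorem IsApproximationScheme.shakenF_zero (hs : IsApproximationScheme γ k ε₀ gK xK κ) {K : ℝ}
    (hK : 0 < K) : shakenF f σ γ (κ K) 0 = pricingOperator f σ γ := by
  change infOperator f σ γ (shakenSet (κ K) 0) = _
  rw [shakenSet_zero (hs.kappa_pos hK), infOperator_singleton]

theorem IsApproximationScheme.exists_solutions (hs : IsApproximationScheme γ k ε₀ gK xK κ)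
    (hb : CoeffBounds f σ γ c B ι) (hT : 0 < T) :
    ∃ v : ℝ → ℝ → ℝ × ℝ → ℝ, ∀ ε ∈ Icc 0 ε₀, ∀ K > 0,
      IsUniqueContinuousSolution T (shakenF f σ γ (κ K) ε) (fun x => gK K x + ε) (v ε K) := by
  obtain ⟨C, hC⟩ := hs.exists_growth
  have (ε K : ℝ) : ∃ w, ε ∈ Icc 0 ε₀ → 0 < K →
      IsUniqueContinuousSolution T (shakenF f σ γ (κ K) ε) (fun x => gK K x + ε) w := by
    by_cases h : ε ∈ Icc 0 ε₀ ∧ 0 < K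
    · obtain ⟨L, hL⟩ := hs.isLipschitzFamily h.2 h.1
      obtain ⟨w, hw⟩ := hb.exists_isUniqueContinuousSolution hL hT
        (hs.continuous_add_const h.2 ε) ⟨C, hC K h.2 ε h.1⟩
      exact ⟨w, fun _ _ => hw⟩
    · exact ⟨0, fun h1 h2 => absurd ⟨h1, h2⟩ h⟩
  choose v hv using this
  exact ⟨v, fun ε hε K hK => hv ε K hε hK⟩

variable {v : ℝ → ℝ → ℝ × ℝ → ℝ} {h : ℝ → ℝ} {w : ℝ × ℝ → ℝ}

/-- Convergence along any filter, as soon as the shaking vanishes and the terminal values converge,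
both locally uniformly. -/
theorem IsApproximationScheme.tendsto_solutions (hs : IsApproximationScheme γ k ε₀ gK xK κ)
    (hb : CoeffBounds f σ γ c B ι) (hT : 0 < T)
    (hv : ∀ ε ∈ Icc 0 ε₀, ∀ K > 0,
      IsUniqueContinuousSolution T (shakenF f σ γ (κ K) ε) (fun x => gK K x + ε) (v ε K))
    (hh : Continuous h) (hw : IsLinearGrowthSolution T (pricingOperator f σ γ) h w)
    (hwc : ContinuousOn w (strip T)) {α : Type*} {l : Filter α} {e K : α → ℝ}
    (he0 : ∀ᶠ a in l, 0 ≤ e a) (he : Tendsto e l (𝓝 0)) (hK : ∀ᶠ a in l, 0 < K a)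
    (hκ : ∀ R, ∃ C, ∀ᶠ a in l, ∀ x, |x| ≤ R → e a * κ (K a) x ≤ e a * C)
    (hle : ∀ᶠ a in l, ∀ x, h x ≤ gK (K a) x)
    (heq : ∀ R, ∀ᶠ a in l, ∀ x, |x| ≤ R → gK (K a) x = h x) :
    TendstoLocallyUniformlyOn (fun a => v (e a) (K a)) w l (strip T) := by
  obtain ⟨C, hC⟩ := hs.exists_growth
  have hsmall (θ : ℝ) (hθ : 0 < θ) : ∀ᶠ a in l, e a < θ := he.eventually_lt_const hθ
  have hp := hs.eps_pos
  refine hb.tendsto_solution hT hh hw hwc (D' := fun a => shakenSet (κ (K a)) (e a))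
    (h' := fun a x => gK (K a) x + e a) (C := C) ?_ (fun R θ hθ => ?_) fun R θ hθ => ?_
  · filter_upwards [he0, hsmall ε₀ hp, hK, hle] with a h1 h2 h3 h4
    have h5 : e a ∈ Icc 0 ε₀ := ⟨h1, h2.le⟩
    obtain ⟨⟨h6, h7⟩, -⟩ := hv _ h5 _ h3
    exact ⟨h7, h6, hs.isLipschitzFamily h3 h5, hs.continuous_add_const h3 _, hC _ h3 _ h5,
      fun x => (h4 x).trans (le_add_of_nonneg_right h1)⟩
  -- The hypothesis bounds `e a * κ` by `e a * C` rather than `κ` by `C`, so that it is void when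
  -- there is no shaking.
  · obtain ⟨C', hC'⟩ := hκ R
    have hlim : Tendsto (fun a => 2 * (e a * C')) l (𝓝 0) := by
      simpa using (he.mul_const C').const_mul 2
    filter_upwards [he0, hsmall (ε₀ / 2) (by linarith), hK, hC', hlim.eventually_lt_const hθ]
      with a h1 h2 h3 h4 h5 x hx x' hx'
    have h6 := hs.abs_sub_le_of_mem h3 h1 (by linarith) hx'
    have h7 := h4 x hx
    linarith
  · filter_upwards [heq R, hsmall θ hθ] with a h1 h2 x hx
    rw [h1 x hx]
    linarith

theorem IsApproximationScheme.eventually_eq (hs : IsApproximationScheme γ k ε₀ gK xK κ) (R : ℝ) :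
    ∀ᶠ K in atTop, ∀ x, |x| ≤ R → gK K x = k x := by
  filter_upwards [eventually_ge_atTop R, eventually_gt_atTop 0] with K h1 h2 x hx
  exact hs.gK_eq K h2 x (abs_le.1 (hx.trans h1))

theorem IsApproximationScheme.eventually_le (hs : IsApproximationScheme γ k ε₀ gK xK κ) :
    ∀ᶠ K in atTop, ∀ x, k x ≤ gK K x := by
  filter_upwards [eventually_gt_atTop 0] with K hK x using hs.le_gK K hK x

end

end GammaPricing

/-! ### Proof of the proposition -/

theorem mainTheorem9 (T : ℝ) (f σ γ Γ g : ℝ → ℝ)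
    (hyp : GammaPricing.StandingAssumptions T f σ γ Γ g) :
    -- approximation schemes exist, with weights that are locally bounded uniformly in `K`
    (∃ (ε₀ : ℝ) (gK : ℝ → ℝ → ℝ) (xK : ℝ → ℝ) (κ : ℝ → ℝ → ℝ),
      GammaPricing.IsApproximationScheme γ (GammaPricing.faceLift Γ g) ε₀ gK xK κ ∧
        GammaPricing.LocallyBoundedWeights κ) ∧
    ∃ vbar : ℝ × ℝ → ℝ,
      -- `vbar` is a continuous solution with linear growth, and takes the terminal value pointwise
      ContinuousOn vbar (GammaPricing.strip T) ∧
      GammaPricing.IsLinearGrowthSolution T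
        (fun x q M => ((GammaPricing.pricingF f σ γ x q M : ℝ) : EReal))
        (GammaPricing.faceLift Γ g) vbar ∧
      (∀ x : ℝ, vbar (T, x) = GammaPricing.faceLift Γ g x) ∧
      -- it is the only solution with linear growth, continuous or not
      (∀ w : ℝ × ℝ → ℝ,
        GammaPricing.IsLinearGrowthSolution T
          (fun x q M => ((GammaPricing.pricingF f σ γ x q M : ℝ) : EReal))
          (GammaPricing.faceLift Γ g) w →
        Set.EqOn w vbar (GammaPricing.strip T)) ∧
      -- it is the limit of the solutions for shaken coefficients, for every approximation scheme
      ∀ (ε₀ : ℝ) (gK : ℝ → ℝ → ℝ) (xK : ℝ → ℝ) (κ : ℝ → ℝ → ℝ),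
        GammaPricing.IsApproximationScheme γ (GammaPricing.faceLift Γ g) ε₀ gK xK κ →
        ∃ v : ℝ → ℝ → ℝ × ℝ → ℝ,
          (∀ ε ∈ Set.Icc 0 ε₀, ∀ K > 0,
            GammaPricing.IsUniqueContinuousSolution T (GammaPricing.shakenF f σ γ (κ K) ε)
              (fun x => gK K x + ε) (v ε K)) ∧
          (GammaPricing.LocallyBoundedWeights κ →
            TendstoLocallyUniformlyOn (fun (q : ℝ × ℝ) => v q.1 q.2) vbar
              (nhdsWithin 0 (Set.Ioi 0) ×ˢ Filter.atTop) (GammaPricing.strip T)) ∧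
          (∀ K > 0, TendstoLocallyUniformlyOn (fun ε : ℝ => v ε K) (v 0 K)
            (nhdsWithin 0 (Set.Ioi 0)) (GammaPricing.strip T)) ∧
          TendstoLocallyUniformlyOn (fun K : ℝ => v 0 K) vbar
            Filter.atTop (GammaPricing.strip T) := by
  obtain ⟨c, B, ι, hb⟩ := hyp.exists_coeffBounds
  obtain ⟨C, hC⟩ := hyp.faceLift_growth
  obtain ⟨Q, hQ⟩ := hyp.gamma_bounded
  obtain ⟨ι', hι', hγ⟩ := hyp.gamma_gap
  have hT := hyp.T_pos
  have hΓ := hyp.secondPrimitive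
  have huc := hyp.faceLift_uniformContinuous
  have hh := huc.continuous
  have hconc := GammaPricing.concaveOn_faceLift_sub Γ g
  obtain ⟨vbar, ⟨hvc, hv⟩, -⟩ := hb.exists_isUniqueContinuousSolution
    GammaPricing.isLipschitzFamily_singleton hT hh ⟨C, hC⟩
  rw [GammaPricing.infOperator_singleton] at hv
  refine ⟨hΓ.exists_scheme hι' (fun x => (hγ x).1) hQ huc hconc, vbar, hvc, hv, fun x => ?_,
    fun w hw => hb.eqOn_of_isLinearGrowthSolution hT hΓ hh hC hconc hv hvc hw, ?_⟩
  · exact le_antisymm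
      (hb.subsolution_terminal_le hT hΓ hh hC hconc (hv.sub_self hvc) hv.growth x)
      (hb.le_supersolution_terminal hT hh (hv.super_self hvc) x)
  intro ε₀ gK xK κ hs
  have h0 : (0 : ℝ) ∈ Icc 0 ε₀ := ⟨le_rfl, hs.eps_pos.le⟩
  obtain ⟨v, hsol⟩ := hs.exists_solutions hb hT
  refine ⟨v, hsol, fun hκ => ?_, fun K hK => ?_, ?_⟩
  -- In the joint limit the size of the shaking is `ε * κ K x`; the local bounds on the weights make
  -- it vanish locally uniformly.
  · refine hs.tendsto_solutions hb hT hsol hh hv hvc (e := Prod.fst) (K := Prod.snd) ?_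
      (tendsto_fst.mono_right nhdsWithin_le_nhds) (tendsto_snd.eventually_gt_atTop 0)
      (fun R => ?_) (tendsto_snd.eventually hs.eventually_le)
      fun R => tendsto_snd.eventually (hs.eventually_eq R)
    · exact tendsto_fst.eventually (eventually_mem_nhdsWithin.mono fun _ h => le_of_lt h)
    · obtain ⟨C', hC'⟩ := hκ R
      refine ⟨C', ?_⟩
      filter_upwards [tendsto_snd.eventually hC',
        tendsto_fst.eventually eventually_mem_nhdsWithin] with a h1 h2 x hx
      exact mul_le_mul_of_nonneg_left (h1 x (abs_le.1 hx)) (le_of_lt h2)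
  · obtain ⟨⟨h1, h2⟩, -⟩ := hsol 0 h0 K hK
    rw [hs.shakenF_zero hK] at h2
    simp only [add_zero] at h2
    -- For fixed `K` the limit problem is the unshaken one with payoff `gK K`, and continuity of the
    -- single weight `κ K` replaces local boundedness in `K`.
    refine hs.tendsto_solutions hb hT hsol (hs.gK_uniformContinuous K hK).continuous h2 h1
      (e := id) (K := fun _ => K) (eventually_mem_nhdsWithin.mono fun _ h => le_of_lt h)
      nhdsWithin_le_nhds (Eventually.of_forall fun _ => hK) (fun R => ?_)
      (Eventually.of_forall fun _ _ => le_rfl) fun R => Eventually.of_forall fun _ _ _ => rfl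
    obtain ⟨C', hC'⟩ := (isCompact_Icc (a := -R) (b := R)).bddAbove_image
      (hs.kappa_smooth K hK).continuous.continuousOn
    refine ⟨C', eventually_mem_nhdsWithin.mono fun ε hε x hx => ?_⟩
    exact mul_le_mul_of_nonneg_left (hC' (mem_image_of_mem _ (abs_le.1 hx))) (le_of_lt hε)
  -- With `ε = 0` throughout, the weights play no role and only the payoffs vary.
  · exact hs.tendsto_solutions hb hT hsol hh hv hvc (e := fun _ => 0) (K := id)
      (Eventually.of_forall fun _ => le_rfl) tendsto_const_nhds (eventually_gt_atTop 0)
      (fun R => ⟨0, by simp⟩) hs.eventually_le hs.eventually_eq
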